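/- **Setting.** A data collector is a triple $(\mathcal X,\pi,\pi_D)$ of an interactive machine $\mathcal X$, a two-party protocol $\pi$ and a two-party deletion protocol $\pi_D$, each with a client and a server side; a completed instance of $\pi$ defines a deletion token, a function of its session number and transcript. In an execution with security parameter $\lambda$, an environment $\mathcal Z$ and a deletion-requester $\mathcal Y$ (interactive Turing machines with $1^\lambda$ on their input tapes) initiate instances of $\pi,\pi_D$ with $\mathcal X$, which controls the server sides. $\mathcal Z$ may run arbitrary probabilistic polynomial-time (PPT) client machines and may send messages to $\mathcal Y$. $\mathcal Y$ uses the honest clients, never communicates with $\mathcal Z$, and runs $\pi_D$ only on deletion tokens of its own instances of $\pi$. One machine is active at a time: writing on the input or incoming tape of a machine activates it, writing on one's output tape activates the controlling machine, and if a machine stops otherwise then $\mathcal Z$ is activated. When $\mathcal Z$ halts or declares the end of this phase, the clients of $\mathcal Y$ for $\pi$ are run until they halt, then $\pi_D$ is initiated with the deletion token of each completed instance of $\pi$ of $\mathcal Y$ for which this has not happened yet, and the clients of $\mathcal Y$ for $\pi_D$ are run until they halt. Let $(\mathsf{state}_{\mathcal X}^{R,\lambda},\mathsf{view}_{\mathcal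 Z}^{R,\lambda})$ be the work tape of $\mathcal X$ and the contents of all other tapes of $\mathcal Z$ (including what it can read of the outputs of its clients) at the end, and let $(\mathsf{state}_{\mathcal X}^{I,\lambda},\mathsf{view}_{\mathcal Z}^{I,\lambda})$ be the same for the execution in which $\mathcal Y$ is replaced by a machine that always halts at once. $(\mathcal X,\pi,\pi_D)$ is *statistically deletion-compliant* if for all PPT $\mathcal Z$, all PPT $\mathcal Y$ and every (unbounded) distinguisher $D$ there is a negligible function $\varepsilon$ such that for all $\lambda\in\mathbb N$ $$\left|\Pr[D(\mathsf{state}_{\mathcal X}^{R,\lambda},\mathsf{view}_{\mathcal Z}^{R,\lambda})=1]-\Pr[D(\mathsf{state}_{\mathcal X}^{I,\lambda},\mathsf{view}_{\mathcal Z}^{I,\lambda})=1]\right|\le\varepsilon(\lambda).$$ A dictionary stores key-value pairs with the operations Insert (no effect if the key is in use), Lookup (returns $\bot$ if the key is not in use) and Delete (no effect if the key is not in use). An implementation of it, possibly randomized but always returning correct results, is *history-independent* if any two sequences of operations that produce the same content (every further sequence of operations returns the same results after either) induce the same distribution on the memory representation. **The storage collector.** $\mathcal X$ maintains a history-independent dictionary,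 and its work tape holds nothing but the memory of the dictionary. In $\pi$, the client sends its input $(inst,key,auth,value)$ to the server, where $auth$ or $value$ may be empty. If $inst=\mathsf{insert}$ and $value$ is not empty, the server hands $(\mathsf{insert},key,value)$ to $\mathcal X$; if $inst=\mathsf{lookup}$ and $auth$ is not empty, it hands over $(\mathsf{lookup},key,auth)$; otherwise it stops. The server sends the reply of $\mathcal X$ to the client, which outputs it. In $\pi_D$, the client with input $(key,auth)$ sends $(\mathsf{delete},key,auth)$ to the server, which hands the message it receives to $\mathcal X$. On $(\mathsf{insert},key,value)$, $\mathcal X$ samples $auth\in\{0,1\}^\lambda$ uniformly, inserts $value$ under $(key,auth)$ and replies $auth$; on $(\mathsf{lookup},key,auth)$, it replies with the result of the lookup of $(key,auth)$; on $(\mathsf{delete},key,auth)$, it deletes $(key,auth)$. The deletion token is $(key,auth)$, with the returned $auth$, for an insertion, and $\bot$ for a lookup. **Theorem.** For every history-independent implementation of the dictionary, the storage collector is statistically deletion-compliant. More precisely, for all PPT $\mathcal Z$ and $\mathcal Y$ there is a polynomial $p$ such that for all $\lambda\in\mathbb N$ the statistical distance between $(\mathsf{state}_{\mathcal X}^{R,\lambda},\mathsf{view}_{\mathcal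 Z}^{R,\lambda})$ and $(\mathsf{state}_{\mathcal X}^{I,\lambda},\mathsf{view}_{\mathcal Z}^{I,\lambda})$ is at most $p(\lambda)/2^\lambda$. -/

import Mathlib

/-! ## Data structures, their implementations, history independence -/

/-- An abstract data structure: every operation changes the abstract state and returns a result
(operations without a meaningful result return a null value). -/
structure AbstractDS (Op Res : Type) where
  State : Type
  init : State
  step : State → Op → State × Res

namespace AbstractDS

variable {Op Res : Type} (A : AbstractDS Op Res)

/-- The abstract state after a sequence of operations, started in `s`. -/
def stateFrom (s : A.State) : List Op → A.State
  | [] => s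
  | o :: os => stateFrom (A.step s o).1 os

/-- The results returned by a sequence of operations, started in `s`. -/
def resultsFrom (s : A.State) : List Op → List Res
  | [] => []
  | o :: os => (A.step s o).2 :: resultsFrom (A.step s o).1 os

/-- Two sequences of operations produce the same content: every further sequence `T` returns the
same results with either of them as prefix. -/
def SameContent (S₁ S₂ : List Op) : Prop :=
  ∀ T : List Op,
    A.resultsFrom (A.stateFrom A.init S₁) T = A.resultsFrom (A.stateFrom A.init S₂) T

end AbstractDS

/-- A randomized procedure that maintains a memory and processes operations one by one. -/
structure MemoryScheme (Op Res : Type) where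
  Mem : Type
  init : PMF Mem
  exec : Mem → Op → PMF (Mem × Res)

namespace MemoryScheme

variable {Op Res : Type} (I : MemoryScheme Op Res)

/-- Final memory and returned results of a sequence of operations, started in memory `m`. -/
noncomputable def runFrom (m : I.Mem) : List Op → PMF (I.Mem × List Res)
  | [] => PMF.pure (m, [])
  | o :: os => (I.exec m o).bind fun r =>
      (runFrom r.1 os).map fun t => (t.1, r.2 :: t.2)

noncomputable def run (S : List Op) : PMF (I.Mem × List Res) :=
  I.init.bind fun m => I.runFrom m S

/-- The distribution of the memory representation induced by a sequence of operations. -/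
noncomputable def memDist (S : List Op) : PMF I.Mem :=
  (I.run S).map Prod.fst

end MemoryScheme

/-- An implementation of an abstract data structure: it returns the prescribed results. -/
structure Implementation {Op Res : Type} (A : AbstractDS Op Res) extends
    MemoryScheme Op Res where
  correct : ∀ S : List Op, ∀ r ∈ (toMemoryScheme.run S).support, r.2 = A.resultsFrom A.init S

/-- Sequences of operations that produce the same content induce the same distribution on the
memory representation. -/
def Implementation.HistoryIndependent {Op Res : Type} {A : AbstractDS Op Res}
    (I : Implementation A) : Prop :=
  ∀ S₁ S₂ : List Op, A.SameContent S₁ S₂ → I.memDist S₁ = I.memDist S₂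

inductive DictOp (K V : Type) where
  | insert (key : K) (value : V)
  | lookup (key : K)
  | delete (key : K)

/-- The dictionary; `none` plays the role of `⊥` and of the null result. -/
def dictionary (K V : Type) [DecidableEq K] : AbstractDS (DictOp K V) (Option V) where
  State := K → Option V
  init := fun _ => none
  step := fun s o => match o with
    | .insert k v => ((if s k = none then Function.update s k (some v) else s), none)
    | .lookup k => (s, s k)
    | .delete k => (Function.update s k none, none)

/-! ## Interactive Turing machines -/

/-- Symbols on the communication tapes: bits, and the separation mark `none`. -/
abbrev TapeSymbol := Option Bool

abbrev Msg := List TapeSymbol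

/-- The two protocols through which a data collector is accessed: `pi`, and the deletion
protocol `del`. -/
inductive Kind where
  | pi
  | del
  deriving DecidableEq

/-- The read-only tapes other than the randomness tape. The tape `reports` gives access to the
output tapes of the controlled instances: whenever one of them writes on its output tape, the text
becomes readable here, after the identifier of the writer. -/
inductive RTape where
  | ident
  | input
  | incoming
  | control
  | reports
  deriving DecidableEq

/-- What a machine can do to the outside. The message concerned is the text that it has written
since its last such action. -/
inductive Act (κ : Type) where
  /-- write the message on the incoming tape of the deletion-requester -/
  | tellY
  /-- write on the input tape of a controlled instance; the message is `i` symbols, a separation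
  mark and the text, where `i` is the number of the instance -/
  | writeInput
  /-- initiate a protocol instance, choosing the code of its client side -/
  | initiate (k : Kind) (code : κ)
  | wakeX
  | wakeY
  | endAlive
  /-- write the message on the incoming tape of the other party of the protocol instance -/
  | send
  /-- write the message on the own output tape -/
  | output
  /-- stop for this activation, without writing on a tape of another machine -/
  | yield

/-- The symbols under the heads; `none` is the blank. One new cell of the randomness tape is read
in each step. -/
structure Scan (Γ : Type) where
  tape : RTape → Option TapeSymbol
  work : Γ
  coin : Bool

/-- The effect of one step: new control state, symbol written on the work tape, moves of the work
head and of the reading heads, a symbol that may be written, and an action that may be taken. -/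
structure Instr (κ Q Γ : Type) where
  next : Q
  write : Γ
  workMove : Option Turing.Dir
  move : RTape → Option Turing.Dir
  emit : Option TapeSymbol
  act : Option (Act κ)

/-- An interactive Turing machine. If `δ` is `none`, then the machine has halted: it takes no
step (until it is activated again and reads something else). -/
structure ITM (κ : Type) where
  Q : Type
  Γ : Type
  finQ : Finite Q
  finΓ : Finite Γ
  inhΓ : Inhabited Γ
  start : Q
  δ : Q → Scan Γ → Option (Instr κ Q Γ)

attribute [instance] ITM.finQ ITM.finΓ ITM.inhΓ

/-- The view of a machine: the contents of all its tapes but the work tape. Of the randomness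
tape, the part that has been read is recorded. -/
structure View where
  tape : RTape → Msg
  rand : List Bool
  outgoing : Msg
  output : Msg

namespace ITM

variable {κ : Type} (M : ITM κ)

/-- A configuration; `pending` is the text written since the last action. -/
structure Config where
  q : M.Q
  work : Turing.Tape M.Γ
  head : RTape → ℕ
  pending : Msg
  view : View

/-- The security parameter is written in unary on the input tape. -/
def init (secp : ℕ) : M.Config where
  q := M.start
  work := default
  head := fun _ => 0
  pending := []
  view :=
    { tape := fun t => if t = .input then List.replicate secp (some true) else []
      rand := []
      outgoing := []
      output := [] }

variable {M}

/-- Another machine appends text to a tape. -/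
def Config.write (c : M.Config) (t : RTape) (m : Msg) : M.Config :=
  { c with view := { c.view with tape := Function.update c.view.tape t (c.view.tape t ++ m) } }

def Config.scan (c : M.Config) (coin : Bool) : Scan M.Γ where
  tape := fun t => (c.view.tape t)[c.head t]?
  work := c.work.head
  coin := coin

/-- The incoming tape can be read only once. -/
def moveHead (t : RTape) (h : ℕ) : Option Turing.Dir → ℕ
  | none => h
  | some .right => h + 1
  | some .left => if t = .incoming then h else h - 1

/-- One step; it yields the action taken, if any, with its message. -/
def Config.step (c : M.Config) (coin : Bool) : Option (M.Config × Option (Act κ × Msg)) :=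
  (M.δ c.q (c.scan coin)).map fun i =>
    let pend := c.pending ++ i.emit.toList
    let work := c.work.write i.write
    ({ q := i.next
       work := match i.workMove with
         | none => work
         | some d => work.move d
       head := fun t => moveHead t (c.head t) (i.move t)
       pending := if i.act.isSome then [] else pend
       view :=
         { tape := c.view.tape
           rand := c.view.rand ++ [coin]
           outgoing := c.view.outgoing ++ i.emit.toList
           output := match i.act with
             | some .output => c.view.output ++ pend
             | _ => c.view.output } },
      i.act.map fun a => (a, pend))

/-- The number of steps made so far: each step reads one new cell of the randomness tape. -/
def Config.time (c : M.Config) : ℕ := c.view.rand.length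

/-- The number of symbols written on the input tape so far. -/
def Config.inputLength (c : M.Config) : ℕ := (c.view.tape .input).length

/-- The configurations that the machine can reach, whatever others write on its tapes. -/
inductive Reachable (M : ITM κ) (secp : ℕ) : M.Config → Prop
  | init : Reachable M secp (M.init secp)
  | write (c : M.Config) (t : RTape) (m : Msg) :
      Reachable M secp c → Reachable M secp (c.write t m)
  | step (c c' : M.Config) (coin : Bool) (a : Option (Act κ × Msg)) :
      Reachable M secp c → c.step coin = some (c', a) → Reachable M secp c'

/-- Probabilistic polynomial time: at any point of any run, the number of steps is bounded by a
fixed polynomial in the number of symbols written on the input tape. -/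
def PPT (M : ITM κ) : Prop :=
  ∃ c : ℕ, ∀ (secp : ℕ) (d : M.Config), M.Reachable secp d → d.time ≤ d.inputLength ^ c + c

/-- The silent machine: whenever it is activated, it simply halts. -/
def silent (κ : Type) : ITM κ where
  Q := Unit
  Γ := Unit
  finQ := inferInstance
  finΓ := inferInstance
  inhΓ := inferInstance
  start := ()
  δ := fun _ _ => none

end ITM

/-- An environment: its program, and the programs that it may run as client sides of the
protocol instances that it initiates. -/
structure Environment where
  Code : Type
  finCode : Finite Code
  machine : ITM Code
  client : Code → ITM Empty

def Environment.PPT (Z : Environment) : Prop :=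
  Z.machine.PPT ∧ ∀ c, (Z.client c).PPT

/-- The deletion-requester can initiate protocol instances with the honest client only. -/
abbrev Requester := ITM Unit

/-! ## Data collectors -/

/-- What activates a party of a protocol instance. -/
inductive Event where
  | wake
  | input (m : Msg)
  | incoming (m : Msg)

/-- How an activation of a party of a protocol instance ends. -/
inductive Effect where
  | halt
  | send (m : Msg)
  | output (m : Msg)

inductive Side where
  | client
  | server

/-- A data collector `(X, π, π_D)`. The machines prescribed by it are given by their behavior
per activation. `X` sees the server-side instances that it controls under the numbers of their
creation; when activated, it reads the first output that it has not read so far, if there is one,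
and may write on the input tape of one instance. `State` is the type of the contents of
the work tape of `X`. The deletion token of an instance of `π` is a function of its number and its
transcript, with `none` if the transcript is not that of a completed execution. -/
structure DataCollector where
  State : Type
  init : ℕ → PMF State
  act : ℕ → State → Option (ℕ × Msg) → PMF (State × Option (ℕ × Msg))
  Local : Type
  initLocal : ℕ → Kind → Side → Local
  party : Kind → Side → Local → Event → PMF (Local × Effect)
  token : ℕ → List (Side × Msg) → Option Msg

/-! ## The execution -/

inductive Owner where
  | Z
  | Y
  deriving DecidableEq

/-- A protocol instance, named by its initiator and its number among the instances of the same
initiator. -/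
abbrev SID := Owner × ℕ

/-- A protocol instance: states of both sides, transcript, first input given to the client. -/
structure Session (Client Server : Type) where
  kind : Kind
  client : Client
  server : Server
  transcript : List (Side × Msg)
  given : Option Msg

/-- The alive phase, and the stages of the terminate phase: running the instances of `π` of the
deletion-requester, initiating the missing deletion requests, running the instances of `π_D`;
the number says which instance comes next. -/
inductive Phase where
  | alive
  | runPi (n : ℕ)
  | request (n : ℕ)
  | runDel (n : ℕ)
  | done

/-- Who is activated: `main` is the environment during the alive phase, and the procedure of the
terminate phase afterwards. -/
inductive Active where
  | main
  | X
  | Y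
  | clientZ (j : ℕ)
  | clientY (j : ℕ) (e : Event)
  | server (sid : SID) (e : Event)

/-- The global configuration; `control` is the list of the server-side instances in the order of
creation, `unread` is the list of their outputs not yet read by the data collector. -/
structure World (C : DataCollector) (Z : Environment) (Y : Requester) where
  phase : Phase
  active : Active
  z : Z.machine.Config
  y : Y.Config
  x : C.State
  control : List SID
  unread : List (SID × Msg)
  zs : List (Session (Σ c : Z.Code, (Z.client c).Config) C.Local)
  ys : List (Session C.Local C.Local)

/-- The identifier of the `j`-th controlled instance, as written on tapes. -/
def identOf (j : ℕ) : Msg := List.replicate j (some true) ++ [none]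

/-- Splitting a message into the number of the addressee and the text. -/
def splitTarget (m : Msg) : ℕ × Msg :=
  ((m.takeWhile Option.isSome).length, (m.dropWhile Option.isSome).tail)

namespace World

variable {C : DataCollector} {Z : Environment} {Y : Requester} (secp : ℕ)

/-- Activate the deletion-requester; in the terminate phase, its procedure goes on instead. -/
def passY (s : World C Z Y) : World C Z Y :=
  match s.phase with
  | .alive => { s with active := .Y }
  | _ => { s with active := .main }

/-- The deletion tokens of the completed instances of `π` initiated by the deletion-requester. -/
def tokenOf (s : World C Z Y) (j : ℕ) : Option Msg :=
  match s.ys[j]? with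
  | some e => if e.kind = .pi then C.token (s.control.idxOf (Owner.Y, j)) e.transcript else none
  | none => none

/-- Is `m` the deletion token of an instance of `π` initiated by the deletion-requester? -/
def isToken (s : World C Z Y) (m : Msg) : Bool :=
  (List.range s.ys.length).any fun j => decide (s.tokenOf j = some m)

/-- Has the deletion-requester initiated an instance of `π_D` for the token `m`? -/
def isRequested (s : World C Z Y) (m : Msg) : Bool :=
  s.ys.any fun e => decide (e.kind = .del) && decide (e.given = some m)

/-- The deletion-requester initiates an instance. -/
def openY (s : World C Z Y) (k : Kind) : World C Z Y :=
  { s with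
    y := s.y.write .control (identOf s.ys.length)
    control := s.control ++ [(Owner.Y, s.ys.length)]
    ys := s.ys ++ [⟨k, C.initLocal secp k .client, C.initLocal secp k .server, [], none⟩] }

/-- The environment initiates an instance. -/
def openZ (s : World C Z Y) (k : Kind) (c : Z.Code) : World C Z Y :=
  { s with
    z := s.z.write .control (identOf s.zs.length)
    control := s.control ++ [(Owner.Z, s.zs.length)]
    zs := s.zs ++ [⟨k, ⟨c, ((Z.client c).init secp).write .ident (identOf s.zs.length)⟩,
      C.initLocal secp k .server, [], none⟩] }

/-- The text `m` is written on the input tape of the `j`-th client of the deletion-requester,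
which is thereby activated. -/
def inputY (s : World C Z Y) (j : ℕ) (m : Msg) : World C Z Y :=
  { s with
    active := .clientY j (.input m)
    ys := s.ys.modify j fun e => { e with given := e.given.or (some m) } }

/-- A step of the environment. -/
def stepZ (s : World C Z Y) (coin : Bool) : World C Z Y :=
  match s.z.step coin with
  | none => { s with phase := .runPi 0 }
  | some (z, none) => { s with z := z }
  | some (z, some (a, m)) =>
    let s : World C Z Y := { s with z := z }
    match a with
    | .tellY => { s with y := s.y.write .incoming (m ++ [none]), active := .Y }
    | .writeInput =>
      let t := splitTarget m
      if t.1 < s.zs.length then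
        { s with
          active := .clientZ t.1
          zs := s.zs.modify t.1 fun e =>
            { e with
              client := ⟨e.client.1, e.client.2.write .input (none :: t.2)⟩
              given := e.given.or (some t.2) } }
      else s
    | .initiate k c => s.openZ secp k c
    | .wakeX => { s with active := .X }
    | .wakeY => { s with active := .Y }
    | .endAlive => { s with phase := .runPi 0 }
    | .send => s
    | .output => s
    | .yield => s

/-- A step of the deletion-requester. It may give as input to an instance of `π_D` only the
deletion token of an instance of `π` that it has initiated; actions that are not allowed to it have
no effect, and the environment is activated. -/
def stepY (s : World C Z Y) (coin : Bool) : World C Z Y :=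
  match s.y.step coin with
  | none => { s with active := .main }
  | some (y, none) => { s with y := y }
  | some (y, some (a, m)) =>
    let s : World C Z Y := { s with y := y }
    match a with
    | .initiate k _ => s.openY secp k
    | .writeInput =>
      let t := splitTarget m
      match s.ys[t.1]? with
      | none => { s with active := .main }
      | some e =>
        if e.kind = .pi ∨ s.isToken t.2 = true then s.inputY t.1 t.2
        else { s with active := .main }
    | _ => { s with active := .main }

/-- A step of the `j`-th client of the environment. -/
def stepClientZ (s : World C Z Y) (j : ℕ) (coin : Bool) : World C Z Y :=
  match s.zs[j]? with
  | none => { s with active := .main }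
  | some e =>
    match e.client.2.step coin with
    | none => { s with active := .main }
    | some (c, a) =>
      let e : Session (Σ c : Z.Code, (Z.client c).Config) C.Local :=
        { e with client := ⟨e.client.1, c⟩ }
      match a with
      | none => { s with zs := s.zs.set j e }
      | some (.send, m) =>
        { s with
          active := .server (.Z, j) (.incoming m)
          zs := s.zs.set j { e with transcript := e.transcript ++ [(.client, m)] } }
      | some (.output, m) =>
        { s with
          active := .main
          zs := s.zs.set j e
          z := s.z.write .reports (identOf j ++ m ++ [none]) }
      | some _ => { s with active := .main, zs := s.zs.set j e }

/-- The activation of the `j`-th client of the deletion-requester ends with an effect. -/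
def afterClientY (s : World C Z Y) (j : ℕ) (l : C.Local) : Effect → World C Z Y
  | .halt => { s with
      active := .main
      ys := s.ys.modify j fun e => { e with client := l } }
  | .send m => { s with
      active := .server (.Y, j) (.incoming m)
      ys := s.ys.modify j fun e =>
        { e with client := l, transcript := e.transcript ++ [(.client, m)] } }
  | .output m => passY { s with
      y := s.y.write .reports (identOf j ++ m ++ [none])
      ys := s.ys.modify j fun e => { e with client := l } }

/-- The activation of a server ends with an effect. -/
def afterServer (s : World C Z Y) (sid : SID) (l : C.Local) (f : Effect) : World C Z Y :=
  match sid with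
  | (.Z, j) =>
    let s : World C Z Y := { s with zs := s.zs.modify j fun e => { e with server := l } }
    match f with
    | .halt => { s with active := .main }
    | .send m => { s with
        active := .clientZ j
        zs := s.zs.modify j fun e =>
          { e with
            client := ⟨e.client.1, e.client.2.write .incoming (m ++ [none])⟩
            transcript := e.transcript ++ [(.server, m)] } }
    | .output m => { s with active := .X, unread := s.unread ++ [(sid, m)] }
  | (.Y, j) =>
    let s : World C Z Y := { s with ys := s.ys.modify j fun e => { e with server := l } }
    match f with
    | .halt => { s with active := .main }
    | .send m => { s with
        active := .clientY j (.incoming m)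
        ys := s.ys.modify j fun e => { e with transcript := e.transcript ++ [(.server, m)] } }
    | .output m => { s with active := .X, unread := s.unread ++ [(sid, m)] }

/-- The kind and the server state of a protocol instance. -/
def serverOf (s : World C Z Y) : SID → Option (Kind × C.Local)
  | (.Z, j) => s.zs[j]?.map fun e => (e.kind, e.server)
  | (.Y, j) => s.ys[j]?.map fun e => (e.kind, e.server)

noncomputable def stepServer (s : World C Z Y) (sid : SID) (ev : Event) : PMF (World C Z Y) :=
  match s.serverOf sid with
  | none => PMF.pure { s with active := .main }
  | some (k, l) => (C.party k .server l ev).map fun r => s.afterServer sid r.1 r.2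

noncomputable def stepClientY (s : World C Z Y) (j : ℕ) (ev : Event) : PMF (World C Z Y) :=
  match s.ys[j]? with
  | none => PMF.pure { s with active := .main }
  | some e => (C.party e.kind .client e.client ev).map fun r => s.afterClientY j r.1 r.2

/-- An activation of the data collector. -/
noncomputable def stepX (s : World C Z Y) : PMF (World C Z Y) :=
  (C.act secp s.x (s.unread.head?.map fun r => (s.control.idxOf r.1, r.2))).map fun r =>
    let s : World C Z Y := { s with x := r.1, unread := s.unread.tail, active := .main }
    match r.2 with
    | none => s
    | some (h, m) =>
      match s.control[h]? with
      | none => s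
      | some sid => { s with active := .server sid (.input m) }

/-- Activate the client of an instance of the deletion-requester in the terminate phase; if it
halts, go on with the phase `next`. -/
noncomputable def wakeUntilHalt (s : World C Z Y) (j : ℕ)
    (e : Session C.Local C.Local) (next : Phase) : PMF (World C Z Y) :=
  (C.party e.kind .client e.client .wake).map fun r =>
    match r.2 with
    | .halt => { s.afterClientY j r.1 .halt with phase := next }
    | f => s.afterClientY j r.1 f

/-- A step of whoever is activated. -/
noncomputable def step (s : World C Z Y) : PMF (World C Z Y) :=
  match s.active with
  | .X => s.stepX secp
  | .Y => (PMF.uniformOfFintype Bool).map (s.stepY secp)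
  | .clientZ j => (PMF.uniformOfFintype Bool).map (s.stepClientZ j)
  | .clientY j ev => s.stepClientY j ev
  | .server sid ev => s.stepServer sid ev
  | .main =>
    match s.phase with
    | .alive => (PMF.uniformOfFintype Bool).map (s.stepZ secp)
    | .runPi n =>
      match s.ys[n]? with
      | none => PMF.pure { s with phase := .request 0 }
      | some e =>
        if e.kind = .pi then s.wakeUntilHalt n e (.runPi (n + 1))
        else PMF.pure { s with phase := .runPi (n + 1) }
    | .request n =>
      if n < s.ys.length then
        match s.tokenOf n with
        | none => PMF.pure { s with phase := .request (n + 1) }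
        | some t =>
          if s.isRequested t = true then PMF.pure { s with phase := .request (n + 1) }
          else PMF.pure
            ((openY secp { s with phase := .request (n + 1) } .del).inputY s.ys.length t)
      else PMF.pure { s with phase := .runDel 0 }
    | .runDel n =>
      match s.ys[n]? with
      | none => PMF.pure { s with phase := .done }
      | some e =>
        if e.kind = .del then s.wakeUntilHalt n e (.runDel (n + 1))
        else PMF.pure { s with phase := .runDel (n + 1) }
    | .done => PMF.pure s

/-- The initial global configuration, given the initial state of the data collector. -/
def start (C : DataCollector) (Z : Environment) (Y : Requester) (secp : ℕ) (x : C.State) :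
    World C Z Y where
  phase := .alive
  active := .main
  z := Z.machine.init secp
  y := Y.init secp
  x := x
  control := []
  unread := []
  zs := []
  ys := []

end World

/-- The distribution of the global configuration after `T` steps of the execution. -/
noncomputable def execution (C : DataCollector) (Z : Environment) (Y : Requester) (secp : ℕ) :
    ℕ → PMF (World C Z Y)
  | 0 => (C.init secp).map (World.start C Z Y secp)
  | T + 1 => (execution C Z Y secp T).bind fun s => s.step secp

/-- Has the execution ended, with an outcome (state of the data collector and view of the
environment) that the distinguisher accepts? -/
def World.accepted {C : DataCollector} {Z : Environment} {Y : Requester}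
    (D : C.State × View → Bool) (s : World C Z Y) : Bool :=
  match s.phase with
  | .done => D (s.x, s.z.view)
  | _ => false

/-- The probability that the distinguisher accepts the state of the data collector and the view of
the environment at the end of the execution. -/
noncomputable def acceptProb (C : DataCollector) (Z : Environment) (Y : Requester)
    (D : C.State × View → Bool) (secp : ℕ) : ℝ :=
  (⨆ T : ℕ, ((execution C Z Y secp T).map (World.accepted D)) true).toReal

/-- The advantage of a distinguisher between the real execution, with `Y`, and the ideal one, with
the silent deletion-requester. -/
noncomputable def advantage (C : DataCollector) (Z : Environment) (Y : Requester)
    (D : C.State × View → Bool) (secp : ℕ) : ℝ :=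
  |acceptProb C Z Y D secp - acceptProb C Z (ITM.silent Unit) D secp|

def Negligible (f : ℕ → ℝ) : Prop :=
  Asymptotics.SuperpolynomialDecay Filter.atTop (fun n : ℕ => (n : ℝ)) f

def StatisticallyDeletionCompliant (C : DataCollector) : Prop :=
  ∀ Z : Environment, Z.PPT → ∀ Y : Requester, Y.PPT → ∀ D : C.State × View → Bool,
    ∃ ε : ℕ → ℝ, Negligible ε ∧ ∀ secp : ℕ, advantage C Z Y D secp ≤ ε secp

/-! ## The storage collector -/

/-- The fields of a message, separated by the separation marks. -/
def fields : Msg → List (List Bool)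
  | [] => [[]]
  | none :: m => [] :: fields m
  | some b :: m =>
    match fields m with
    | [] => [[b]]
    | f :: fs => (b :: f) :: fs

/-- The message with given fields. -/
def tuple : List (List Bool) → Msg
  | [] => []
  | [f] => f.map some
  | f :: g :: fs => f.map some ++ none :: tuple (g :: fs)

/-- The bit strings that stand for the three instructions. -/
def insCode : List Bool := [false, false]
def lookCode : List Bool := [false, true]
def delCode : List Bool := [true, false]

/-- The local state of a party of one of the protocols of the storage collector. -/
inductive Stage where
  | fresh
  | waiting
  | finished

/-- The server of `π` on the message `m` of the client. An empty field is an absent one. -/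
def serverPi (m : Msg) : Stage × Effect :=
  match fields m with
  | [inst, key, auth, value] =>
    if inst = insCode ∧ value ≠ [] then (.waiting, .output (tuple [insCode, key, value]))
    else if inst = lookCode ∧ auth ≠ [] then (.waiting, .output (tuple [lookCode, key, auth]))
    else (.finished, .halt)
  | _ => (.finished, .halt)

/-- The client of `π_D` on its input. -/
def clientDel (m : Msg) : Stage × Effect :=
  match fields m with
  | [key, auth] => (.finished, .send (tuple [delCode, key, auth]))
  | _ => (.finished, .halt)

/-- The prescribed behavior of the parties of the protocols `π` and `π_D`. -/
def storageParty : Kind → Side → Stage → Event → Stage × Effect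
  | .pi, .client, .fresh, .input m => (.waiting, .send m)
  | .pi, .client, .waiting, .incoming m => (.finished, .output m)
  | .pi, .server, .fresh, .incoming m => serverPi m
  | .pi, .server, .waiting, .input m => (.finished, .send m)
  | .del, .client, .fresh, .input m => clientDel m
  | .del, .server, .fresh, .incoming m => (.finished, .output m)
  | _, _, st, _ => (st, .halt)

/-- The deletion token of an instance of `π`: key and authentication string for an insertion, the
empty message for a lookup. -/
def storageToken : List (Side × Msg) → Option Msg
  | [(.client, m), (.server, a)] =>
    match fields m with
    | [inst, key, _, _] =>
      if inst = insCode then some (key.map some ++ none :: a) else some []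
    | _ => none
  | _ => none

abbrev StorageDict := dictionary (List Bool × List Bool) (List Bool)

/-- The storage collector on the output of a server: new memory, and its reply. -/
noncomputable def storageReply (Dict : Implementation StorageDict) (secp : ℕ) (mem : Dict.Mem)
    (m : Msg) : PMF (Dict.Mem × Option Msg) :=
  match fields m with
  | [inst, key, arg] =>
    if inst = insCode then
      (PMF.uniformOfFintype (Fin secp → Bool)).bind fun r =>
        (Dict.exec mem (.insert (key, List.ofFn r) arg)).map fun t =>
          (t.1, some ((List.ofFn r).map some))
    else if inst = lookCode then
      (Dict.exec mem (.lookup (key, arg))).map fun t => (t.1, some ((t.2.getD []).map some))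
    else if inst = delCode then
      (Dict.exec mem (.delete (key, arg))).map fun t => (t.1, none)
    else PMF.pure (mem, none)
  | _ => PMF.pure (mem, none)

/-- The storage collector that uses the given dictionary; its work tape holds nothing but the
memory of the dictionary. -/
noncomputable def storageCollector (Dict : Implementation StorageDict) : DataCollector where
  State := Dict.Mem
  init := fun _ => Dict.init
  act := fun secp mem r =>
    match r with
    | none => PMF.pure (mem, none)
    | some (h, m) => (storageReply Dict secp mem m).map fun t =>
        (t.1, t.2.map fun reply => (h, reply))
  Local := Stage
  initLocal := fun _ _ _ => .fresh
  party := fun k side st ev => PMF.pure (storageParty k side st ev)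
  token := fun _ tr => storageToken tr

/-! The proof has three ingredients: the memory carries no more information than the content, the
content outside the requester's keys evolves as if there were no requester, and all executions end
after polynomially many steps.

Memory. Replies are correct, hence determined by the content and the sampled strings; by history
independence the memory, given the rest of the configuration, is distributed according to the
current content alone. So `value_withMem` lets the collector keep only the content
(`contentCollector`) and samples the memory at the very end, from `contentMem`.

Comparison. Let `L` be the keys under which the requester has inserted values. Erasing `L` from the
content and dropping the requester (`forget`) gives a configuration of `ZWorld`, the execution of
the environment alone. With shared randomness both executions agree until the environment looks up a
key of `L`, one of its insertions draws the authentication string of a key of `L`, or an insertion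
of the requester draws a string already in use. In `ZWorld` the requester's strings do not occur at
all. A new one is therefore uniform and independent of the future of `ZWorld`, and the risk that it
will be hit can be charged when it is drawn: over `T` further steps it is at most `T / 2 ^ secp` on
average (`sum_guess_le`), plus the risk that the string is already in use. This is the content of
`value_X_le` and `run_pi`, and `bounded` is the resulting induction on the number of steps. The
invariant `Good` says that each key of `L` still present has a deletion request to come; at the end
none is present and erasing `L` changes nothing.

From one side to two. `bounded` only bounds acceptance from above. Applied to a distinguisher and to
its negation, it gives a two-sided bound (`abs_acceptProb_sub_le`): the two acceptance probabilities
add up to 1 in the actual execution, because it ends, and to at most 1 in `ZWorld`.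

Termination. The potential `remaining` strictly decreases, and initially it is polynomial in the
security parameter. Both the real and the ideal execution are then within `T ^ 2 / 2 ^ secp` of the
same `ZWorld` value, which yields the theorem. -/

open scoped ENNReal

/-! ## Expectations of extended nonnegative functions -/

/-- The expectation of `f` under `p`. -/
noncomputable def PMF.expect {α : Type*} (p : PMF α) (f : α → ℝ≥0∞) : ℝ≥0∞ :=
  ∑' a, p a * f a

namespace PMF

variable {α β : Type*}

theorem expect_pure (a : α) (f : α → ℝ≥0∞) : (PMF.pure a).expect f = f a := by
  classical
  unfold expect
  rw [tsum_eq_single a]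
  · simp
  · intro b hb
    simp [PMF.pure_apply, hb]

theorem expect_bind (p : PMF α) (q : α → PMF β) (f : β → ℝ≥0∞) :
    (p.bind q).expect f = p.expect fun a => (q a).expect f := by
  simp only [expect, PMF.bind_apply, ← ENNReal.tsum_mul_right, ← ENNReal.tsum_mul_left]
  rw [ENNReal.tsum_comm]
  simp only [mul_assoc]

theorem expect_map (p : PMF α) (h : α → β) (f : β → ℝ≥0∞) :
    (p.map h).expect f = p.expect fun a => f (h a) := by
  simp only [PMF.map, expect_bind, Function.comp_def, expect_pure]

theorem expect_congr {p : PMF α} {f g : α → ℝ≥0∞} (h : ∀ a ∈ p.support, f a = g a) :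
    p.expect f = p.expect g := by
  refine tsum_congr fun a => ?_
  by_cases ha : a ∈ p.support
  · rw [h a ha]
  · rw [PMF.mem_support_iff, not_not] at ha
    simp [ha]

theorem expect_mono {p : PMF α} {f g : α → ℝ≥0∞} (h : ∀ a ∈ p.support, f a ≤ g a) :
    p.expect f ≤ p.expect g := by
  refine ENNReal.tsum_le_tsum fun a => ?_
  by_cases ha : a ∈ p.support
  · exact mul_le_mul_right (h a ha) _
  · rw [PMF.mem_support_iff, not_not] at ha
    simp [ha]

theorem expect_const (p : PMF α) (c : ℝ≥0∞) : (p.expect fun _ => c) = c := by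
  simp [expect, ENNReal.tsum_mul_right, p.tsum_coe]

theorem expect_add (p : PMF α) (f g : α → ℝ≥0∞) :
    (p.expect fun a => f a + g a) = p.expect f + p.expect g := by
  simp [expect, mul_add, ENNReal.tsum_add]

theorem expect_sum {ι : Type*} (p : PMF α) (s : Finset ι) (f : ι → α → ℝ≥0∞) :
    (p.expect fun a => ∑ i ∈ s, f i a) = ∑ i ∈ s, p.expect (f i) := by
  classical
  induction s using Finset.induction_on with
  | empty => simpa using p.expect_const 0
  | insert i s hi ih => simp [Finset.sum_insert hi, expect_add, ih]

theorem expect_list_sum {ι : Type*} (p : PMF α) (l : List ι) (f : ι → α → ℝ≥0∞) :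
    (p.expect fun a => (l.map fun i => f i a).sum) = (l.map fun i => p.expect (f i)).sum := by
  induction l with
  | nil => simpa using p.expect_const 0
  | cons i l ih => simp [expect_add, ih]

theorem expect_comm (p : PMF α) (q : PMF β) (f : α → β → ℝ≥0∞) :
    (p.expect fun a => q.expect (f a)) = q.expect fun b => p.expect fun a => f a b := by
  simp only [expect, ← ENNReal.tsum_mul_left]
  rw [ENNReal.tsum_comm]
  simp only [mul_left_comm]

theorem expect_le_const {p : PMF α} {f : α → ℝ≥0∞} {c : ℝ≥0∞} (h : ∀ a ∈ p.support, f a ≤ c) :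
    p.expect f ≤ c :=
  (expect_mono h).trans_eq (p.expect_const c)

theorem expect_eq_const {p : PMF α} {f : α → ℝ≥0∞} {c : ℝ≥0∞} (h : ∀ a ∈ p.support, f a = c) :
    p.expect f = c :=
  (expect_congr h).trans (p.expect_const c)

theorem expect_uniform [Fintype α] [Nonempty α] (f : α → ℝ≥0∞) :
    (PMF.uniformOfFintype α).expect f = (∑ a, f a) * (Fintype.card α : ℝ≥0∞)⁻¹ := by
  simp [expect, tsum_fintype, Finset.sum_mul, mul_comm]

theorem map_true_eq_expect (p : PMF α) (f : α → Bool) :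
    (p.map f) true = p.expect fun a => if f a = true then 1 else 0 := by
  rw [PMF.map_apply]
  refine tsum_congr fun a => ?_
  cases h : f a <;> simp [h]

end PMF

/-! ## Expected rewards of the execution -/

namespace World

variable {C : DataCollector} {Z : Environment} {Y : Requester} (secp : ℕ)

/-- The expected reward after `T` further steps. -/
noncomputable def value (g : World C Z Y → ℝ≥0∞) : ℕ → World C Z Y → ℝ≥0∞
  | 0, s => g s
  | T + 1, s => (s.step secp).expect (value g T)

/-- `execution` appends steps at the end while `value` splits off the first step; the extra `T'`
makes the induction on `T` pass from one recursion to the other. -/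
theorem execution_expect (g : World C Z Y → ℝ≥0∞) (T T' : ℕ) :
    (execution C Z Y secp T).expect (value secp g T') =
      (C.init secp).expect fun x => value secp g (T + T') (World.start C Z Y secp x) := by
  induction T generalizing T' with
  | zero => rw [execution, PMF.expect_map, zero_add]
  | succ T ih =>
    rw [execution, PMF.expect_bind, Nat.add_right_comm, Nat.add_assoc, ← ih]
    rfl

theorem value_add (g₁ g₂ : World C Z Y → ℝ≥0∞) (T : ℕ) (s : World C Z Y) :
    value secp (fun s => g₁ s + g₂ s) T s = value secp g₁ T s + value secp g₂ T s := by
  induction T generalizing s with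
  | zero => rfl
  | succ T ih =>
    simp only [value, ← PMF.expect_add]
    exact PMF.expect_congr fun s' _ => ih s'

theorem value_le_one {g : World C Z Y → ℝ≥0∞} (hg : ∀ s, g s ≤ 1) (T : ℕ) (s : World C Z Y) :
    value secp g T s ≤ 1 := by
  induction T generalizing s with
  | zero => exact hg s
  | succ T ih => exact PMF.expect_le_const fun s' _ => ih s'

/-- Rewards that are granted only at the end of the execution. -/
def Terminal (g : World C Z Y → ℝ≥0∞) : Prop :=
  ∀ s, s.phase ≠ .done ∨ s.active ≠ .main → g s = 0

/-- A finished configuration steps to itself, and any other has reward zero. Monotonicity in `T` is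
what later allows steps to be skipped free of charge. -/
theorem value_le_succ {g : World C Z Y → ℝ≥0∞} (hg : Terminal g) (T : ℕ) (s : World C Z Y) :
    value secp g T s ≤ value secp g (T + 1) s := by
  induction T generalizing s with
  | zero =>
    by_cases h : s.phase ≠ .done ∨ s.active ≠ .main
    · simp [value, hg s h]
    · push Not at h
      have : s.step secp = PMF.pure s := by simp [step, h.1, h.2]
      simp [value, this, PMF.expect_pure]
  | succ T ih => exact PMF.expect_mono fun s' _ => ih s'

theorem value_mono {g : World C Z Y → ℝ≥0∞} (hg : Terminal g) (s : World C Z Y) :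
    Monotone fun T => value secp g T s :=
  monotone_nat_of_le_succ fun T => value_le_succ secp hg T s

end World

/-! ## The storage collector that stores contents -/

abbrev StorageKey := List Bool × List Bool

abbrev StorageOp := DictOp StorageKey (List Bool)

theorem AbstractDS.stateFrom_append {Op Res : Type} (A : AbstractDS Op Res) (s : A.State)
    (S T : List Op) : A.stateFrom s (S ++ T) = A.stateFrom (A.stateFrom s S) T := by
  induction S generalizing s with
  | nil => rfl
  | cons o S ih => exact ih _

theorem AbstractDS.resultsFrom_append {Op Res : Type} (A : AbstractDS Op Res) (s : A.State)
    (S T : List Op) :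
    A.resultsFrom s (S ++ T) = A.resultsFrom s S ++ A.resultsFrom (A.stateFrom s S) T := by
  induction S generalizing s with
  | nil => rfl
  | cons o S ih => simp [AbstractDS.resultsFrom, AbstractDS.stateFrom, ih]

/-- The contents that the dictionary can have. -/
def Content : Type :=
  {x : StorageKey → Option (List Bool) //
    ∃ S, StorageDict.stateFrom StorageDict.init S = x}

namespace Content

def empty : Content := ⟨fun _ => none, [], rfl⟩

def get (x : Content) (k : StorageKey) : Option (List Bool) := x.1 k

theorem ext {x y : Content} (h : ∀ k, x.get k = y.get k) : x = y :=
  Subtype.ext (funext h)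

def apply (x : Content) (o : StorageOp) : Content :=
  ⟨(StorageDict.step x.1 o).1, by
    obtain ⟨S, hS⟩ := x.2
    exact ⟨S ++ [o], by rw [AbstractDS.stateFrom_append, hS]; rfl⟩⟩

/-- The `getD` expresses that an insertion has no effect on a key in use. -/
theorem get_insert (x : Content) (k k' : StorageKey) (v : List Bool) :
    (x.apply (.insert k v)).get k' =
      if k' = k then some ((x.get k).getD v) else x.get k' := by
  change (if x.1 k = none then Function.update x.1 k (some v) else x.1) k' = _
  unfold get
  cases h : x.1 k <;> by_cases hk : k' = k <;> simp_all

theorem get_delete (x : Content) (k k' : StorageKey) :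
    (x.apply (.delete k)).get k' = if k' = k then none else x.get k' := by
  change Function.update x.1 k none k' = _
  rw [Function.update_apply]
  rfl

end Content

/-- The storage collector on the output of a server, in terms of the content. -/
noncomputable def contentReply (secp : ℕ) (x : Content) (m : Msg) : PMF (Content × Option Msg) :=
  match fields m with
  | [inst, key, arg] =>
    if inst = insCode then
      (PMF.uniformOfFintype (Fin secp → Bool)).map fun r =>
        (x.apply (.insert (key, List.ofFn r) arg), some ((List.ofFn r).map some))
    else if inst = lookCode then
      PMF.pure (x, some (((x.get (key, arg)).getD []).map some))
    else if inst = delCode then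
      PMF.pure (x.apply (.delete (key, arg)), none)
    else PMF.pure (x, none)
  | _ => PMF.pure (x, none)

/-- The storage collector whose state is the content of the dictionary. -/
noncomputable abbrev contentCollector : DataCollector where
  State := Content
  init := fun _ => PMF.pure Content.empty
  act := fun secp x r =>
    match r with
    | none => PMF.pure (x, none)
    | some (h, m) => (contentReply secp x m).map fun t =>
        (t.1, t.2.map fun reply => (h, reply))
  Local := Stage
  initLocal := fun _ _ _ => .fresh
  party := fun k side st ev => PMF.pure (storageParty k side st ev)
  token := fun _ tr => storageToken tr

/-! ## Memory representations of contents -/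

namespace MemoryScheme

variable {Op Res : Type} (I : MemoryScheme Op Res)

theorem runFrom_snoc (m : I.Mem) (S : List Op) (o : Op) :
    I.runFrom m (S ++ [o]) = (I.runFrom m S).bind fun t =>
      (I.exec t.1 o).map fun r => (r.1, t.2 ++ [r.2]) := by
  induction S generalizing m with
  | nil =>
    simp [runFrom, PMF.pure_bind, PMF.map, Function.comp_def]
  | cons o' S ih =>
    simp [runFrom, ih, PMF.map, PMF.bind_bind, PMF.pure_bind, Function.comp_def]

theorem run_snoc (S : List Op) (o : Op) :
    I.run (S ++ [o]) = (I.run S).bind fun t =>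
      (I.exec t.1 o).map fun r => (r.1, t.2 ++ [r.2]) := by
  simp [run, runFrom_snoc, PMF.bind_bind]

end MemoryScheme

theorem PMF.bind_congr_support {α β : Type*} {p : PMF α} {f g : α → PMF β}
    (h : ∀ a ∈ p.support, f a = g a) : p.bind f = p.bind g := by
  ext b
  simp only [PMF.bind_apply]
  refine tsum_congr fun a => ?_
  by_cases ha : a ∈ p.support
  · rw [h a ha]
  · rw [PMF.mem_support_iff, not_not] at ha
    simp [ha]

theorem PMF.map_congr_support {α β : Type*} {p : PMF α} {f g : α → β}
    (h : ∀ a ∈ p.support, f a = g a) : p.map f = p.map g :=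
  PMF.bind_congr_support fun a ha => by simp [h a ha]

namespace Implementation

variable {Op Res : Type} {A : AbstractDS Op Res} (I : Implementation A)

/-- An operation returns the prescribed result and leads to the memory of the longer history. -/
theorem memDist_bind_exec (S : List Op) (o : Op) :
    (I.memDist S).bind (fun m => I.exec m o) =
      (I.memDist (S ++ [o])).map fun m => (m, (A.step (A.stateFrom A.init S) o).2) := by
  have key : (I.memDist S).bind (fun m => I.exec m o) =
      (I.run S).bind fun t => (I.exec t.1 o) := by
    simp [MemoryScheme.memDist, PMF.map, PMF.bind_bind, PMF.pure_bind, Function.comp_def]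
  rw [key, MemoryScheme.memDist, MemoryScheme.run_snoc]
  simp only [PMF.map_bind, PMF.map_comp, Function.comp_def]
  refine PMF.bind_congr_support fun t ht => ?_
  conv_lhs => rw [← PMF.map_id (I.exec t.1 o)]
  refine PMF.map_congr_support fun r hr => ?_
  have h₁ := I.correct S t ht
  have h₂ := I.correct (S ++ [o]) (r.1, t.2 ++ [r.2]) (by
    rw [MemoryScheme.run_snoc, PMF.mem_support_bind_iff]
    exact ⟨t, ht, by rw [PMF.mem_support_map_iff]; exact ⟨r, hr, rfl⟩⟩)
  rw [AbstractDS.resultsFrom_append, ← h₁] at h₂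
  have h₃ := List.append_cancel_left h₂
  simp only [AbstractDS.resultsFrom, List.cons.injEq, and_true] at h₃
  exact Prod.ext rfl h₃

end Implementation

/-- The distribution of the memory representation of a content. -/
noncomputable def contentMem (Dict : Implementation StorageDict) (x : Content) : PMF Dict.Mem :=
  Dict.memDist x.2.choose

/-- Histories that end in the same state produce the same content, so history independence makes the
chosen history irrelevant. -/
theorem contentMem_eq {Dict : Implementation StorageDict} (hDict : Dict.HistoryIndependent)
    (x : Content) (S : List StorageOp)
    (hS : StorageDict.stateFrom StorageDict.init S = x.1) :
    contentMem Dict x = Dict.memDist S :=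
  hDict _ _ fun T => by rw [x.2.choose_spec, hS]

theorem contentMem_bind_exec {Dict : Implementation StorageDict}
    (hDict : Dict.HistoryIndependent) (x : Content) (o : StorageOp) :
    (contentMem Dict x).bind (fun m => Dict.exec m o) =
      (contentMem Dict (x.apply o)).map fun m => (m, (StorageDict.step x.1 o).2) := by
  obtain ⟨S, hS⟩ := x.2
  rw [contentMem_eq hDict x S hS, Implementation.memDist_bind_exec,
    contentMem_eq hDict (x.apply o) (S ++ [o]), hS]
  rw [AbstractDS.stateFrom_append, hS]
  rfl

theorem contentMem_empty {Dict : Implementation StorageDict}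
    (hDict : Dict.HistoryIndependent) : contentMem Dict Content.empty = Dict.init := by
  rw [contentMem_eq hDict Content.empty [] rfl]
  simp [MemoryScheme.memDist, MemoryScheme.run, MemoryScheme.runFrom, PMF.map, PMF.bind_bind]

/-- The authentication string is sampled independently of the memory, so the two may be drawn in
either order; given the string, the claim is `contentMem_bind_exec` for a single operation. -/
theorem contentMem_bind_reply {Dict : Implementation StorageDict}
    (hDict : Dict.HistoryIndependent) (secp : ℕ) (x : Content) (m : Msg) :
    (contentMem Dict x).bind (fun mem => storageReply Dict secp mem m) =
      (contentReply secp x m).bind fun t => (contentMem Dict t.1).map fun mem => (mem, t.2) := by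
  unfold storageReply contentReply
  rcases fields m with _ | ⟨inst, _ | ⟨key, _ | ⟨arg, _ | _⟩⟩⟩
  case cons.cons.cons.nil =>
    dsimp only
    split_ifs
    · rw [PMF.bind_comm]
      simp only [PMF.map, PMF.bind_bind, PMF.pure_bind, Function.comp_def]
      refine congrArg _ (funext fun r => ?_)
      have := contentMem_bind_exec hDict x (.insert (key, List.ofFn r) arg)
      rw [← PMF.bind_bind, this]
      simp only [PMF.map, PMF.bind_bind, PMF.pure_bind, Function.comp_def]
    · have := contentMem_bind_exec hDict x (.lookup (key, arg))
      simp only [PMF.map, PMF.pure_bind, Function.comp_def]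
      rw [← PMF.bind_bind, this]
      simp only [PMF.map, PMF.bind_bind, PMF.pure_bind, Function.comp_def]
      rfl
    · have := contentMem_bind_exec hDict x (.delete (key, arg))
      simp only [PMF.map, PMF.pure_bind, Function.comp_def]
      rw [← PMF.bind_bind, this]
      simp only [PMF.map, PMF.bind_bind, PMF.pure_bind, Function.comp_def]
    · rw [PMF.pure_bind]; rfl
  all_goals dsimp only; rw [PMF.pure_bind]; rfl

/-! ### Sampling the memory at the end of the execution -/

namespace World

variable {Z : Environment} {Y : Requester} (secp : ℕ) {Dict : Implementation StorageDict}

/-- The configuration in which the content is represented by the memory `mem`. -/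
def withMem (mem : Dict.Mem) (s : World contentCollector Z Y) :
    World (storageCollector Dict) Z Y where
  phase := s.phase
  active := s.active
  z := s.z
  y := s.y
  x := mem
  control := s.control
  unread := s.unread
  zs := s.zs
  ys := s.ys

theorem stepZ_withMem (mem : Dict.Mem) (s : World contentCollector Z Y) (coin : Bool) :
    (s.withMem mem).stepZ secp coin = (s.stepZ secp coin).withMem mem := by
  unfold stepZ
  rw [show (s.withMem mem).z = s.z from rfl]
  rcases s.z.step coin with _ | ⟨z, _ | ⟨a, m⟩⟩
  · rfl
  · rfl
  · cases a <;> try rfl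
    dsimp only
    by_cases h : (splitTarget m).1 < s.zs.length
    · have h' : (splitTarget m).1 < (s.withMem mem).zs.length := h
      rw [if_pos h, if_pos h']
      rfl
    · have h' : ¬ (splitTarget m).1 < (s.withMem mem).zs.length := h
      rw [if_neg h, if_neg h']
      rfl

theorem tokenOf_withMem (mem : Dict.Mem) (s : World contentCollector Z Y) (j : ℕ) :
    (s.withMem mem).tokenOf j = s.tokenOf j := by
  unfold tokenOf
  cases h : s.ys[j]? with
  | none =>
    have h' : (s.withMem mem).ys[j]? = none := h
    rw [h']
  | some e =>
    have h' : (s.withMem mem).ys[j]? = some e := h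
    rw [h']
    rfl

theorem isToken_withMem (mem : Dict.Mem) (s : World contentCollector Z Y) (m : Msg) :
    (s.withMem mem).isToken m = s.isToken m := by
  unfold isToken
  simp only [tokenOf_withMem]
  rfl

theorem pure_withMem {mem : Dict.Mem} {s : World contentCollector Z Y}
    {t : World (storageCollector Dict) Z Y} (h : t = s.withMem mem) :
    PMF.pure t = (PMF.pure s).map (withMem mem) := by
  rw [h, PMF.pure_map]

theorem serverOf_withMem (mem : Dict.Mem) (s : World contentCollector Z Y) (sid : SID) :
    (s.withMem mem).serverOf sid = s.serverOf sid := by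
  obtain ⟨_ | _, j⟩ := sid <;> rfl

theorem stepY_withMem (mem : Dict.Mem) (s : World contentCollector Z Y) (coin : Bool) :
    (s.withMem mem).stepY secp coin = (s.stepY secp coin).withMem mem := by
  unfold stepY
  rw [show (s.withMem mem).y = s.y from rfl]
  rcases s.y.step coin with _ | ⟨y, _ | ⟨a, m⟩⟩
  · rfl
  · rfl
  · cases a <;> try rfl
    dsimp only
    cases h : s.ys[(splitTarget m).1]? with
    | none =>
      have h' : (s.withMem mem).ys[(splitTarget m).1]? = none := h
      rw [h']
      rfl
    | some e =>
      have h' : (s.withMem mem).ys[(splitTarget m).1]? = some e := h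
      rw [h']
      dsimp only
      have ht := isToken_withMem mem { s with y := y } (splitTarget m).2
      split_ifs with h₁ h₂ h₂
      · rfl
      · exact absurd (h₁.imp_right ht.symm.trans) h₂
      · exact absurd (h₂.imp_right ht.trans) h₁
      · rfl

theorem stepClientZ_withMem (mem : Dict.Mem) (s : World contentCollector Z Y) (j : ℕ)
    (coin : Bool) :
    (s.withMem mem).stepClientZ j coin = (s.stepClientZ j coin).withMem mem := by
  unfold stepClientZ
  cases h : s.zs[j]? with
  | none =>
    have h' : (s.withMem mem).zs[j]? = none := h
    rw [h']
    rfl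
  | some e =>
    have h' : (s.withMem mem).zs[j]? = some e := h
    rw [h']
    dsimp only
    rcases e.client.2.step coin with _ | ⟨y, _ | ⟨a, m⟩⟩
    · rfl
    · rfl
    · cases a <;> rfl

theorem passY_withMem (mem : Dict.Mem) (s : World contentCollector Z Y) :
    (s.withMem mem).passY = s.passY.withMem mem := by
  unfold passY
  rw [show (s.withMem mem).phase = s.phase from rfl]
  cases s.phase <;> rfl

theorem afterClientY_withMem (mem : Dict.Mem) (s : World contentCollector Z Y) (j : ℕ)
    (l : Stage) (f : Effect) :
    (s.withMem mem).afterClientY j l f = (s.afterClientY j l f).withMem mem := by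
  cases f
  · rfl
  · rfl
  · unfold afterClientY
    rw [← passY_withMem]
    rfl

theorem afterServer_withMem (mem : Dict.Mem) (s : World contentCollector Z Y) (sid : SID)
    (l : Stage) (f : Effect) :
    (s.withMem mem).afterServer sid l f = (s.afterServer sid l f).withMem mem := by
  obtain ⟨_ | _, j⟩ := sid <;> cases f <;> rfl

theorem wakeUntilHalt_withMem (mem : Dict.Mem) (s : World contentCollector Z Y) (j : ℕ)
    (e : Session Stage Stage) (next : Phase) :
    (s.withMem mem).wakeUntilHalt j e next = (s.wakeUntilHalt j e next).map (withMem mem) := by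
  unfold wakeUntilHalt
  dsimp only [storageCollector, contentCollector]
  simp only [PMF.pure_map]
  refine pure_withMem ?_
  rcases storageParty e.kind .client e.client .wake with ⟨l, _ | m | m⟩
  · rfl
  · rfl
  · exact (afterClientY_withMem mem s j l (.output m))

/-- The memory is read and written only when the collector is active; all other parties follow the
same code for both collectors. -/
theorem step_withMem (mem : Dict.Mem) (s : World contentCollector Z Y) (h : s.active ≠ .X) :
    (s.withMem mem).step secp = (s.step secp).map (withMem mem) := by
  unfold step
  rw [show (s.withMem mem).active = s.active from rfl]
  cases hs : s.active with
  | X => exact absurd hs h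
  | Y =>
    simp only [PMF.map_comp]
    exact congrArg (PMF.map · _) (funext fun coin => stepY_withMem secp mem s coin)
  | clientZ j =>
    simp only [PMF.map_comp]
    exact congrArg (PMF.map · _) (funext fun coin => stepClientZ_withMem mem s j coin)
  | clientY j ev =>
    dsimp only
    unfold stepClientY
    cases h : s.ys[j]? with
    | none =>
      have h' : (s.withMem mem).ys[j]? = none := h
      rw [h']
      exact pure_withMem rfl
    | some e =>
      have h' : (s.withMem mem).ys[j]? = some e := h
      rw [h']
      dsimp only [storageCollector, contentCollector]
      rw [PMF.pure_map, PMF.pure_map]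
      exact pure_withMem (afterClientY_withMem mem s j _ _)
  | server sid ev =>
    dsimp only
    unfold stepServer
    cases h : s.serverOf sid with
    | none =>
      have h' := (serverOf_withMem mem s sid).trans h
      rw [h']
      exact pure_withMem rfl
    | some e =>
      have h' := (serverOf_withMem mem s sid).trans h
      rw [h']
      dsimp only [storageCollector, contentCollector]
      rw [PMF.pure_map, PMF.pure_map]
      exact pure_withMem (afterServer_withMem mem s sid _ _)
  | main =>
    dsimp only
    rw [show (s.withMem mem).phase = s.phase from rfl]
    cases hp : s.phase with
    | alive =>
      simp only [PMF.map_comp]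
      exact congrArg (PMF.map · _) (funext fun coin => stepZ_withMem secp mem s coin)
    | runPi n =>
      dsimp only
      cases h : s.ys[n]? with
      | none =>
        have h' : (s.withMem mem).ys[n]? = none := h
        rw [h']
        exact pure_withMem rfl
      | some e =>
        have h' : (s.withMem mem).ys[n]? = some e := h
        rw [h']
        dsimp only
        by_cases hk : e.kind = .pi
        · rw [if_pos hk, if_pos hk]
          exact wakeUntilHalt_withMem mem s n e _
        · rw [if_neg hk, if_neg hk]
          exact pure_withMem rfl
    | request n =>
      dsimp only
      by_cases hn : n < s.ys.length
      · have hn' : n < (s.withMem mem).ys.length := hn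
        rw [if_pos hn, if_pos hn']
        cases h : s.tokenOf n with
        | none =>
          have h' := (tokenOf_withMem mem s n).trans h
          rw [h']
          exact pure_withMem rfl
        | some t =>
          have h' := (tokenOf_withMem mem s n).trans h
          rw [h']
          dsimp only
          by_cases hr : s.isRequested t = true
          · have hr' : (s.withMem mem).isRequested t = true := hr
            rw [if_pos hr, if_pos hr']
            exact pure_withMem rfl
          · have hr' : ¬ (s.withMem mem).isRequested t = true := hr
            rw [if_neg hr, if_neg hr']
            exact pure_withMem rfl
      · have hn' : ¬ n < (s.withMem mem).ys.length := hn
        rw [if_neg hn, if_neg hn']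
        exact pure_withMem rfl
    | runDel n =>
      dsimp only
      cases h : s.ys[n]? with
      | none =>
        have h' : (s.withMem mem).ys[n]? = none := h
        rw [h']
        exact pure_withMem rfl
      | some e =>
        have h' : (s.withMem mem).ys[n]? = some e := h
        rw [h']
        dsimp only
        by_cases hk : e.kind = .del
        · rw [if_pos hk, if_pos hk]
          exact wakeUntilHalt_withMem mem s n e _
        · rw [if_neg hk, if_neg hk]
          exact pure_withMem rfl
    | done => exact pure_withMem rfl

theorem stepZ_x (s : World contentCollector Z Y) (coin : Bool) :
    (s.stepZ secp coin).x = s.x := by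
  unfold stepZ
  rcases s.z.step coin with _ | ⟨z, _ | ⟨a, m⟩⟩
  · rfl
  · rfl
  · cases a <;> try rfl
    dsimp only
    split_ifs <;> rfl

theorem stepY_x (s : World contentCollector Z Y) (coin : Bool) :
    (s.stepY secp coin).x = s.x := by
  unfold stepY
  rcases s.y.step coin with _ | ⟨y, _ | ⟨a, m⟩⟩
  · rfl
  · rfl
  · cases a <;> try rfl
    dsimp only
    cases s.ys[(splitTarget m).1]? with
    | none => rfl
    | some e =>
      dsimp only
      split_ifs <;> rfl

theorem stepClientZ_x (s : World contentCollector Z Y) (j : ℕ) (coin : Bool) :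
    (s.stepClientZ j coin).x = s.x := by
  unfold stepClientZ
  cases s.zs[j]? with
  | none => rfl
  | some e =>
    dsimp only
    rcases e.client.2.step coin with _ | ⟨y, _ | ⟨a, m⟩⟩
    · rfl
    · rfl
    · cases a <;> rfl

theorem passY_x (s : World contentCollector Z Y) : s.passY.x = s.x := by
  unfold passY
  cases s.phase <;> rfl

theorem afterClientY_x (s : World contentCollector Z Y) (j : ℕ) (l : Stage) (f : Effect) :
    (s.afterClientY j l f).x = s.x := by
  cases f
  · rfl
  · rfl
  · exact passY_x _

theorem afterServer_x (s : World contentCollector Z Y) (sid : SID) (l : Stage) (f : Effect) :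
    (s.afterServer sid l f).x = s.x := by
  obtain ⟨_ | _, j⟩ := sid <;> cases f <;> rfl

theorem wakeUntilHalt_x (s : World contentCollector Z Y) (j : ℕ) (e : Session Stage Stage)
    (next : Phase) : ∀ s' ∈ (s.wakeUntilHalt j e next).support, s'.x = s.x := by
  unfold wakeUntilHalt
  dsimp only [contentCollector]
  rw [PMF.pure_map]
  intro s' hs'
  rw [PMF.support_pure] at hs'
  obtain rfl : s' = _ := hs'
  rcases storageParty e.kind .client e.client .wake with ⟨l, _ | m | m⟩
  · rfl
  · rfl
  · exact afterClientY_x _ _ _ (.output m)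

theorem step_x (s : World contentCollector Z Y) (h : s.active ≠ .X) :
    ∀ s' ∈ (s.step secp).support, s'.x = s.x := by
  have pure_x : ∀ t : World contentCollector Z Y, t.x = s.x →
      ∀ s' ∈ (PMF.pure t).support, s'.x = s.x := by
    intro t ht s' hs'
    rw [PMF.support_pure, Set.mem_singleton_iff] at hs'
    rw [hs', ht]
  have map_x : ∀ f : Bool → World contentCollector Z Y, (∀ b, (f b).x = s.x) →
      ∀ s' ∈ ((PMF.uniformOfFintype Bool).map f).support, s'.x = s.x := by
    intro f hf s' hs'
    obtain ⟨b, -, rfl⟩ := (PMF.mem_support_map_iff _ _ _).1 hs'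
    exact hf b
  unfold step
  cases hs : s.active with
  | X => exact absurd hs h
  | Y => exact map_x _ (stepY_x secp s)
  | clientZ j => exact map_x _ (stepClientZ_x s j)
  | clientY j ev =>
    dsimp only [stepClientY]
    split
    · exact pure_x _ rfl
    · dsimp only [contentCollector]
      rw [PMF.pure_map]
      exact pure_x _ (afterClientY_x _ _ _ _)
  | server sid ev =>
    dsimp only [stepServer]
    split
    · exact pure_x _ rfl
    · dsimp only [contentCollector]
      rw [PMF.pure_map]
      exact pure_x _ (afterServer_x _ _ _ _)
  | main =>
    dsimp only
    split
    · exact map_x _ (stepZ_x secp s)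
    · split
      · exact pure_x _ rfl
      · split
        · exact wakeUntilHalt_x s _ _ _
        · exact pure_x _ rfl
    · split
      · split
        · exact pure_x _ rfl
        · split <;> exact pure_x _ rfl
      · exact pure_x _ rfl
    · split
      · exact pure_x _ rfl
      · split
        · exact wakeUntilHalt_x s _ _ _
        · exact pure_x _ rfl
    · exact pure_x _ rfl

/-- The configuration after an activation of the data collector with a given effect. -/
def afterX {C : DataCollector} (s : World C Z Y) (r : C.State × Option (ℕ × Msg)) :
    World C Z Y :=
  let s : World C Z Y := { s with x := r.1, unread := s.unread.tail, active := .main }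
  match r.2 with
  | none => s
  | some (h, m) =>
    match s.control[h]? with
    | none => s
    | some sid => { s with active := .server sid (.input m) }

theorem afterX_withMem (mem mem' : Dict.Mem) (s : World contentCollector Z Y) (x : Content)
    (r : Option (ℕ × Msg)) :
    (s.withMem mem).afterX (mem', r) = (s.afterX (x, r)).withMem mem' := by
  unfold afterX
  rcases r with _ | ⟨h, m⟩
  · rfl
  · dsimp only
    rw [show (s.withMem mem).control = s.control from rfl]
    cases s.control[h]? <;> rfl

theorem afterX_x {C : DataCollector} (s : World C Z Y) (r : C.State × Option (ℕ × Msg)) :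
    (s.afterX r).x = r.1 := by
  unfold afterX
  rcases r with ⟨x, _ | ⟨h, m⟩⟩
  · rfl
  · dsimp only
    cases s.control[h]? <;> rfl

theorem stepX_eq {C : DataCollector} (s : World C Z Y) :
    s.stepX secp =
      (C.act secp s.x (s.unread.head?.map fun r => (s.control.idxOf r.1, r.2))).map s.afterX :=
  rfl

theorem step_of_X {C : DataCollector} {s : World C Z Y} (h : s.active = .X) :
    s.step secp = s.stepX secp := by
  unfold step
  rw [h]

theorem contentMem_bind_act (hDict : Dict.HistoryIndependent) (x : Content)
    (r : Option (ℕ × Msg)) :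
    (contentMem Dict x).bind (fun mem => (storageCollector Dict).act secp mem r) =
      (contentCollector.act secp x r).bind fun t =>
        (contentMem Dict t.1).map fun mem => (mem, t.2) := by
  rcases r with _ | ⟨h, m⟩
  · dsimp only [storageCollector, contentCollector]
    rw [PMF.pure_bind]
    rfl
  · have := congrArg (PMF.map fun t : Dict.Mem × Option Msg =>
      (t.1, t.2.map fun reply => (h, reply))) (contentMem_bind_reply hDict secp x m)
    rw [PMF.map_bind, PMF.map_bind] at this
    refine this.trans ?_
    dsimp only [storageCollector, contentCollector]
    rw [PMF.bind_map]
    simp only [PMF.map_comp]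
    rfl

theorem contentMem_expect_act (hDict : Dict.HistoryIndependent) (x : Content)
    (r : Option (ℕ × Msg)) (F : Dict.Mem × Option (ℕ × Msg) → ℝ≥0∞) :
    ((contentMem Dict x).expect fun mem =>
        PMF.expect ((storageCollector Dict).act secp mem r) F) =
      PMF.expect (contentCollector.act secp x r) fun t =>
        (contentMem Dict t.1).expect fun mem => F (mem, t.2) := by
  have := congrArg (fun p => PMF.expect p F) (contentMem_bind_act secp hDict x r)
  refine (PMF.expect_bind _ _ _).symm.trans (this.trans ((PMF.expect_bind _ _ _).trans ?_))
  exact congrArg _ (funext fun t => PMF.expect_map _ _ _)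

/-- With a history-independent dictionary, the memory can be sampled at the end, given the content
of the dictionary. -/
theorem value_withMem (hDict : Dict.HistoryIndependent)
    (g : World (storageCollector Dict) Z Y → ℝ≥0∞) (T : ℕ) (s : World contentCollector Z Y) :
    ((contentMem Dict s.x).expect fun mem => value secp g T (s.withMem mem)) =
      value secp (fun s => (contentMem Dict s.x).expect fun mem => g (s.withMem mem)) T s := by
  induction T generalizing s with
  | zero => rfl
  | succ T ih =>
    simp only [value]
    by_cases h : s.active = .X
    · have h' (mem) : (s.withMem mem : World (storageCollector Dict) Z Y).active = .X := h
      rw [step_of_X secp h]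
      simp only [step_of_X secp (h' _), stepX_eq, PMF.expect_map]
      have hf (mem : Dict.Mem) (a : Dict.Mem × Option (ℕ × Msg)) :
          value secp g T ((s.withMem mem).afterX a) =
            value secp g T ((s.afterX (s.x, a.2)).withMem a.1) :=
        congrArg _ (afterX_withMem mem a.1 s s.x a.2)
      have ht (t : Content × Option (ℕ × Msg)) :
          ((contentMem Dict t.1).expect fun mem =>
            value secp g T ((s.afterX (s.x, t.2)).withMem mem)) =
          value secp (fun s => (contentMem Dict s.x).expect fun mem => g (s.withMem mem)) T
            (s.afterX t) := by
        have hx : (s.afterX t).x = t.1 := afterX_x s t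
        rw [← ih]
        refine Eq.trans ?_ (congrArg (fun x => (contentMem Dict x).expect fun mem =>
          value secp g T ((s.afterX t).withMem mem)) hx.symm)
        refine PMF.expect_congr fun mem _ => congrArg _ ?_
        exact (afterX_withMem mem mem s s.x t.2).symm.trans (afterX_withMem mem mem s t.1 t.2)
      refine Eq.trans ?_ ((contentMem_expect_act secp hDict s.x _ fun a =>
        value secp g T ((s.afterX (s.x, a.2)).withMem a.1)).trans (congrArg _ (funext ht)))
      exact congrArg _ (funext fun mem => congrArg _ (funext fun a => hf mem a))
    · simp only [step_withMem secp _ s h, PMF.expect_map]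
      -- The step and the memory are independent here, and the step preserves the content that
      -- governs the memory.
      rw [PMF.expect_comm]
      refine PMF.expect_congr fun s' hs' => ?_
      rw [← ih, step_x secp s h s' hs']

end World

/-! ## Messages with several fields -/

theorem fields_map_append (f : List Bool) (m : Msg) :
    fields (f.map some ++ none :: m) = f :: fields m := by
  induction f with
  | nil => rfl
  | cons b f ih => simp [fields, ih]

theorem fields_map (f : List Bool) : fields (f.map some) = [f] := by
  induction f with
  | nil => rfl
  | cons b f ih => simp [fields, ih]

theorem fields_tuple : ∀ {fs : List (List Bool)}, fs ≠ [] → fields (tuple fs) = fs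
  | [], h => absurd rfl h
  | [f], _ => fields_map f
  | f :: g :: fs, _ => by
    rw [tuple, fields_map_append, fields_tuple (List.cons_ne_nil g fs)]

/-- The deletion token of an insertion under the key `k`. -/
def tokenMsg (k : StorageKey) : Msg := tuple [k.1, k.2]

theorem fields_tokenMsg (k : StorageKey) : fields (tokenMsg k) = [k.1, k.2] :=
  fields_tuple (by simp)

theorem tokenMsg_injective : Function.Injective tokenMsg := by
  intro k k' h
  have := congrArg fields h
  simp only [fields_tokenMsg, List.cons.injEq, and_true] at this
  exact Prod.ext this.1 this.2

theorem tokenMsg_ne_nil (k : StorageKey) : tokenMsg k ≠ [] := by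
  simp [tokenMsg, tuple]

/-! ## Erasing keys -/

namespace Content

/-- The content without the keys in the list. -/
def erase (x : Content) (L : List StorageKey) : Content :=
  L.foldl (fun x k => x.apply (.delete k)) x

theorem get_erase (x : Content) (L : List StorageKey) (k : StorageKey) :
    (x.erase L).get k = if k ∈ L then none else x.get k := by
  induction L generalizing x with
  | nil => simp [erase]
  | cons k' L ih =>
    have : x.erase (k' :: L) = (x.apply (.delete k')).erase L := rfl
    rw [this, ih, get_delete]
    by_cases h₁ : k ∈ L <;> by_cases h₂ : k = k' <;> simp [h₁, h₂]

theorem erase_eq_self {x : Content} {L : List StorageKey} (h : ∀ k ∈ L, x.get k = none) :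
    x.erase L = x :=
  ext fun k => by
    rw [get_erase]
    split_ifs with hk
    · exact (h k hk).symm
    · rfl

/-- Outside `L`, erasing does not change whether `k` is in use, so both insertions succeed or fail
together. -/
theorem erase_insert {x : Content} {L : List StorageKey} {k : StorageKey} (hk : k ∉ L)
    (v : List Bool) : (x.apply (.insert k v)).erase L = (x.erase L).apply (.insert k v) :=
  ext fun k' => by
    simp only [get_erase, get_insert, if_neg hk]
    split_ifs with h₁ h₂ <;> simp_all

/-- No condition relates `k` to `L`: this is why deletions by the environment need not be charged,
even if they hit a key of the requester. -/
theorem erase_delete (x : Content) (L : List StorageKey) (k : StorageKey) :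
    (x.apply (.delete k)).erase L = (x.erase L).apply (.delete k) :=
  ext fun k' => by
    simp only [get_erase, get_delete]
    split_ifs <;> rfl

/-- Makes an insertion of the requester invisible. If `k` were in use, erasing it could remove an
older entry, possibly one of the environment; hence `hk`. -/
theorem erase_cons_insert {x : Content} {k : StorageKey} (hk : x.get k = none)
    (L : List StorageKey) (v : List Bool) :
    (x.apply (.insert k v)).erase (k :: L) = x.erase L :=
  ext fun k' => by
    simp only [get_erase, get_insert, List.mem_cons]
    by_cases h₁ : k' = k
    · subst h₁; simp [hk]
    · simp [h₁]

theorem erase_delete_of_mem {x : Content} {L : List StorageKey} {k : StorageKey} (hk : k ∈ L) :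
    (x.apply (.delete k)).erase L = x.erase L :=
  ext fun k' => by
    simp only [get_erase, get_delete]
    split_ifs <;> simp_all

end Content

/-! ## The execution without a deletion-requester -/

inductive ZActive where
  | main
  | X (j : ℕ) (m : Msg)
  | client (j : ℕ)
  | server (j : ℕ) (e : Event)

/-- The part of the global configuration that does not concern the deletion-requester; `live` is
`false` after the alive phase. -/
structure ZWorld (Z : Environment) where
  live : Bool
  active : ZActive
  z : Z.machine.Config
  x : Content
  zs : List (Session (Σ c : Z.Code, (Z.client c).Config) Stage)

namespace ZWorld

variable {Z : Environment} (secp : ℕ)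

def stepMain (u : ZWorld Z) (coin : Bool) : ZWorld Z :=
  match u.z.step coin with
  | none => { u with live := false }
  | some (z, none) => { u with z := z }
  | some (z, some (a, m)) =>
    let u : ZWorld Z := { u with z := z }
    match a with
    | .writeInput =>
      let t := splitTarget m
      if t.1 < u.zs.length then
        { u with
          active := .client t.1
          zs := u.zs.modify t.1 fun e =>
            { e with
              client := ⟨e.client.1, e.client.2.write .input (none :: t.2)⟩
              given := e.given.or (some t.2) } }
      else u
    | .initiate k c =>
      { u with
        z := u.z.write .control (identOf u.zs.length)
        zs := u.zs ++ [⟨k, ⟨c, ((Z.client c).init secp).write .ident (identOf u.zs.length)⟩,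
          .fresh, [], none⟩] }
    | .endAlive => { u with live := false }
    | _ => u

def stepClient (u : ZWorld Z) (j : ℕ) (coin : Bool) : ZWorld Z :=
  match u.zs[j]? with
  | none => { u with active := .main }
  | some e =>
    match e.client.2.step coin with
    | none => { u with active := .main }
    | some (c, a) =>
      let e : Session (Σ c : Z.Code, (Z.client c).Config) Stage :=
        { e with client := ⟨e.client.1, c⟩ }
      match a with
      | none => { u with zs := u.zs.set j e }
      | some (.send, m) =>
        { u with
          active := .server j (.incoming m)
          zs := u.zs.set j { e with transcript := e.transcript ++ [(.client, m)] } }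
      | some (.output, m) =>
        { u with
          active := .main
          zs := u.zs.set j e
          z := u.z.write .reports (identOf j ++ m ++ [none]) }
      | some _ => { u with active := .main, zs := u.zs.set j e }

def afterServer (u : ZWorld Z) (j : ℕ) (l : Stage) (f : Effect) : ZWorld Z :=
  let u : ZWorld Z := { u with zs := u.zs.modify j fun e => { e with server := l } }
  match f with
  | .halt => { u with active := .main }
  | .send m => { u with
      active := .client j
      zs := u.zs.modify j fun e =>
        { e with
          client := ⟨e.client.1, e.client.2.write .incoming (m ++ [none])⟩
          transcript := e.transcript ++ [(.server, m)] } }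
  | .output m => { u with active := .X j m }

def stepServer (u : ZWorld Z) (j : ℕ) (ev : Event) : ZWorld Z :=
  match u.zs[j]? with
  | none => { u with active := .main }
  | some e =>
    u.afterServer j (storageParty e.kind .server e.server ev).1
      (storageParty e.kind .server e.server ev).2

def afterX (u : ZWorld Z) (j : ℕ) (t : Content × Option Msg) : ZWorld Z :=
  match t.2 with
  | none => { u with x := t.1, active := .main }
  | some a => { u with x := t.1, active := .server j (.input a) }

/-- A step of whoever is activated, until the end of the alive phase. -/
noncomputable def step (u : ZWorld Z) : PMF (ZWorld Z) :=
  if u.live then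
    match u.active with
    | .main => (PMF.uniformOfFintype Bool).map (u.stepMain secp)
    | .client j => (PMF.uniformOfFintype Bool).map (u.stepClient j)
    | .server j ev => PMF.pure (u.stepServer j ev)
    | .X j m => (contentReply secp u.x m).map (u.afterX j)
  else PMF.pure u

/-- The probability that the next step has to do with a given authentication string. -/
noncomputable def hit (u : ZWorld Z) (a : List Bool) : ℝ≥0∞ :=
  if u.live then
    match u.active with
    | .X _ m =>
      match fields m with
      | [inst, _, arg] =>
        -- An insertion draws `a` with at most this probability; any other message counts in full if
        -- it carries `a`. Counting deletions too is harmless, as only an upper bound is needed.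
        if inst = insCode then ((2 : ℝ≥0∞) ^ secp)⁻¹ else if arg = a then 1 else 0
      | _ => 0
    | _ => 0
  else 0

/-- The expected reward after `T` further steps. -/
noncomputable def value (h : ZWorld Z → ℝ≥0∞) : ℕ → ZWorld Z → ℝ≥0∞
  | 0, u => h u
  | T + 1, u => (u.step secp).expect (value h T)

/-- A bound for the expected number of steps, among the next `T` ones, that have to do with a given
authentication string. -/
noncomputable def guess (a : List Bool) : ℕ → ZWorld Z → ℝ≥0∞
  | 0, _ => 0
  | T + 1, u => u.hit secp a + (u.step secp).expect (guess a T)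

/-- The expected reward, increased by the expected numbers of steps that have to do with the
authentication strings in a list of keys. -/
noncomputable def bound (h : ZWorld Z → ℝ≥0∞) (L : List StorageKey) (T : ℕ) (u : ZWorld Z) :
    ℝ≥0∞ :=
  value secp h T u + (L.map fun k => guess secp k.2 T u).sum

theorem step_of_not_live {u : ZWorld Z} (hu : u.live = false) : u.step secp = PMF.pure u := by
  simp [step, hu]

theorem value_le_succ {h : ZWorld Z → ℝ≥0∞} (hh : ∀ u, u.live = true → h u = 0) (T : ℕ)
    (u : ZWorld Z) : value secp h T u ≤ value secp h (T + 1) u := by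
  induction T generalizing u with
  | zero =>
    cases hu : u.live with
    | true => simp [value, hh u hu]
    | false => simp [value, step_of_not_live secp hu, PMF.expect_pure]
  | succ T ih => exact PMF.expect_mono fun u' _ => ih u'

theorem guess_le_succ (a : List Bool) (T : ℕ) (u : ZWorld Z) :
    guess secp a T u ≤ guess secp a (T + 1) u := by
  induction T generalizing u with
  | zero => exact zero_le
  | succ T ih => exact add_le_add_right (PMF.expect_mono fun u' _ => ih u') _

/-- Used when the actual execution spends a step on the requester or in the terminate phase, during
which `ZWorld` stands still. -/
theorem bound_le_succ {h : ZWorld Z → ℝ≥0∞} (hh : ∀ u, u.live = true → h u = 0)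
    (L : List StorageKey) (T : ℕ) (u : ZWorld Z) :
    bound secp h L T u ≤ bound secp h L (T + 1) u :=
  add_le_add (value_le_succ secp hh T u)
    (List.sum_le_sum fun k _ => guess_le_succ secp k.2 T u)

theorem bound_succ (h : ZWorld Z → ℝ≥0∞) (L : List StorageKey) (T : ℕ) (u : ZWorld Z) :
    bound secp h L (T + 1) u =
      (L.map fun k => u.hit secp k.2).sum + (u.step secp).expect (bound secp h L T) := by
  have : (u.step secp).expect (bound secp h L T) = (u.step secp).expect (value secp h T) +
      (L.map fun k => (u.step secp).expect (guess secp k.2 T)).sum := by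
    rw [← PMF.expect_list_sum, ← PMF.expect_add]
    rfl
  rw [this, bound]
  simp only [value, guess, List.sum_map_add]
  ring

theorem value_add_le_one {h₁ h₂ : ZWorld Z → ℝ≥0∞} (hh : ∀ u, h₁ u + h₂ u ≤ 1) (T : ℕ)
    (u : ZWorld Z) : value secp h₁ T u + value secp h₂ T u ≤ 1 := by
  induction T generalizing u with
  | zero => exact hh u
  | succ T ih =>
    simp only [value, ← PMF.expect_add]
    exact PMF.expect_le_const fun u' _ => ih u'

/-- An insertion contributes `1 / 2 ^ secp` for each of the `2 ^ secp` strings, while any other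
message carries one string only. -/
theorem sum_hit_le (u : ZWorld Z) :
    ∑ r : Fin secp → Bool, u.hit secp (List.ofFn r) ≤ 1 := by
  unfold hit
  split_ifs
  · split
    · split
      · split_ifs
        · simp only [Finset.sum_const, Finset.card_univ, Fintype.card_pi, Fintype.card_bool,
            Finset.prod_const, Fintype.card_fin, nsmul_eq_mul, Nat.cast_pow, Nat.cast_ofNat]
          exact ENNReal.mul_inv_le_one _
        · rename_i arg _ _
          by_cases harg : ∃ r : Fin secp → Bool, arg = List.ofFn r
          · obtain ⟨r, rfl⟩ := harg
            simp [List.ofFn_inj]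
          · push Not at harg
            simp [harg]
      · simp
    · simp
  · simp

/-- The run from `u` does not depend on the string, so the sum over strings can be taken inside the
expectation, where each step contributes at most 1. Dividing by `2 ^ secp` bounds the expected hits
on a uniformly drawn string. -/
theorem sum_guess_le (T : ℕ) (u : ZWorld Z) :
    ∑ r : Fin secp → Bool, guess secp (List.ofFn r) T u ≤ T := by
  induction T generalizing u with
  | zero => simp [guess]
  | succ T ih =>
    simp only [guess, Finset.sum_add_distrib]
    rw [← PMF.expect_sum, Nat.cast_succ, add_comm]
    exact add_le_add (PMF.expect_le_const fun u' _ => ih u') (sum_hit_le secp u)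

end ZWorld

/-! ## Forgetting the deletion-requester -/

namespace World

variable {Z : Environment} {Y : Requester} (secp : ℕ)

def _root_.Phase.isAlive : Phase → Bool
  | .alive => true
  | _ => false

/-- The active machine as far as the environment is concerned: when the deletion-requester or one
of its instances is active, the environment is going to be activated. -/
def activeZ (a : Active) (unread : List (SID × Msg)) : ZActive :=
  match a with
  | .clientZ j => .client j
  | .server (.Z, j) ev => .server j ev
  | .X =>
    match unread with
    | ((.Z, j), m) :: _ => .X j m
    | _ => .main
  | _ => .main

/-- The part of the configuration that does not concern the deletion-requester, which has inserted
values under the keys in `L`. -/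
def forget (s : World contentCollector Z Y) (L : List StorageKey) : ZWorld Z where
  live := s.phase.isAlive
  active := activeZ s.active s.unread
  z := s.z
  x := Content.erase s.x L
  zs := s.zs

/-- Waking the requester, writing to it, or waking the collector with nothing to read leaves the
environment next in line, so `ZWorld` treats these actions as void; this uses that no output is
unread. -/
theorem forget_stepZ (s : World contentCollector Z Y) (L : List StorageKey) (coin : Bool)
    (hp : s.phase = .alive) (ha : s.active = .main) (hu : s.unread = []) :
    (s.stepZ secp coin).forget L = (s.forget L).stepMain secp coin := by
  obtain ⟨phase, active, z, y, x, control, unread, zs, ys⟩ := s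
  dsimp only at hp ha hu
  subst hp ha hu
  unfold stepZ ZWorld.stepMain
  dsimp only [forget]
  rcases z.step coin with _ | ⟨z, _ | ⟨a, m⟩⟩
  · rfl
  · rfl
  · cases a <;> try rfl
    dsimp only
    split_ifs <;> rfl

theorem forget_stepClientZ (s : World contentCollector Z Y) (L : List StorageKey) (j : ℕ)
    (coin : Bool) (ha : s.active = .clientZ j) :
    (s.stepClientZ j coin).forget L = (s.forget L).stepClient j coin := by
  obtain ⟨phase, active, z, y, x, control, unread, zs, ys⟩ := s
  dsimp only at ha
  subst ha
  unfold stepClientZ ZWorld.stepClient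
  dsimp only [forget]
  cases zs[j]? with
  | none => rfl
  | some e =>
    dsimp only
    rcases e.client.2.step coin with _ | ⟨c, _ | ⟨a, m⟩⟩
    · rfl
    · rfl
    · cases a <;> rfl

theorem forget_afterServer (s : World contentCollector Z Y) (L : List StorageKey) (j : ℕ)
    (l : Stage) (f : Effect) (hu : s.unread = []) :
    (s.afterServer (.Z, j) l f).forget L = (s.forget L).afterServer j l f := by
  obtain ⟨phase, active, z, y, x, control, unread, zs, ys⟩ := s
  dsimp only at hu
  subst hu
  cases f <;> rfl

theorem step_of_Y {s : World contentCollector Z Y} (h : s.active = .Y) :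
    s.step secp = (PMF.uniformOfFintype Bool).map (s.stepY secp) := by
  unfold step
  rw [h]

theorem step_of_clientZ {s : World contentCollector Z Y} {j : ℕ} (h : s.active = .clientZ j) :
    s.step secp = (PMF.uniformOfFintype Bool).map (s.stepClientZ j) := by
  unfold step
  rw [h]

theorem step_of_alive {s : World contentCollector Z Y} (h : s.active = .main)
    (hp : s.phase = .alive) :
    s.step secp = (PMF.uniformOfFintype Bool).map (s.stepZ secp) := by
  unfold step
  rw [h, hp]

theorem step_of_server {s : World contentCollector Z Y} {sid : SID} {ev : Event}
    (h : s.active = .server sid ev) :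
    s.step secp = PMF.pure (match s.serverOf sid with
      | none => { s with active := .main }
      | some (k, l) => s.afterServer sid (storageParty k .server l ev).1
          (storageParty k .server l ev).2) := by
  unfold step
  rw [h]
  dsimp only [stepServer]
  cases s.serverOf sid with
  | none => rfl
  | some e => exact PMF.pure_map _ _

theorem step_of_clientY {s : World contentCollector Z Y} {j : ℕ} {ev : Event}
    (h : s.active = .clientY j ev) :
    s.step secp = PMF.pure (match s.ys[j]? with
      | none => { s with active := .main }
      | some e => s.afterClientY j (storageParty e.kind .client e.client ev).1
          (storageParty e.kind .client e.client ev).2) := by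
  unfold step
  rw [h]
  dsimp only [stepClientY]
  cases s.ys[j]? with
  | none => rfl
  | some e => exact PMF.pure_map _ _

/-- The server of the environment's instance, seen by the environment. -/
theorem forget_server (s : World contentCollector Z Y) (L : List StorageKey) (j : ℕ) (ev : Event)
    (hu : s.unread = []) :
    (match s.serverOf (.Z, j) with
      | none => { s with active := .main }
      | some (k, l) => s.afterServer (.Z, j) (storageParty k .server l ev).1
          (storageParty k .server l ev).2).forget L = (s.forget L).stepServer j ev := by
  unfold ZWorld.stepServer
  have h : s.serverOf (.Z, j) = (s.forget L).zs[j]?.map fun e => (e.kind, e.server) := rfl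
  rw [h]
  cases (s.forget L).zs[j]? with
  | none => rfl
  | some e => exact forget_afterServer s L j _ _ hu

/-! ## Invariants of the execution -/

/-- The instances of the deletion-requester with a smaller number have been dealt with in the
terminate phase; `none` means all of them. -/
def _root_.Phase.pendingFrom : Phase → Option ℕ
  | .alive => some 0
  | .runPi _ => some 0
  | .request n => some n
  | .runDel _ => none
  | .done => none

/-- An instance of the deletion-requester is new, or its client has been used; in the latter case,
its deletion token is empty or belongs to a key in `L`. -/
def SessionGood (L : List StorageKey) (e : Session Stage Stage) : Prop :=
  (e.client = .fresh ∧ e.server = .fresh ∧ e.transcript = [] ∧ e.given = none) ∨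
    (e.client ≠ .fresh ∧ e.given ≠ none ∧
      (e.kind = .pi → ∀ t, storageToken e.transcript = some t → t = [] ∨ ∃ k ∈ L, t = tokenMsg k) ∧
      (e.kind = .del → ∀ t, e.given = some t → t = [] ∨ ∃ k ∈ L, t = tokenMsg k))

/-- The deletion token of `k` still has to be given to an instance of `π_D`. -/
def Pending (phase : Phase) (ys : List (Session Stage Stage)) (k : StorageKey) : Prop :=
  (∃ n, phase.pendingFrom = some n ∧ ∃ j, n ≤ j ∧ ∃ e, ys[j]? = some e ∧ e.kind = .pi ∧
    storageToken e.transcript = some (tokenMsg k)) ∧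
  ∀ e ∈ ys, e.kind = .del → e.given ≠ some (tokenMsg k)

/-- The invariant: `L` are the keys under which the deletion-requester has inserted values, `F`
contains all authentication strings in use; the token `t` is exempted. -/
structure Good (phase : Phase) (x : Content) (control : List SID) (n : ℕ)
    (ys : List (Session Stage Stage)) (L : List StorageKey) (F : List (List Bool)) (t : Msg) :
    Prop where
  control_Z : ∀ j < n, (Owner.Z, j) ∈ control
  control_Y : ∀ j < ys.length, (Owner.Y, j) ∈ control
  mem_of_get : ∀ k, x.get k ≠ none → k.2 ∈ F
  mem_of_mem : ∀ k ∈ L, k.2 ∈ F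
  session : ∀ e ∈ ys, SessionGood L e
  pending : ∀ k ∈ L, x.get k ≠ none → tokenMsg k ≠ t → Pending phase ys k

def GoodWorld (s : World contentCollector Z Y) (L : List StorageKey) (F : List (List Bool))
    (t : Msg) : Prop :=
  Good s.phase s.x s.control s.zs.length s.ys L F t

/-- The configurations between the runs of instances of the deletion-requester. -/
def Stable (s : World contentCollector Z Y) : Prop :=
  (s.active = .main ∧ s.unread = []) ∨ (s.phase = .alive ∧
    ((s.active = .Y ∧ s.unread = []) ∨ (∃ j, s.active = .clientZ j ∧ s.unread = []) ∨
      (∃ j ev, s.active = .server (.Z, j) ev ∧ s.unread = []) ∨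
      (s.active = .X ∧ s.unread = []) ∨
      ∃ j m, s.active = .X ∧ s.unread = [((.Z, j), m)] ∧ (Owner.Z, j) ∈ s.control))

end World

namespace World

variable {Z : Environment} {Y : Requester} (secp : ℕ)

/-! ## Steps that concern the environment -/

/-- The reward after `T` steps is bounded in terms of the execution without a deletion-requester;
at most `N` authentication strings are in use. -/
def Bounded (g : World contentCollector Z Y → ℝ≥0∞) (h : ZWorld Z → ℝ≥0∞) (N T : ℕ) : Prop :=
  ∀ (s : World contentCollector Z Y) (L : List StorageKey) (F : List (List Bool)),
    GoodWorld s L F [] → Stable s → F.length + T ≤ N →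
      value secp g T s ≤ (s.forget L).bound secp h L T + T * (N * ((2 : ℝ≥0∞) ^ secp)⁻¹)

variable {secp}

/-- The coupled step: both executions use the same sample from `p`. The immediate hits in `bound`
are not needed and are discarded. -/
theorem value_succ_le_of_map {g : World contentCollector Z Y → ℝ≥0∞} {h : ZWorld Z → ℝ≥0∞}
    {α : Type} {p : PMF α} {f : α → World contentCollector Z Y} {f' : α → ZWorld Z}
    {s : World contentCollector Z Y} {u : ZWorld Z} {L : List StorageKey} {T : ℕ} {c : ℝ≥0∞}
    (hs : s.step secp = p.map f) (hu : u.step secp = p.map f')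
    (H : ∀ a, value secp g T (f a) ≤ (f' a).bound secp h L T + c) :
    value secp g (T + 1) s ≤ u.bound secp h L (T + 1) + c := by
  rw [value, hs, PMF.expect_map, ZWorld.bound_succ, hu, PMF.expect_map]
  calc p.expect (fun a => value secp g T (f a))
      ≤ p.expect (fun a => (f' a).bound secp h L T + c) := PMF.expect_mono fun a _ => H a
    _ = p.expect (fun a => (f' a).bound secp h L T) + c := by
      rw [PMF.expect_add, PMF.expect_const]
    _ ≤ _ := by gcongr; exact le_add_self

theorem value_succ_le_of_forall {g : World contentCollector Z Y → ℝ≥0∞}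
    {s : World contentCollector Z Y} {T : ℕ} {c : ℝ≥0∞}
    (H : ∀ s' ∈ (s.step secp).support, value secp g T s' ≤ c) :
    value secp g (T + 1) s ≤ c :=
  PMF.expect_le_const H

theorem goodWorld_of_eq {s s' : World contentCollector Z Y} {L : List StorageKey}
    {F : List (List Bool)} {t : Msg} (hG : GoodWorld s L F t)
    (hp : s'.phase.pendingFrom = s.phase.pendingFrom) (hx : s'.x = s.x)
    (hc : s'.control = s.control) (hz : s'.zs.length = s.zs.length) (hy : s'.ys = s.ys) :
    GoodWorld s' L F t := by
  obtain ⟨h₁, h₂, h₃, h₄, h₅, h₆⟩ := hG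
  unfold GoodWorld
  rw [hx, hc, hz, hy]
  refine ⟨h₁, h₂, h₃, h₄, h₅, fun k hk hx ht => ?_⟩
  have := h₆ k hk hx ht
  unfold Pending at this ⊢
  rwa [hp]

theorem good_stepZ {s : World contentCollector Z Y} {L : List StorageKey} {F : List (List Bool)}
    (hG : GoodWorld s L F []) (hp : s.phase = .alive) (ha : s.active = .main)
    (hu : s.unread = []) (coin : Bool) :
    GoodWorld (s.stepZ secp coin) L F [] ∧ Stable (s.stepZ secp coin) := by
  have hpend (n) : (Phase.runPi n).pendingFrom = s.phase.pendingFrom := by rw [hp]; rfl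
  unfold stepZ
  rcases s.z.step coin with _ | ⟨z, _ | ⟨a, m⟩⟩
  · exact ⟨goodWorld_of_eq hG (hpend 0) rfl rfl rfl rfl, .inl ⟨ha, hu⟩⟩
  · exact ⟨goodWorld_of_eq hG rfl rfl rfl rfl rfl, .inl ⟨ha, hu⟩⟩
  · cases a with
    | tellY => exact ⟨goodWorld_of_eq hG rfl rfl rfl rfl rfl, .inr ⟨hp, .inl ⟨rfl, hu⟩⟩⟩
    | wakeY => exact ⟨goodWorld_of_eq hG rfl rfl rfl rfl rfl, .inr ⟨hp, .inl ⟨rfl, hu⟩⟩⟩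
    | wakeX =>
      exact ⟨goodWorld_of_eq hG rfl rfl rfl rfl rfl,
        .inr ⟨hp, .inr (.inr (.inr (.inl ⟨rfl, hu⟩)))⟩⟩
    | endAlive => exact ⟨goodWorld_of_eq hG (hpend 0) rfl rfl rfl rfl, .inl ⟨ha, hu⟩⟩
    | writeInput =>
      dsimp only
      split_ifs
      · exact ⟨goodWorld_of_eq hG rfl rfl rfl (List.length_modify ..) rfl,
          .inr ⟨hp, .inr (.inl ⟨_, rfl, hu⟩)⟩⟩
      · exact ⟨goodWorld_of_eq hG rfl rfl rfl rfl rfl, .inl ⟨ha, hu⟩⟩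
    | initiate k c =>
      refine ⟨?_, .inl ⟨ha, hu⟩⟩
      obtain ⟨h₁, h₂, h₃, h₄, h₅, h₆⟩ := hG
      refine ⟨fun j hj => ?_, fun j hj => ?_, h₃, h₄, h₅, h₆⟩
      · simp only [openZ, List.length_append, List.length_cons, List.length_nil] at hj
        simp only [openZ, List.mem_append, List.mem_singleton, Prod.mk.injEq, true_and]
        rcases Nat.lt_succ_iff_lt_or_eq.1 hj with hj | hj
        · exact .inl (h₁ j hj)
        · exact .inr hj
      · exact List.mem_append_left _ (h₂ j hj)
    | send => exact ⟨goodWorld_of_eq hG rfl rfl rfl rfl rfl, .inl ⟨ha, hu⟩⟩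
    | output => exact ⟨goodWorld_of_eq hG rfl rfl rfl rfl rfl, .inl ⟨ha, hu⟩⟩
    | yield => exact ⟨goodWorld_of_eq hG rfl rfl rfl rfl rfl, .inl ⟨ha, hu⟩⟩

theorem good_stepClientZ {s : World contentCollector Z Y} {L : List StorageKey}
    {F : List (List Bool)} {j : ℕ} (hG : GoodWorld s L F []) (hp : s.phase = .alive)
    (ha : s.active = .clientZ j) (hu : s.unread = []) (coin : Bool) :
    GoodWorld (s.stepClientZ j coin) L F [] ∧ Stable (s.stepClientZ j coin) := by
  unfold stepClientZ
  cases s.zs[j]? with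
  | none => exact ⟨goodWorld_of_eq hG rfl rfl rfl rfl rfl, .inl ⟨rfl, hu⟩⟩
  | some e =>
    dsimp only
    rcases e.client.2.step coin with _ | ⟨c, _ | ⟨a, m⟩⟩
    · exact ⟨goodWorld_of_eq hG rfl rfl rfl rfl rfl, .inl ⟨rfl, hu⟩⟩
    · exact ⟨goodWorld_of_eq hG rfl rfl rfl (List.length_set ..) rfl,
        .inr ⟨hp, .inr (.inl ⟨j, ha, hu⟩)⟩⟩
    · cases a with
      | send => exact ⟨goodWorld_of_eq hG rfl rfl rfl (List.length_set ..) rfl,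
          .inr ⟨hp, .inr (.inr (.inl ⟨_, _, rfl, hu⟩))⟩⟩
      | _ => exact ⟨goodWorld_of_eq hG rfl rfl rfl (List.length_set ..) rfl, .inl ⟨rfl, hu⟩⟩

theorem good_serverZ {s : World contentCollector Z Y} {L : List StorageKey}
    {F : List (List Bool)} {j : ℕ} (hG : GoodWorld s L F []) (hp : s.phase = .alive)
    (hu : s.unread = []) {k : Kind} {l : Stage} (hs : s.serverOf (.Z, j) = some (k, l))
    (l' : Stage) (f : Effect) :
    GoodWorld (s.afterServer (.Z, j) l' f) L F [] ∧ Stable (s.afterServer (.Z, j) l' f) := by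
  cases f with
  | halt => exact ⟨goodWorld_of_eq hG rfl rfl rfl (List.length_modify ..) rfl, .inl ⟨rfl, hu⟩⟩
  | send m => 
    refine ⟨goodWorld_of_eq hG rfl rfl rfl ?_ rfl, .inr ⟨hp, .inr (.inl ⟨_, rfl, hu⟩)⟩⟩
    exact (List.length_modify ..).trans (List.length_modify ..)
  | output m => 
    refine ⟨goodWorld_of_eq hG rfl rfl rfl (List.length_modify ..) rfl,
      .inr ⟨hp, .inr (.inr (.inr (.inr ⟨j, m, rfl, ?_, ?_⟩)))⟩⟩
    · dsimp only [afterServer]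
      rw [hu]
      rfl
    · refine hG.control_Z j ?_
      by_contra hj
      have : s.zs[j]? = none := List.getElem?_eq_none (not_lt.1 hj)
      dsimp only [serverOf] at hs
      rw [this] at hs
      cases hs

/-- The collector knows the server only by its position in `control`; since `sid` occurs there,
looking up that position returns `sid`, and the reply reaches the instance that asked. -/
theorem step_of_X_single {s : World contentCollector Z Y} (ha : s.active = .X) {sid : SID}
    {m : Msg} (hu : s.unread = [(sid, m)]) (hc : sid ∈ s.control) :
    s.step secp = (contentReply secp s.x m).map fun t =>
      { s with
        x := t.1
        unread := []
        active := match t.2 with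
          | none => .main
          | some a => .server sid (.input a) } := by
  rw [step_of_X secp ha, stepX_eq, hu]
  dsimp only [List.head?_cons, Option.map_some]
  rw [PMF.map_comp]
  refine congrArg (PMF.map · _) (funext fun t => ?_)
  dsimp only [Function.comp, afterX]
  rw [hu]
  rcases t.2 with _ | a
  · rfl
  · dsimp only [Option.map_some]
    rw [List.getElem?_idxOf hc]
    rfl

theorem step_of_X_nil {s : World contentCollector Z Y} (ha : s.active = .X) (hu : s.unread = []) :
    s.step secp = PMF.pure { s with active := .main } := by
  rw [step_of_X secp ha, stepX_eq, hu]
  dsimp only [List.head?_nil, Option.map_none]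
  rw [PMF.pure_map]
  dsimp only [afterX]
  rw [hu]
  congr

end World

theorem PMF.expect_uniform_ofFn_eq (n : ℕ) (a : List Bool) :
    ((PMF.uniformOfFintype (Fin n → Bool)).expect fun r => if List.ofFn r = a then 1 else 0) ≤
      ((2 : ℝ≥0∞) ^ n)⁻¹ := by
  rw [PMF.expect_uniform]
  have hcard : ((Fintype.card (Fin n → Bool) : ℕ) : ℝ≥0∞) = 2 ^ n := by simp
  rw [hcard]
  refine (mul_le_mul_left ?_ _).trans_eq (one_mul _)
  by_cases ha : ∃ r : Fin n → Bool, List.ofFn r = a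
  · obtain ⟨r, rfl⟩ := ha
    simp [List.ofFn_inj]
  · push Not at ha
    simp [ha]

namespace World

variable {Z : Environment} {Y : Requester} {secp : ℕ}

theorem one_le_sum_hit {L : List StorageKey} {k : StorageKey} (hk : k ∈ L) {f : StorageKey → ℝ≥0∞}
    (hf : f k = 1) : 1 ≤ (L.map f).sum :=
  hf ▸ List.single_le_sum (fun _ _ => zero_le) _ (List.mem_map_of_mem hk)

theorem goodWorld_of_content {s s' : World contentCollector Z Y} {L : List StorageKey}
    {F F' : List (List Bool)} {t : Msg} (hG : GoodWorld s L F t) (hF : F ⊆ F')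
    (hp : s'.phase = s.phase) (hc : s'.control = s.control) (hz : s'.zs = s.zs)
    (hy : s'.ys = s.ys) (h : ∀ k, Content.get s'.x k ≠ none → k.2 ∈ F')
    (hL : ∀ k ∈ L, Content.get s'.x k ≠ none → Content.get s.x k ≠ none) :
    GoodWorld s' L F' t := by
  obtain ⟨h₁, h₂, h₃, h₄, h₅, h₆⟩ := hG
  unfold GoodWorld
  rw [hc, hz, hy, hp]
  exact ⟨h₁, h₂, h, fun k hk => hF (h₄ k hk), h₅, fun k hk hx => h₆ k hk (hL k hk hx)⟩

/-- The only place where the environment can notice the keys in `L`. Either its request commutes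
with erasing `L`, and the two executions stay coupled, or the request is a hit, already paid for by
the `guess` terms in `bound`. -/
theorem value_X_le {g : World contentCollector Z Y → ℝ≥0∞} {h : ZWorld Z → ℝ≥0∞} {N T : ℕ}
    (hg : ∀ s, g s ≤ 1) (hb : Bounded secp g h N T) {s : World contentCollector Z Y}
    {L : List StorageKey} {F : List (List Bool)} {j : ℕ} {m : Msg} (hG : GoodWorld s L F [])
    (hp : s.phase = .alive) (ha : s.active = .X) (hu : s.unread = [((.Z, j), m)])
    (hc : (Owner.Z, j) ∈ s.control) (hN : F.length + (T + 1) ≤ N) :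
    value secp g (T + 1) s ≤
      (s.forget L).bound secp h L (T + 1) + T * (N * ((2 : ℝ≥0∞) ^ secp)⁻¹) := by
  set c : ℝ≥0∞ := T * (N * ((2 : ℝ≥0∞) ^ secp)⁻¹) with hcdef
  set u := s.forget L with hudef
  set s' : Content × Option Msg → World contentCollector Z Y := fun t =>
    { s with
      x := t.1
      unread := []
      active := match t.2 with
        | none => .main
        | some a => .server (.Z, j) (.input a) } with hs'
  have hstep : s.step secp = (contentReply secp s.x m).map s' := step_of_X_single ha hu hc
  have hlive : u.live = true := by simp [hudef, forget, hp, Phase.isAlive]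
  have hact : u.active = .X j m := by simp [hudef, forget, ha, hu, activeZ]
  have hustep : u.step secp = (contentReply secp u.x m).map (u.afterX j) := by
    simp [ZWorld.step, hlive, hact]
  have hforget (t) : (s' t).forget L = u.afterX j (t.1.erase L, t.2) := by
    rcases t with ⟨x, _ | a⟩ <;> rfl
  have hstable (t) : Stable (s' t) := by
    rcases t with ⟨x, _ | a⟩
    · exact .inl ⟨rfl, rfl⟩
    · exact .inr ⟨hp, .inr (.inr (.inl ⟨_, _, rfl, rfl⟩))⟩
  have hgood (t : Content × Option Msg) (F') (hF : F ⊆ F') (h : ∀ k, t.1.get k ≠ none → k.2 ∈ F')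
      (hL : ∀ k ∈ L, t.1.get k ≠ none → Content.get s.x k ≠ none) : GoodWorld (s' t) L F' [] :=
    goodWorld_of_content hG hF rfl rfl rfl rfl h hL
  have hvalue (t : Content × Option Msg) (F') (hF : F ⊆ F') (hlen : F'.length ≤ F.length + 1)
      (h' : ∀ k, t.1.get k ≠ none → k.2 ∈ F')
      (hL : ∀ k ∈ L, t.1.get k ≠ none → Content.get s.x k ≠ none) :
      value secp g T (s' t) ≤ (u.afterX j (t.1.erase L, t.2)).bound secp h L T + c :=
    hforget t ▸ hb (s' t) L F' (hgood t F' hF h' hL) (hstable t) (by omega)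
  have hpure (t : Content × Option Msg) (h₁ : contentReply secp s.x m = PMF.pure t)
      (h₂ : contentReply secp u.x m = PMF.pure (t.1.erase L, t.2))
      (hsub : ∀ k, t.1.get k ≠ none → Content.get s.x k ≠ none) :
      value secp g (T + 1) s ≤ u.bound secp h L (T + 1) + c := by
    rw [value, hstep, h₁, PMF.expect_map, PMF.expect_pure, ZWorld.bound_succ, hustep, h₂,
      PMF.expect_map, PMF.expect_pure]
    exact (hvalue t F (List.Subset.refl F) (Nat.le_succ _)
      (fun k hk => hG.mem_of_get k (hsub k hk)) (fun k _ => hsub k)).trans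
      (add_le_add_left le_add_self _)
  -- Rewards are at most 1, so nothing remains to be shown once the immediate hits amount to 1.
  have hhit (hf' : (L.map fun k => u.hit secp k.2).sum ≥ 1) :
      value secp g (T + 1) s ≤ u.bound secp h L (T + 1) + c := by
    refine (value_le_one secp hg _ _).trans ?_
    rw [ZWorld.bound_succ]
    exact hf'.le.trans (le_add_right (le_add_right le_rfl))
  rcases hf : fields m with _ | ⟨inst, _ | ⟨key, _ | ⟨arg, _ | _⟩⟩⟩
  case cons.cons.cons.nil =>
    by_cases h₁ : inst = insCode
    · have hs₁ : contentReply secp s.x m = (PMF.uniformOfFintype (Fin secp → Bool)).map fun r =>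
          (Content.apply s.x (.insert (key, List.ofFn r) arg),
            some ((List.ofFn r).map some)) := by
        simp [contentReply, hf, h₁]
      have hu₁ : contentReply secp u.x m = (PMF.uniformOfFintype (Fin secp → Bool)).map fun r =>
          ((Content.erase s.x L).apply (.insert (key, List.ofFn r) arg),
            some ((List.ofFn r).map some)) := by
        simp [contentReply, hf, h₁, hudef, forget]
      have hhits (a : List Bool) : u.hit secp a = ((2 : ℝ≥0∞) ^ secp)⁻¹ := by
        simp [ZWorld.hit, hlive, hact, hf, h₁]
      rw [value, hstep, hs₁, PMF.expect_map, PMF.expect_map, ZWorld.bound_succ, hustep, hu₁,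
        PMF.expect_map, PMF.expect_map]
      -- For a fixed string: either it belongs to some key in `L` and the indicator sum absorbs the
      -- reward, or the insertion commutes with erasing. Averaging over `r` turns the indicators
      -- into the immediate hits.
      have hr (r : Fin secp → Bool) :
          value secp g T (s' (Content.apply s.x (.insert (key, List.ofFn r) arg),
            some ((List.ofFn r).map some))) ≤
          (L.map fun k => if List.ofFn r = k.2 then 1 else 0).sum +
            ((u.afterX j ((Content.erase s.x L).apply (.insert (key, List.ofFn r) arg),
              some ((List.ofFn r).map some))).bound secp h L T + c) := by
        by_cases hrL : ∃ k ∈ L, List.ofFn r = k.2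
        · obtain ⟨k, hk, hkr⟩ := hrL
          refine (value_le_one secp hg _ _).trans (le_add_right ?_)
          exact one_le_sum_hit hk (by simp [hkr])
        · push Not at hrL
          have hnot : (key, List.ofFn r) ∉ L := fun hk => hrL _ hk rfl
          refine le_add_left ?_
          rw [← Content.erase_insert hnot]
          refine hvalue (Content.apply s.x (.insert (key, List.ofFn r) arg), _)
            (List.ofFn r :: F) (List.subset_cons_self _ _) le_rfl (fun k hk => ?_)
            fun k hkL hk => ?_
          · dsimp only at hk
            rw [Content.get_insert] at hk
            split_ifs at hk with hk'
            · rw [hk']; exact List.mem_cons_self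
            · exact List.mem_cons_of_mem _ (hG.mem_of_get k hk)
          · dsimp only at hk
            rwa [Content.get_insert, if_neg (fun hk' : k = (key, List.ofFn r) => hnot (hk' ▸ hkL))] at hk
      refine (PMF.expect_mono fun r _ => hr r).trans ?_
      rw [PMF.expect_add, PMF.expect_add, PMF.expect_const, ← add_assoc]
      gcongr
      rw [PMF.expect_list_sum]
      refine List.sum_le_sum fun k _ => ?_
      rw [hhits]
      exact PMF.expect_uniform_ofFn_eq secp k.2
    by_cases h₂ : inst = lookCode
    -- Only a key in `L` can give different results before and after erasing, and looking one up is
    -- a full hit.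
    · by_cases hL : (key, arg) ∈ L
      · refine hhit (one_le_sum_hit hL ?_)
        simp [ZWorld.hit, hlive, hact, hf, h₁]
      · refine hpure (s.x, some (((Content.get s.x (key, arg)).getD []).map some)) ?_ ?_
          fun _ => id
        · simp [contentReply, hf, h₂, insCode, lookCode]
        · simp [contentReply, hf, h₂, hudef, forget, insCode, lookCode, Content.get_erase, hL]
    by_cases h₃ : inst = delCode
    · refine hpure (Content.apply s.x (.delete (key, arg)), none) ?_ ?_ fun k hk => ?_
      · simp [contentReply, hf, h₃, insCode, lookCode, delCode]
      · simp [contentReply, hf, h₃, hudef, forget, insCode, lookCode, delCode,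
          Content.erase_delete]
      · dsimp only at hk
        rw [Content.get_delete] at hk
        split_ifs at hk
        · exact absurd rfl hk
        · exact hk
    · refine hpure (s.x, none) ?_ ?_ fun _ => id
      all_goals simp [contentReply, hf, h₁, h₂, h₃, hudef, forget]
  all_goals
    refine hpure (s.x, none) ?_ ?_ fun _ => id
    all_goals simp [contentReply, hf, hudef, forget]
end World

theorem List.modify_eq_set_of_getElem? {α : Type*} {l : List α} {j : ℕ} {a : α}
    (h : l[j]? = some a) (f : α → α) : l.modify j f = l.set j (f a) := by
  rw [List.modify_eq_set_getElem?, h]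
  rfl

namespace World

variable {Z : Environment} {Y : Requester} {secp : ℕ}

/-! ## Runs of instances of the deletion-requester -/

/-- The step is taken without decreasing `T`, which can only increase a terminal reward. Whole
deterministic stretches of a protocol run are skipped in this way. -/
theorem value_le_of_pure {g : World contentCollector Z Y → ℝ≥0∞} (hg : Terminal g)
    {s s' : World contentCollector Z Y} (h : s.step secp = PMF.pure s') (T : ℕ) :
    value secp g T s ≤ value secp g T s' := by
  refine (value_le_succ secp hg T s).trans_eq ?_
  rw [value, h, PMF.expect_pure]

/-- The configuration `s` with a different `j`-th instance of the deletion-requester. -/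
def frame (s : World contentCollector Z Y) (a : Active) (unread : List (SID × Msg)) (x : Content)
    (y : Y.Config) (j : ℕ) (e : Session Stage Stage) : World contentCollector Z Y :=
  { s with active := a, unread := unread, x := x, y := y, ys := s.ys.set j e }

theorem inputY_eq_frame {s : World contentCollector Z Y} {j : ℕ} {e : Session Stage Stage}
    (he : s.ys[j]? = some e) (m : Msg) :
    s.inputY j m = s.frame (.clientY j (.input m)) s.unread s.x s.y j
      { e with given := e.given.or (some m) } := by
  unfold inputY frame
  rw [List.modify_eq_set_of_getElem? he]

section frame

variable {s : World contentCollector Z Y} {unread : List (SID × Msg)} {x : Content}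
  {y : Y.Config} {j : ℕ} {e : Session Stage Stage}

theorem frame_getElem? (hj : j < s.ys.length) (a : Active) :
    (s.frame a unread x y j e).ys[j]? = some e := by
  simp [frame, hj]

theorem frame_modify (hj : j < s.ys.length) (f : Session Stage Stage → Session Stage Stage) :
    (s.ys.set j e).modify j f = s.ys.set j (f e) := by
  rw [List.modify_eq_set_of_getElem? (a := e) (by simp [hj]), List.set_set]

theorem frame_client_halt {ev : Event} {l : Stage} (hj : j < s.ys.length)
    (h : storageParty e.kind .client e.client ev = (l, .halt)) :
    (s.frame (.clientY j ev) unread x y j e).step secp =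
      PMF.pure (s.frame .main unread x y j { e with client := l }) := by
  rw [step_of_clientY secp rfl, frame_getElem? hj]
  dsimp only
  rw [h]
  dsimp only [afterClientY, frame]
  rw [frame_modify hj]

theorem frame_client_send {ev : Event} {l : Stage} {m : Msg} (hj : j < s.ys.length)
    (h : storageParty e.kind .client e.client ev = (l, .send m)) :
    (s.frame (.clientY j ev) unread x y j e).step secp =
      PMF.pure (s.frame (.server (.Y, j) (.incoming m)) unread x y j
        { e with client := l, transcript := e.transcript ++ [(.client, m)] }) := by
  rw [step_of_clientY secp rfl, frame_getElem? hj]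
  dsimp only
  rw [h]
  dsimp only [afterClientY, frame]
  rw [frame_modify hj]

theorem frame_client_output {ev : Event} {l : Stage} {m : Msg} (hj : j < s.ys.length)
    (hp : s.phase = .alive) (h : storageParty e.kind .client e.client ev = (l, .output m)) :
    (s.frame (.clientY j ev) unread x y j e).step secp =
      PMF.pure (s.frame .Y unread x (y.write .reports (identOf j ++ m ++ [none])) j
        { e with client := l }) := by
  rw [step_of_clientY secp rfl, frame_getElem? hj]
  dsimp only
  rw [h]
  dsimp only [afterClientY, frame, passY]
  rw [frame_modify hj, hp]

theorem frame_server (hj : j < s.ys.length) (ev : Event) :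
    (s.frame (.server (.Y, j) ev) unread x y j e).step secp =
      PMF.pure ((s.frame (.server (.Y, j) ev) unread x y j e).afterServer (.Y, j)
        (storageParty e.kind .server e.server ev).1
        (storageParty e.kind .server e.server ev).2) := by
  rw [step_of_server secp rfl]
  dsimp only [serverOf]
  rw [frame_getElem? hj]
  rfl

theorem frame_server_halt {ev : Event} {l : Stage} (hj : j < s.ys.length)
    (h : storageParty e.kind .server e.server ev = (l, .halt)) :
    (s.frame (.server (.Y, j) ev) unread x y j e).step secp =
      PMF.pure (s.frame .main unread x y j { e with server := l }) := by
  rw [frame_server hj, h]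
  dsimp only [afterServer, frame]
  rw [frame_modify hj]

theorem frame_server_send {ev : Event} {l : Stage} {m : Msg} (hj : j < s.ys.length)
    (h : storageParty e.kind .server e.server ev = (l, .send m)) :
    (s.frame (.server (.Y, j) ev) unread x y j e).step secp =
      PMF.pure (s.frame (.clientY j (.incoming m)) unread x y j
        { e with server := l, transcript := e.transcript ++ [(.server, m)] }) := by
  rw [frame_server hj, h]
  dsimp only [afterServer, frame]
  rw [frame_modify hj, frame_modify hj]

theorem frame_server_output {ev : Event} {l : Stage} {m : Msg} (hj : j < s.ys.length)
    (h : storageParty e.kind .server e.server ev = (l, .output m)) :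
    (s.frame (.server (.Y, j) ev) unread x y j e).step secp =
      PMF.pure (s.frame .X (unread ++ [((.Y, j), m)]) x y j { e with server := l }) := by
  rw [frame_server hj, h]
  dsimp only [afterServer, frame]
  rw [frame_modify hj]

theorem frame_X {m : Msg} (hc : (Owner.Y, j) ∈ s.control) :
    (s.frame .X [((.Y, j), m)] x y j e).step secp =
      (contentReply secp x m).map fun t =>
        s.frame (match t.2 with
          | none => .main
          | some a => .server (.Y, j) (.input a)) [] t.1 y j e :=
  step_of_X_single rfl rfl hc

end frame

theorem SessionGood.mono {L L' : List StorageKey} (h : L ⊆ L') {e : Session Stage Stage}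
    (he : SessionGood L e) : SessionGood L' e := by
  refine he.imp_right fun ⟨h₁, h₂, h₃, h₄⟩ => ⟨h₁, h₂, fun hk t ht => ?_, fun hk t ht => ?_⟩
  · exact (h₃ hk t ht).imp_right fun ⟨k, hk, hkt⟩ => ⟨k, h hk, hkt⟩
  · exact (h₄ hk t ht).imp_right fun ⟨k, hk, hkt⟩ => ⟨k, h hk, hkt⟩

/-- The replaced instance had no token, so it is not the one that witnesses the pending request. -/
theorem Pending.set {phase : Phase} {ys : List (Session Stage Stage)} {k : StorageKey}
    (h : Pending phase ys k) {j : ℕ} {e e' : Session Stage Stage} (he : ys[j]? = some e)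
    (ht : storageToken e.transcript = none) (hd : e'.kind = .del → e'.given ≠ some (tokenMsg k)) :
    Pending phase (ys.set j e') k := by
  obtain ⟨⟨n, hn, i, hi, f, hf, hfk, hft⟩, hall⟩ := h
  have hij : j ≠ i := by
    rintro rfl
    rw [he, Option.some.injEq] at hf
    subst hf
    rw [ht] at hft
    cases hft
  refine ⟨⟨n, hn, i, hi, f, ?_, hfk, hft⟩, fun f hf => ?_⟩
  · rwa [List.getElem?_set_ne hij]
  · rcases List.mem_or_eq_of_mem_set hf with hf | rfl
    · exact hall f hf
    · exact hd

theorem goodWorld_frame {s : World contentCollector Z Y} {L L' : List StorageKey}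
    {F F' : List (List Bool)} {t : Msg} (hG : GoodWorld s L F t) (hL : L ⊆ L')
    {a : Active} {unread : List (SID × Msg)} {x : Content} {y : Y.Config} {j : ℕ}
    {e : Session Stage Stage}
    (hx : ∀ k, x.get k ≠ none → k.2 ∈ F') (hF : ∀ k ∈ L', k.2 ∈ F') (he : SessionGood L' e)
    (hpend : ∀ k ∈ L', x.get k ≠ none → Pending s.phase (s.ys.set j e) k) :
    GoodWorld (s.frame a unread x y j e) L' F' [] := by
  obtain ⟨h₁, h₂, -, -, h₅, -⟩ := hG
  refine ⟨h₁, fun i hi => h₂ i ?_, hx, hF, fun f hf => ?_, fun k hk hk' _ => hpend k hk hk'⟩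
  · simpa [frame] using hi
  · rcases List.mem_or_eq_of_mem_set hf with hf | rfl
    · exact (h₅ f hf).mono hL
    · exact he

/-- A client that is no longer fresh ignores inputs, and only the first input is recorded, so the
instance remains as it was. -/
theorem run_used {g : World contentCollector Z Y → ℝ≥0∞} {h : ZWorld Z → ℝ≥0∞} {N T : ℕ}
    (hg : Terminal g) (hb : Bounded secp g h N T) {s : World contentCollector Z Y}
    {L : List StorageKey} {F : List (List Bool)} {j : ℕ} {e : Session Stage Stage}
    (hG : GoodWorld s L F []) (hu : s.unread = []) (hN : F.length + T ≤ N)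
    (he : s.ys[j]? = some e) (hc : e.client ≠ .fresh) (m : Msg) :
    value secp g T (s.inputY j m) ≤
      (({ s with active := .main } : World contentCollector Z Y).forget L).bound secp h L T +
        T * (N * ((2 : ℝ≥0∞) ^ secp)⁻¹) := by
  have hj : j < s.ys.length := (List.getElem?_eq_some_iff.1 he).1
  have hgiven : e.given ≠ none := by
    rcases hG.session e (List.mem_of_getElem? he) with h | h
    · exact absurd h.1 hc
    · exact h.2.1
  have hgiven' : e.given.or (some m) = e.given := by
    cases h : e.given with
    | none => exact absurd h hgiven
    | some _ => rfl
  have hparty : storageParty e.kind .client e.client (.input m) = (e.client, .halt) := by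
    rcases e with ⟨k, c, _, _, _⟩
    cases k <;> cases c <;> first | rfl | exact absurd rfl hc
  rw [inputY_eq_frame he]
  simp only [hgiven']
  refine (value_le_of_pure hg (frame_client_halt hj hparty) T).trans ?_
  have : s.frame .main s.unread s.x s.y j e = { s with active := .main } := by
    unfold frame
    have : s.ys.set j e = s.ys := by
      rw [← (List.getElem?_eq_some_iff.1 he).2]
      exact List.set_getElem_self hj
    rw [this]
  refine (congrArg _ this).trans_le (hb _ L F ?_ (.inl ⟨rfl, hu⟩) hN)
  exact goodWorld_of_eq hG rfl rfl rfl rfl rfl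

/-- Deleting a key of `L` is invisible after erasing `L`. The exemption of `t` serves the terminate
phase, where the procedure moves past an instance before its token is deleted; the run restores the
invariant without exemption. With `t = []` nothing is exempted, since no token of an insertion is
empty. -/
theorem run_del {g : World contentCollector Z Y → ℝ≥0∞} {h : ZWorld Z → ℝ≥0∞} {N T : ℕ}
    (hg : Terminal g) (hb : Bounded secp g h N T) {s : World contentCollector Z Y}
    {L : List StorageKey} {F : List (List Bool)} {j : ℕ} {m t : Msg} (ht : t = [] ∨ t = m)
    (hG : GoodWorld s L F t) (hu : s.unread = []) (hN : F.length + T ≤ N)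
    (he : s.ys[j]? = some ⟨.del, .fresh, .fresh, [], none⟩)
    (hm : m = [] ∨ ∃ k ∈ L, m = tokenMsg k) :
    value secp g T (s.inputY j m) ≤
      (({ s with active := .main } : World contentCollector Z Y).forget L).bound secp h L T +
        T * (N * ((2 : ℝ≥0∞) ^ secp)⁻¹) := by
  have hj : j < s.ys.length := (List.getElem?_eq_some_iff.1 he).1
  rw [inputY_eq_frame he]
  rcases hm with rfl | ⟨k, hk, rfl⟩
  -- The empty token of a lookup does not have two fields, so the client of `π_D` stops at once.
  · obtain rfl : t = [] := ht.elim id id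
    refine (value_le_of_pure hg (frame_client_halt (l := .finished) hj rfl) T).trans ?_
    refine hb _ L F ?_ (.inl ⟨rfl, hu⟩) hN
    refine goodWorld_frame hG (List.Subset.refl L) hG.mem_of_get hG.mem_of_mem
      (.inr ⟨by simp, by simp, by simp, by simp⟩) fun k hk hx => ?_
    exact (hG.pending k hk hx (tokenMsg_ne_nil k)).set he rfl fun _ => by
      simpa using (tokenMsg_ne_nil k).symm
  · have hdel : clientDel (tokenMsg k) = (.finished, .send (tuple [delCode, k.1, k.2])) := by
      simp [clientDel, fields_tokenMsg]
    have hreply : contentReply secp s.x (tuple [delCode, k.1, k.2]) =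
        PMF.pure (Content.apply s.x (.delete k), none) := by
      simp [contentReply, fields_tuple, insCode, lookCode, delCode]
    refine (value_le_of_pure hg (frame_client_send
      (ev := .input (tokenMsg k)) (e := ⟨.del, .fresh, .fresh, [], some (tokenMsg k)⟩)
        hj hdel) T).trans ?_
    refine (value_le_of_pure hg (frame_server_output (l := .finished) hj rfl) T).trans ?_
    rw [hu]
    refine (value_le_of_pure hg ((frame_X (hG.control_Y j hj)).trans
      (by rw [hreply, PMF.pure_map])) T).trans ?_
    refine (hb _ L F ?_ (.inl ⟨rfl, rfl⟩) hN).trans_eq ?_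
    · refine goodWorld_frame hG (List.Subset.refl L) (fun k' hk' => hG.mem_of_get k' ?_)
        hG.mem_of_mem (.inr ⟨by simp, by simp, by simp, ?_⟩) fun k' hk' hx => ?_
      · rw [Content.get_delete] at hk'
        split_ifs at hk'
        · exact absurd rfl hk'
        · exact hk'
      · intro _ t ht
        obtain rfl : tokenMsg k = t := by simpa using ht
        exact .inr ⟨k, hk, rfl⟩
      · rw [Content.get_delete] at hx
        split_ifs at hx with hkk
        · exact absurd rfl hx
        · have hne : tokenMsg k' ≠ tokenMsg k := fun h => hkk (tokenMsg_injective h)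
          refine (hG.pending k' hk' hx ?_).set he rfl fun _ => by simpa using hne.symm
          rcases ht with rfl | rfl
          · exact tokenMsg_ne_nil k'
          · exact hne
    · unfold forget frame
      dsimp only [activeZ]
      rw [Content.erase_delete_of_mem hk]

/-- The heart of the comparison. An insertion adds a key to `L` and a `guess` term to `bound`; as
its string is uniform, this term and the risk of a collision with `F` together cost at most `N / 2 ^
secp`, the excess over the error for `T` steps. A lookup or a rejected request leaves the content
unchanged. -/
theorem run_pi {g : World contentCollector Z Y → ℝ≥0∞} {h : ZWorld Z → ℝ≥0∞} {N T : ℕ}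
    (hg : Terminal g) (hg₁ : ∀ s, g s ≤ 1) (hb : Bounded secp g h N T)
    {s : World contentCollector Z Y} {L : List StorageKey} {F : List (List Bool)} {j : ℕ}
    (hG : GoodWorld s L F []) (hp : s.phase = .alive) (hu : s.unread = [])
    (hN : F.length + (T + 1) ≤ N) (he : s.ys[j]? = some ⟨.pi, .fresh, .fresh, [], none⟩)
    (m : Msg) :
    value secp g T (s.inputY j m) ≤
      (({ s with active := .main } : World contentCollector Z Y).forget L).bound secp h L T +
        (T + 1 : ℕ) * (N * ((2 : ℝ≥0∞) ^ secp)⁻¹) := by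
  set c : ℝ≥0∞ := N * ((2 : ℝ≥0∞) ^ secp)⁻¹ with hc
  set u := ({ s with active := .main } : World contentCollector Z Y).forget L with hudef
  have hcT : u.bound secp h L T + T * c ≤ u.bound secp h L T + (T + 1 : ℕ) * c := by
    gcongr
    exact Nat.le_succ T
  have hj : j < s.ys.length := (List.getElem?_eq_some_iff.1 he).1
  have hsub := List.Subset.refl L
  have hpend (e : Session Stage Stage) (hk : e.kind = .pi) (k) (hkL : k ∈ L)
      (hx : Content.get s.x k ≠ none) : Pending s.phase (s.ys.set j e) k :=
    (hG.pending k hkL hx (tokenMsg_ne_nil k)).set he rfl fun hd => by rw [hk] at hd; cases hd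
  rw [inputY_eq_frame he]
  refine (value_le_of_pure hg (frame_client_send (l := .waiting) hj rfl) T).trans ?_
  have hhalt (l : Stage) (hl : serverPi m = (l, .halt)) :
      value secp g T (s.frame (.server (.Y, j) (.incoming m)) s.unread s.x s.y j
        ⟨.pi, .waiting, .fresh, [(.client, m)], some m⟩) ≤
        u.bound secp h L T + (T + 1 : ℕ) * c := by
    refine (value_le_of_pure hg (frame_server_halt
      (ev := .incoming m) (e := ⟨.pi, .waiting, .fresh, [(.client, m)], some m⟩) hj hl) T).trans ?_
    refine le_trans (hb _ L F ?_ ?_ (by omega)) hcT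
    swap
    · exact .inl ⟨rfl, hu⟩
    refine goodWorld_frame hG hsub hG.mem_of_get hG.mem_of_mem
      (.inr ⟨by simp, by simp, ?_, by simp⟩) (hpend _ rfl)
    intro _ t ht
    cases ht
  have hfinish (x : Content) (a : Msg) :
      value secp g T (s.frame (.server (.Y, j) (.input a)) [] x s.y j
        ⟨.pi, .waiting, .waiting, [(.client, m)], some m⟩) ≤
      value secp g T (s.frame .Y [] x (s.y.write .reports (identOf j ++ a ++ [none])) j
        ⟨.pi, .finished, .finished, [(.client, m), (.server, a)], some m⟩) := by
    refine (value_le_of_pure hg (frame_server_send (l := .finished)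
      (e := ⟨.pi, .waiting, .waiting, [(.client, m)], some m⟩) hj rfl) T).trans ?_
    exact value_le_of_pure hg (frame_client_output (l := .finished)
      (e := ⟨.pi, .waiting, .finished, [(.client, m), (.server, a)], some m⟩) hj hp rfl) T
  rcases hf : fields m with
    _ | ⟨inst, _ | ⟨key, _ | ⟨auth, _ | ⟨val, _ | ⟨_, _⟩⟩⟩⟩⟩
  case cons.cons.cons.cons.nil =>
    by_cases h₁ : inst = insCode ∧ val ≠ []
    · have hs : serverPi m = (.waiting, .output (tuple [insCode, key, val])) := by
        simp [serverPi, hf, h₁.1, h₁.2]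
      refine (value_le_of_pure hg (frame_server_output
        (ev := .incoming m) (e := ⟨.pi, .waiting, .fresh, [(.client, m)], some m⟩) hj hs) T).trans ?_
      have hreply : contentReply secp s.x (tuple [insCode, key, val]) =
          (PMF.uniformOfFintype (Fin secp → Bool)).map fun r =>
            (Content.apply s.x (.insert (key, List.ofFn r) val),
              some ((List.ofFn r).map some)) := by
        simp [contentReply, fields_tuple]
      rw [hu]
      -- The next step samples the string, so it cannot be skipped like the deterministic ones;
      -- monotonicity provides the step to unfold.
      refine (value_le_succ secp hg T _).trans ?_
      have hX := (frame_X (secp := secp) (x := s.x) (y := s.y)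
        (e := ⟨.pi, .waiting, .waiting, [(.client, m)], some m⟩)
        (m := tuple [insCode, key, val]) (hG.control_Y j hj))
      refine (congrArg (fun p => PMF.expect p (value secp g T)) hX).trans_le ?_
      rw [hreply, PMF.expect_map, PMF.expect_map]
      have hr (r : Fin secp → Bool) :
          value secp g T (s.frame (.server (.Y, j) (.input ((List.ofFn r).map some))) []
            (Content.apply s.x (.insert (key, List.ofFn r) val)) s.y j
            ⟨.pi, .waiting, .waiting, [(.client, m)], some m⟩) ≤
          (F.map fun a => if List.ofFn r = a then 1 else 0).sum + u.guess secp (List.ofFn r) T +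
            (u.bound secp h L T + T * c) := by
        -- A string outside `F` makes the key unused, so that the insertion takes effect and
        -- vanishes after erasing; a string in `F` is given up as a collision.
        by_cases hrF : List.ofFn r ∈ F
        · refine (value_le_one secp hg₁ _ _).trans (le_add_right (le_add_right ?_))
          have : (1 : ℝ≥0∞) ∈ F.map fun a => if List.ofFn r = a then 1 else 0 :=
            List.mem_map.2 ⟨_, hrF, by simp⟩
          exact List.single_le_sum (fun _ _ => zero_le) _ this
        · have hxr : Content.get s.x (key, List.ofFn r) = none := by
            by_contra hx
            exact hrF (hG.mem_of_get _ hx)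
          refine le_trans (hfinish _ _) (le_trans (hb _ ((key, List.ofFn r) :: L)
            (List.ofFn r :: F) ?_ ?_ (by simp only [List.length_cons]; omega)) ?_)
          rotate_left
          · exact .inr ⟨hp, .inl ⟨rfl, rfl⟩⟩
          rotate_left
          · have hnew : ∀ k, (Content.apply s.x (.insert (key, List.ofFn r) val)).get k ≠ none →
                k ≠ (key, List.ofFn r) → Content.get s.x k ≠ none := by
              intro k hk hne
              rwa [Content.get_insert, if_neg hne] at hk
            have htoken : storageToken [(.client, m), (.server, (List.ofFn r).map some)] =
                some (tokenMsg (key, List.ofFn r)) := by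
              simp [storageToken, hf, h₁.1, tokenMsg, tuple]
            refine goodWorld_frame hG (List.subset_cons_self _ _) (fun k hk => ?_) (fun k hk => ?_)
              (.inr ⟨by simp, by simp, ?_, by simp⟩) fun k hk hx => ?_
            · by_cases hkr : k = (key, List.ofFn r)
              · rw [hkr]; exact List.mem_cons_self
              · exact List.mem_cons_of_mem _ (hG.mem_of_get k (hnew k hk hkr))
            · rcases List.mem_cons.1 hk with rfl | hk
              · exact List.mem_cons_self
              · exact List.mem_cons_of_mem _ (hG.mem_of_mem k hk)
            · intro _ t ht
              rw [htoken, Option.some.injEq] at ht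
              exact .inr ⟨_, List.mem_cons_self, ht.symm⟩
            · by_cases hkr : k = (key, List.ofFn r)
              · refine ⟨⟨0, by rw [hp]; rfl, j, Nat.zero_le _, _, List.getElem?_set_self hj, rfl,
                  hkr ▸ htoken⟩, fun e he' hd hgiven => ?_⟩
                -- No deletion of the new key can have been requested before: earlier requests
                -- concern empty tokens or keys in `L`, whose strings lie in `F`.
                rcases List.mem_or_eq_of_mem_set he' with he' | rfl
                · rcases hG.session e he' with h | h
                  · rw [h.2.2.2] at hgiven
                    cases hgiven
                  · rcases h.2.2.2 hd _ hgiven with h | ⟨k', hk', h⟩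
                    · exact tokenMsg_ne_nil _ h
                    · obtain rfl := tokenMsg_injective h
                      have hmem := hG.mem_of_mem _ hk'
                      rw [hkr] at hmem
                      exact hrF hmem
                · cases hd
              · exact hpend _ rfl k ((List.mem_cons.1 hk).resolve_left hkr) (hnew k hx hkr)
          · have hforget : (s.frame .Y [] (Content.apply s.x (.insert (key, List.ofFn r) val))
                (s.y.write .reports (identOf j ++ (List.ofFn r).map some ++ [none])) j
                ⟨.pi, .finished, .finished,
                  [(.client, m), (.server, (List.ofFn r).map some)], some m⟩).forget
                ((key, List.ofFn r) :: L) = u := by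
              rw [hudef]
              unfold forget frame
              dsimp only [activeZ]
              rw [Content.erase_cons_insert hxr]
            rw [hforget, add_assoc]
            -- Extending `L` by the new key changes `bound` by exactly its `guess` term.
            refine le_add_left (le_of_eq ?_)
            simp only [ZWorld.bound, List.map_cons, List.sum_cons]
            ring
      refine (PMF.expect_mono fun r _ => hr r).trans ?_
      rw [PMF.expect_add, PMF.expect_add, PMF.expect_const, PMF.expect_list_sum,
        PMF.expect_uniform (fun r => u.guess secp (List.ofFn r) T)]
      have h₁ : (F.map fun a => (PMF.uniformOfFintype (Fin secp → Bool)).expect fun r =>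
          if List.ofFn r = a then (1 : ℝ≥0∞) else 0).sum ≤
          F.length * ((2 : ℝ≥0∞) ^ secp)⁻¹ := by
        refine (List.sum_le_sum (g := fun _ => ((2 : ℝ≥0∞) ^ secp)⁻¹)
          fun a _ => PMF.expect_uniform_ofFn_eq secp a).trans_eq ?_
        simp
      -- Here the independence enters: `u` is fixed before `r` is drawn.
      have h₂ : (∑ r : Fin secp → Bool, u.guess secp (List.ofFn r) T) *
          (Fintype.card (Fin secp → Bool) : ℝ≥0∞)⁻¹ ≤ T * ((2 : ℝ≥0∞) ^ secp)⁻¹ := by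
        have hcard : ((Fintype.card (Fin secp → Bool) : ℕ) : ℝ≥0∞) = 2 ^ secp := by simp
        rw [hcard]
        gcongr
        exact ZWorld.sum_guess_le secp T u
      calc _ ≤ F.length * ((2 : ℝ≥0∞) ^ secp)⁻¹ + T * ((2 : ℝ≥0∞) ^ secp)⁻¹ +
            (u.bound secp h L T + T * c) := by gcongr
        _ = ((F.length + T : ℕ) : ℝ≥0∞) * ((2 : ℝ≥0∞) ^ secp)⁻¹ +
            (u.bound secp h L T + T * c) := by push_cast; ring
        _ ≤ c + (u.bound secp h L T + T * c) := by
          rw [hc]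
          gcongr
          omega
        _ = _ := by push_cast; ring
    by_cases h₂ : inst = lookCode ∧ auth ≠ []
    · have hs : serverPi m = (.waiting, .output (tuple [lookCode, key, auth])) := by
        simp [serverPi, hf, h₂.1, h₂.2, insCode, lookCode]
      refine (value_le_of_pure hg (frame_server_output
        (ev := .incoming m) (e := ⟨.pi, .waiting, .fresh, [(.client, m)], some m⟩) hj hs) T).trans ?_
      have hreply : contentReply secp s.x (tuple [lookCode, key, auth]) =
          PMF.pure (s.x, some (((Content.get s.x (key, auth)).getD []).map some)) := by
        simp [contentReply, fields_tuple, insCode, lookCode]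
      rw [hu]
      refine (value_le_of_pure hg ((frame_X (hG.control_Y j hj)).trans
        (by rw [hreply, PMF.pure_map])) T).trans ((hfinish _ _).trans ?_)
      refine le_trans (hb _ L F ?_ ?_ (by omega)) hcT
      · refine goodWorld_frame hG hsub hG.mem_of_get hG.mem_of_mem
          (.inr ⟨by simp, by simp, ?_, by simp⟩) (hpend _ rfl)
        intro _ t ht
        left
        simpa [storageToken, hf, h₂.1, insCode, lookCode] using ht.symm
      · exact .inr ⟨hp, .inl ⟨rfl, rfl⟩⟩
    · refine hhalt .finished ?_
      simp only [serverPi, hf, if_neg h₁, if_neg h₂]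
  all_goals
    refine hhalt .finished ?_
    simp only [serverPi, hf]

end World

/-! ### Steps of the requester, the terminate phase and the main induction -/

namespace World

variable {Z : Environment} {Y : Requester} {secp : ℕ}

theorem token_cases {s : World contentCollector Z Y} {L : List StorageKey}
    {F : List (List Bool)} {t m : Msg} (hG : GoodWorld s L F t) {j : ℕ}
    (h : s.tokenOf j = some m) : m = [] ∨ ∃ k ∈ L, m = tokenMsg k := by
  unfold tokenOf at h
  cases he : s.ys[j]? with
  | none => rw [he] at h; cases h
  | some e =>
    rw [he] at h
    dsimp only at h
    split_ifs at h with hk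
    rcases hG.session e (List.mem_of_getElem? he) with h' | h'
    · rw [h'.2.2.1] at h
      cases h
    · exact h'.2.2.1 hk m h

theorem tokenOf_eq {s : World contentCollector Z Y} {j : ℕ} {e : Session Stage Stage}
    (he : s.ys[j]? = some e) (hk : e.kind = .pi) : s.tokenOf j = storageToken e.transcript := by
  unfold tokenOf
  rw [he]
  exact if_pos hk

theorem exists_of_isRequested {s : World contentCollector Z Y} {m : Msg}
    (h : s.isRequested m = true) : ∃ e ∈ s.ys, e.kind = .del ∧ e.given = some m := by
  unfold isRequested at h
  rw [List.any_eq_true] at h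
  obtain ⟨e, he, h⟩ := h
  exact ⟨e, he, by simpa using h⟩

theorem goodWorld_openY {s : World contentCollector Z Y} {L : List StorageKey}
    {F : List (List Bool)} {t : Msg} (hG : GoodWorld s L F t) (k : Kind) :
    GoodWorld (s.openY secp k) L F t := by
  obtain ⟨h₁, h₂, h₃, h₄, h₅, h₆⟩ := hG
  refine ⟨fun j hj => List.mem_append_left _ (h₁ j hj), fun j hj => ?_, h₃, h₄, fun e he => ?_,
    fun k' hk' hx ht => ?_⟩
  · simp only [openY, List.length_append, List.length_cons, List.length_nil] at hj
    simp only [openY, List.mem_append, List.mem_singleton, Prod.mk.injEq, true_and]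
    rcases Nat.lt_succ_iff_lt_or_eq.1 hj with hj | hj
    · exact .inl (h₂ j hj)
    · exact .inr hj
  · rcases List.mem_append.1 he with he | he
    · exact h₅ e he
    · obtain rfl := List.mem_singleton.1 he
      exact .inl ⟨rfl, rfl, rfl, rfl⟩
  · obtain ⟨⟨n, hn, i, hi, e, he, hek, het⟩, hall⟩ := h₆ k' hk' hx ht
    refine ⟨⟨n, hn, i, hi, e, ?_, hek, het⟩, fun f hf => ?_⟩
    · exact (List.getElem?_append_left (List.getElem?_eq_some_iff.1 he).1).trans he
    · rcases List.mem_append.1 hf with hf | hf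
      · exact hall f hf
      · obtain rfl := List.mem_singleton.1 hf
        intro _ h
        cases h

theorem run_le {g : World contentCollector Z Y → ℝ≥0∞} {h : ZWorld Z → ℝ≥0∞} {N T : ℕ}
    (hg : Terminal g) (hg₁ : ∀ s, g s ≤ 1) (hb : Bounded secp g h N T)
    {s : World contentCollector Z Y} {L : List StorageKey} {F : List (List Bool)} {j : ℕ}
    (hG : GoodWorld s L F []) (hp : s.phase = .alive) (hu : s.unread = [])
    (hN : F.length + (T + 1) ≤ N) {e : Session Stage Stage} (he : s.ys[j]? = some e) {m : Msg}
    (hm : e.kind = .pi ∨ s.isToken m = true) :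
    value secp g T (s.inputY j m) ≤
      (({ s with active := .main } : World contentCollector Z Y).forget L).bound secp h L T +
        (T + 1 : ℕ) * (N * ((2 : ℝ≥0∞) ^ secp)⁻¹) := by
  have hle : ∀ {a b c : ℝ≥0∞}, a ≤ b + T * c → a ≤ b + (T + 1 : ℕ) * c := by
    intro a b c h
    refine h.trans ?_
    gcongr
    exact Nat.le_succ T
  rcases hG.session e (List.mem_of_getElem? he) with h' | h'
  · obtain ⟨k, cl, sv, tr, gv⟩ := e
    obtain ⟨rfl, rfl, rfl, rfl⟩ := h'
    cases k with
    | pi => exact run_pi hg hg₁ hb hG hp hu hN he m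
    | del =>
      have htok : s.isToken m = true := hm.resolve_left (by simp)
      simp only [isToken, List.any_eq_true, List.mem_range, decide_eq_true_eq] at htok
      obtain ⟨i, -, hi⟩ := htok
      exact hle (run_del hg hb (.inl rfl) hG hu (by omega) he (token_cases hG hi))
  · exact hle (run_used hg hb hG hu (by omega) he h'.1 m)

/-- Up to its own tape and instances, a requester's action either changes nothing or starts a
complete run of an instance. The forgotten configuration stays put, and only a run of `π` uses the
additional error term. -/
theorem value_Y_le {g : World contentCollector Z Y → ℝ≥0∞} {h : ZWorld Z → ℝ≥0∞} {N T : ℕ}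
    (hg : Terminal g) (hg₁ : ∀ s, g s ≤ 1) (hb : Bounded secp g h N T)
    {s : World contentCollector Z Y} {L : List StorageKey} {F : List (List Bool)}
    (hG : GoodWorld s L F []) (hp : s.phase = .alive) (ha : s.active = .Y) (hu : s.unread = [])
    (hN : F.length + (T + 1) ≤ N) (coin : Bool) :
    value secp g T (s.stepY secp coin) ≤
      (s.forget L).bound secp h L T + (T + 1 : ℕ) * (N * ((2 : ℝ≥0∞) ^ secp)⁻¹) := by
  have key : ∀ s' : World contentCollector Z Y, GoodWorld s' L F [] → Stable s' →
      s'.forget L = s.forget L → value secp g T s' ≤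
      (s.forget L).bound secp h L T + (T + 1 : ℕ) * (N * ((2 : ℝ≥0∞) ^ secp)⁻¹) := by
    intro s' hG' hS' hf
    refine (hb s' L F hG' hS' (by omega)).trans ?_
    rw [hf]
    gcongr
    exact Nat.le_succ T
  have hY : ∀ s' : World contentCollector Z Y, s'.phase = s.phase → s'.active = s.active →
      s'.unread = s.unread → Stable s' :=
    fun s' h₁ h₂ h₃ => .inr ⟨h₁.trans hp, .inl ⟨h₂.trans ha, h₃.trans hu⟩⟩
  have hforget : ({ s with active := .main } : World contentCollector Z Y).forget L =
      s.forget L := by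
    unfold forget
    rw [ha]
    rfl
  have hmain : ∀ y : Y.Config, value secp g T { s with y := y, active := .main } ≤
      (s.forget L).bound secp h L T + (T + 1 : ℕ) * (N * ((2 : ℝ≥0∞) ^ secp)⁻¹) :=
    fun y => key _ (goodWorld_of_eq hG rfl rfl rfl rfl rfl) (.inl ⟨rfl, hu⟩) hforget
  unfold stepY
  rcases s.y.step coin with _ | ⟨y, _ | ⟨a, m⟩⟩
  · exact hmain s.y
  · exact key _ (goodWorld_of_eq hG rfl rfl rfl rfl rfl) (hY _ rfl rfl rfl) rfl
  · cases a with
    | initiate k =>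
      refine key _ (goodWorld_openY (goodWorld_of_eq hG rfl rfl rfl rfl rfl) k)
        (hY _ rfl rfl rfl) rfl
    | writeInput =>
      dsimp only
      cases he : s.ys[(splitTarget m).1]? with
      | none => exact hmain y
      | some e =>
        dsimp only
        split_ifs with hm
        · refine (run_le (s := { s with y := y }) hg hg₁ hb
            (goodWorld_of_eq hG rfl rfl rfl rfl rfl) hp hu hN he hm).trans_eq ?_
          rw [← hforget]
          rfl
        · exact hmain y
    | _ => exact hmain y

/-- Honest clients act only on inputs and incoming messages; merely woken up, they halt with their
state unchanged. -/
theorem wakeUntilHalt_eq {s : World contentCollector Z Y} {n : ℕ} {e : Session Stage Stage}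
    (he : s.ys[n]? = some e) (ha : s.active = .main) (next : Phase) :
    s.wakeUntilHalt n e next = PMF.pure { s with phase := next } := by
  have hparty : storageParty e.kind .client e.client .wake = (e.client, .halt) := by
    rcases e with ⟨k, c, _, _, _⟩
    cases k <;> cases c <;> rfl
  have hys : s.ys.modify n (fun e' => { e' with client := e.client }) = s.ys := by
    rw [List.modify_eq_set_of_getElem? he, ← (List.getElem?_eq_some_iff.1 he).2]
    exact List.set_getElem_self _
  unfold wakeUntilHalt
  dsimp only [contentCollector]
  rw [PMF.pure_map, hparty]
  dsimp only [afterClientY]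
  rw [hys, ← ha]

theorem step_of_main {s : World contentCollector Z Y} (ha : s.active = .main) :
    s.step secp = match s.phase with
    | .alive => (PMF.uniformOfFintype Bool).map (s.stepZ secp)
    | .runPi n =>
      match s.ys[n]? with
      | none => PMF.pure { s with phase := .request 0 }
      | some e =>
        if e.kind = .pi then s.wakeUntilHalt n e (.runPi (n + 1))
        else PMF.pure { s with phase := .runPi (n + 1) }
    | .request n =>
      if n < s.ys.length then
        match s.tokenOf n with
        | none => PMF.pure { s with phase := .request (n + 1) }
        | some t =>
          if s.isRequested t = true then PMF.pure { s with phase := .request (n + 1) }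
          else PMF.pure
            ((openY secp { s with phase := .request (n + 1) } .del).inputY s.ys.length t)
      else PMF.pure { s with phase := .runDel 0 }
    | .runDel n =>
      match s.ys[n]? with
      | none => PMF.pure { s with phase := .done }
      | some e =>
        if e.kind = .del then s.wakeUntilHalt n e (.runDel (n + 1))
        else PMF.pure { s with phase := .runDel (n + 1) }
    | .done => PMF.pure s := by
  obtain ⟨phase, active, z, y, x, control, unread, zs, ys⟩ := s
  dsimp only at ha
  subst ha
  unfold step
  dsimp only
  cases phase with
  | alive => rfl
  | runPi n => dsimp only; cases ys[n]? <;> rfl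
  | request n =>
    dsimp only
  | runDel n => dsimp only; cases ys[n]? <;> rfl
  | done => rfl

/-- The step of the procedure of the terminate phase. -/
theorem value_terminate_le {g : World contentCollector Z Y → ℝ≥0∞} {h : ZWorld Z → ℝ≥0∞}
    {N T : ℕ} (hg : Terminal g) (hb : Bounded secp g h N T) {s : World contentCollector Z Y}
    {L : List StorageKey} {F : List (List Bool)} (hG : GoodWorld s L F [])
    (hp : s.phase ≠ .alive) (ha : s.active = .main) (hu : s.unread = [])
    (hN : F.length + (T + 1) ≤ N) :
    value secp g (T + 1) s ≤
      (s.forget L).bound secp h L T + T * (N * ((2 : ℝ≥0∞) ^ secp)⁻¹) := by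
  have key : ∀ p : Phase, p ≠ .alive → GoodWorld { s with phase := p } L F [] →
      value secp g T { s with phase := p } ≤
      (s.forget L).bound secp h L T + T * (N * ((2 : ℝ≥0∞) ^ secp)⁻¹) := by
    intro p hp' hG'
    have hf : ({ s with phase := p } : World contentCollector Z Y).forget L = s.forget L := by
      have hlive : ∀ q : Phase, q ≠ .alive → q.isAlive = false := by
        intro q hq
        cases q <;> first | rfl | exact absurd rfl hq
      unfold forget
      dsimp only
      rw [hlive _ hp, hlive _ hp']
    rw [← hf]
    exact hb _ L F hG' (.inl ⟨ha, hu⟩) (by omega)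
  have key' : ∀ p : Phase, p ≠ .alive → p.pendingFrom = s.phase.pendingFrom →
      value secp g T { s with phase := p } ≤
      (s.forget L).bound secp h L T + T * (N * ((2 : ℝ≥0∞) ^ secp)⁻¹) :=
    fun p hp' hpf => key p hp' (goodWorld_of_eq hG hpf rfl rfl rfl rfl)
  have hpure : ∀ {s' : World contentCollector Z Y} {c : ℝ≥0∞}, s.step secp = PMF.pure s' →
      value secp g T s' ≤ c → value secp g (T + 1) s ≤ c := by
    intro s' c hs hc
    rwa [value, hs, PMF.expect_pure]
  have hstep := step_of_main (secp := secp) ha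
  cases hph : s.phase with
  | alive => exact absurd hph hp
  | runPi n =>
    rw [hph] at hstep
    dsimp only at hstep
    cases he : s.ys[n]? with
    | none =>
      rw [he] at hstep
      exact hpure hstep (key' _ (by simp) (by rw [hph]; rfl))
    | some e =>
      rw [he] at hstep
      dsimp only at hstep
      rw [wakeUntilHalt_eq he ha, ite_self] at hstep
      exact hpure hstep (key' _ (by simp) (by rw [hph]; rfl))
  | runDel n =>
    rw [hph] at hstep
    dsimp only at hstep
    cases he : s.ys[n]? with
    | none =>
      rw [he] at hstep
      exact hpure hstep (key' _ (by simp) (by rw [hph]; rfl))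
    | some e =>
      rw [he] at hstep
      dsimp only at hstep
      rw [wakeUntilHalt_eq he ha, ite_self] at hstep
      exact hpure hstep (key' _ (by simp) (by rw [hph]; rfl))
  | done =>
    rw [hph] at hstep
    have hs : s = { s with phase := .done } := by
      cases s
      cases hph
      rfl
    exact hpure (hstep.trans (congrArg PMF.pure hs)) (key' _ (by simp) (by rw [hph]))
  | request n =>
    rw [hph] at hstep
    dsimp only at hstep
    -- Moving from `n` to `n + 1` can invalidate a pending request only if instance `n` is its
    -- witness, that is, only for the token of this instance.
    have hnext : ∀ t : Msg, (∀ k ∈ L, Content.get s.x k ≠ none → tokenMsg k ≠ t →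
        s.tokenOf n ≠ some (tokenMsg k)) →
        GoodWorld { s with phase := .request (n + 1) } L F t := by
      intro t ht
      obtain ⟨h₁, h₂, h₃, h₄, h₅, h₆⟩ := hG
      refine ⟨h₁, h₂, h₃, h₄, h₅, fun k hk hx hkt => ?_⟩
      obtain ⟨⟨n', hn', i, hi, e, he, hek, het⟩, hall⟩ := h₆ k hk hx (tokenMsg_ne_nil k)
      rw [hph] at hn'
      obtain rfl : n = n' := Option.some.inj hn'
      refine ⟨⟨n + 1, rfl, i, lt_of_le_of_ne hi ?_, e, he, hek, het⟩, hall⟩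
      rintro rfl
      exact ht k hk hx hkt ((tokenOf_eq he hek).trans het)
    by_cases hn : n < s.ys.length
    · rw [if_pos hn] at hstep
      cases ht : s.tokenOf n with
      | none =>
        rw [ht] at hstep
        refine hpure hstep (key _ (by simp) (hnext [] fun k _ _ _ => ?_))
        rw [ht]
        simp
      | some t =>
        rw [ht] at hstep
        dsimp only at hstep
        by_cases hr : s.isRequested t = true
        -- A requested token belongs to no key of `L` that is still present, so the procedure may
        -- skip it.
        · rw [if_pos hr] at hstep
          refine hpure hstep (key _ (by simp) (hnext [] fun k hk hx _ => ?_))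
          rw [ht]
          intro hkt
          obtain rfl := Option.some.inj hkt
          obtain ⟨e, he, hek, heg⟩ := exists_of_isRequested hr
          exact (hG.pending k hk hx (tokenMsg_ne_nil k)).2 e he hek heg
        · rw [if_neg hr] at hstep
          refine hpure hstep ?_
          have hG' : GoodWorld { s with phase := .request (n + 1) } L F t :=
            hnext t fun k _ _ hkt h => hkt (Option.some.inj (h.symm.trans ht))
          refine (run_del hg hb (.inr rfl) (goodWorld_openY (secp := secp) hG' .del) hu (by omega)
            ?_ (token_cases hG ht)).trans_eq ?_
          · simp [openY]
          · have : (({ openY secp { s with phase := .request (n + 1) } .del with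
                active := .main } : World contentCollector Z Y).forget L) = s.forget L := by
              unfold forget openY
              dsimp only
              rw [ha, hph]
              rfl
            exact congrArg (fun u => ZWorld.bound secp h L T u +
              T * (N * ((2 : ℝ≥0∞) ^ secp)⁻¹)) this
    · rw [if_neg hn] at hstep
      -- No instance is left to witness a pending request, so the keys of `L` are all gone and the
      -- invariant holds vacuously from now on.
      refine hpure hstep (key _ (by simp) ?_)
      obtain ⟨h₁, h₂, h₃, h₄, h₅, h₆⟩ := hG
      refine ⟨h₁, h₂, h₃, h₄, h₅, fun k hk hx hkt => ?_⟩
      obtain ⟨⟨n', hn', i, hi, e, he, -⟩, -⟩ := h₆ k hk hx hkt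
      rw [hph] at hn'
      obtain rfl : n = n' := Option.some.inj hn'
      exact absurd (hi.trans_lt (List.getElem?_eq_some_iff.1 he).1) hn

/-- Up to the probability that authentication strings collide, the rewards after the execution are
those of the execution without a deletion-requester. -/
theorem bounded {g : World contentCollector Z Y → ℝ≥0∞} {h : ZWorld Z → ℝ≥0∞}
    (hg : Terminal g) (hg₁ : ∀ s, g s ≤ 1) (hh : ∀ u, u.live = true → h u = 0)
    (hgh : ∀ s : World contentCollector Z Y, s.phase = .done → g s ≤ h (s.forget []))
    (N T : ℕ) : Bounded secp g h N T := by
  induction T with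
  | zero =>
    intro s L F hG hS hN
    refine le_add_right (le_add_right ?_)
    change g s ≤ h (s.forget L)
    by_cases hd : s.phase = .done
    · refine (hgh s hd).trans_eq ?_
      -- At the end no request can be pending, so none of the keys in `L` is present.
      have : Content.erase s.x L = s.x := Content.erase_eq_self fun k hk => by
        by_contra hx
        obtain ⟨n, hn, -⟩ := (hG.pending k hk hx (tokenMsg_ne_nil k)).1
        rw [hd] at hn
        cases hn
      unfold forget
      rw [this]
      rfl
    · rw [hg s (.inl hd)]
      exact zero_le
  | succ T ih =>
    intro s L F hG hS hN
    set c : ℝ≥0∞ := N * ((2 : ℝ≥0∞) ^ secp)⁻¹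
    have hc : (T : ℝ≥0∞) * c ≤ (T + 1 : ℕ) * c := by
      gcongr
      exact Nat.le_succ T
    have hsame : ∀ {s' : World contentCollector Z Y}, GoodWorld s' L F [] ∧ Stable s' →
        value secp g T s' ≤ (s'.forget L).bound secp h L T + (T + 1 : ℕ) * c :=
      fun hs' => (ih _ L F hs'.1 hs'.2 (by omega)).trans (by gcongr)
    have hlive (hp : s.phase = .alive) : (s.forget L).live = true := by
      simp [forget, hp, Phase.isAlive]
    rcases hS with ⟨ha, hu⟩ | ⟨hp, hS⟩
    · by_cases hp : s.phase = .alive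
      · refine value_succ_le_of_map (step_of_alive secp ha hp)
          (f' := (s.forget L).stepMain secp) ?_ fun coin => ?_
        · have hact : (s.forget L).active = .main := by simp [forget, ha, activeZ]
          simp [ZWorld.step, hlive hp, hact]
        · rw [← forget_stepZ secp s L coin hp ha hu]
          exact hsame (good_stepZ hG hp ha hu coin)
      · exact (value_terminate_le hg ih hG hp ha hu hN).trans
          (add_le_add (ZWorld.bound_le_succ secp hh L T _) hc)
    rcases hS with ⟨ha, hu⟩ | ⟨j, ha, hu⟩ | ⟨j, ev, ha, hu⟩ | ⟨ha, hu⟩ | ⟨j, m, ha, hu, hctl⟩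
    · refine (value_succ_le_of_forall (c := (s.forget L).bound secp h L T + (T + 1 : ℕ) * c)
        fun s' hs' => ?_).trans
        (by gcongr; exact ZWorld.bound_le_succ secp hh L T _)
      rw [step_of_Y secp ha] at hs'
      obtain ⟨coin, -, rfl⟩ := (PMF.mem_support_map_iff _ _ _).1 hs'
      exact value_Y_le hg hg₁ ih hG hp ha hu hN coin
    · refine value_succ_le_of_map (step_of_clientZ secp ha)
        (f' := (s.forget L).stepClient j) ?_ fun coin => ?_
      · have hact : (s.forget L).active = .client j := by simp [forget, ha, activeZ]
        simp [ZWorld.step, hlive hp, hact]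
      · rw [← forget_stepClientZ s L j coin ha]
        exact hsame (good_stepClientZ hG hp ha hu coin)
    · refine value_succ_le_of_map (p := PMF.pure ())
        (f := fun _ => match s.serverOf (.Z, j) with
          | none => { s with active := .main }
          | some (k, l) => s.afterServer (.Z, j) (storageParty k .server l ev).1
              (storageParty k .server l ev).2)
        (f' := fun _ => (s.forget L).stepServer j ev)
        (by rw [step_of_server secp ha, PMF.pure_map]) ?_ fun _ => ?_
      · have hact : (s.forget L).active = .server j ev := by simp [forget, ha, activeZ]
        simp [ZWorld.step, hlive hp, hact, PMF.pure_map]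
      · rw [← forget_server s L j ev hu]
        refine hsame ?_
        cases hs : s.serverOf (.Z, j) with
        | none => exact ⟨goodWorld_of_eq hG rfl rfl rfl rfl rfl, .inl ⟨rfl, hu⟩⟩
        | some r => exact good_serverZ hG hp hu hs _ _
    · rw [value, step_of_X_nil ha hu, PMF.expect_pure]
      have hf : ({ s with active := .main } : World contentCollector Z Y).forget L =
          s.forget L := by
        unfold forget
        rw [ha, hu]
        rfl
      refine le_trans (ih _ L F (goodWorld_of_eq hG rfl rfl rfl rfl rfl) ?_ (by omega)) ?_
      · exact .inl ⟨rfl, hu⟩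
      rw [hf]
      exact add_le_add (ZWorld.bound_le_succ secp hh L T _) hc
    · exact (value_X_le hg₁ ih hG hp ha hu hctl hN).trans (by gcongr)

end World

/-! ## Running times -/

namespace ITM

variable {κ : Type} {M : ITM κ}

theorem Config.time_write (c : M.Config) (t : RTape) (m : Msg) : (c.write t m).time = c.time := rfl

theorem Config.inputLength_write (c : M.Config) (m : Msg) :
    (c.write .input m).inputLength = c.inputLength + m.length := by
  simp [Config.inputLength, Config.write]

theorem Config.inputLength_write_of_ne (c : M.Config) {t : RTape} (ht : t ≠ .input) (m : Msg) :
    (c.write t m).inputLength = c.inputLength := by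
  simp [Config.inputLength, Config.write, Function.update_of_ne ht.symm]

theorem Config.step_eq_some {c c' : M.Config} {coin : Bool} {a : Option (Act κ × Msg)}
    (h : c.step coin = some (c', a)) :
    c'.time = c.time + 1 ∧ c'.inputLength = c.inputLength ∧
      c'.pending.length ≤ c.pending.length + 1 ∧
      ∀ b m, a = some (b, m) → c'.pending = [] ∧ m.length ≤ c.pending.length + 1 := by
  unfold Config.step at h
  rw [Option.map_eq_some_iff] at h
  obtain ⟨i, -, hi⟩ := h
  obtain ⟨rfl, rfl⟩ := Prod.mk.inj hi
  have hlen : (c.pending ++ i.emit.toList).length ≤ c.pending.length + 1 := by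
    cases i.emit <;> simp
  refine ⟨by simp [Config.time], rfl, ?_, ?_⟩
  · dsimp only
    split_ifs
    · simp
    · exact hlen
  · intro b m hb
    rw [Option.map_eq_some_iff] at hb
    obtain ⟨a, ha, hb⟩ := hb
    obtain ⟨rfl, rfl⟩ := Prod.mk.inj hb
    exact ⟨by simp [ha], hlen⟩

theorem Config.inputLength_init (secp : ℕ) : (M.init secp).inputLength = secp := by
  simp [Config.inputLength, init]

/-- A single power, monotone in the input length, is easier to compose; the base is at least 2, so
that a larger exponent absorbs the additive constant. -/
theorem PPT.exists_pow (hM : M.PPT) :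
    ∃ k, ∀ secp d, M.Reachable secp d → d.time ≤ (d.inputLength + 2) ^ k := by
  obtain ⟨c, hc⟩ := hM
  refine ⟨c + 1, fun secp d hd => (hc secp d hd).trans ?_⟩
  have h₁ : d.inputLength ^ c ≤ (d.inputLength + 2) ^ c := Nat.pow_le_pow_left (by omega) c
  have h₂ : c ≤ (d.inputLength + 2) ^ c :=
    (Nat.lt_two_pow_self).le.trans (Nat.pow_le_pow_left (by omega) c)
  rw [pow_succ]
  nlinarith [Nat.zero_le (d.inputLength * (d.inputLength + 2) ^ c)]

end ITM

theorem length_splitTarget_le (m : Msg) : (splitTarget m).2.length ≤ m.length := by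
  unfold splitTarget
  have := (List.dropWhile_sublist (p := Option.isSome) (l := m)).length_le
  simp only [List.length_tail]
  omega

theorem List.map_modify_of_eq {α β : Type*} (f : α → β) (g : α → α) (h : ∀ a, f (g a) = f a)
    (l : List α) (j : ℕ) : (l.modify j g).map f = l.map f := by
  apply List.ext_getElem?
  intro i
  rw [List.getElem?_map, List.getElem?_map, List.getElem?_modify]
  cases l[i]? with
  | none => rfl
  | some a =>
    dsimp only [Functor.map, Option.map]
    split_ifs <;> simp [h]

theorem List.forall_mem_modify {α : Type*} {P : α → Prop} {g : α → α} (hg : ∀ a, P a → P (g a))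
    {l : List α} (h : ∀ a ∈ l, P a) (j : ℕ) : ∀ a ∈ l.modify j g, P a := by
  intro a ha
  obtain ⟨i, hi⟩ := List.mem_iff_getElem?.1 ha
  rw [List.getElem?_modify] at hi
  cases hl : l[i]? with
  | none => rw [hl] at hi; cases hi
  | some b =>
    rw [hl] at hi
    have hb := h b (List.mem_of_getElem? hl)
    dsimp only [Functor.map, Option.map] at hi
    split_ifs at hi
    · exact Option.some.inj hi ▸ hg b hb
    · exact Option.some.inj hi ▸ hb

theorem List.sum_map_set {α : Type*} (f : α → ℕ) {l : List α} {j : ℕ} {a b : α}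
    (h : l[j]? = some a) : ((l.set j b).map f).sum + f a = (l.map f).sum + f b := by
  induction l generalizing j with
  | nil => cases h
  | cons c l ih =>
    cases j with
    | zero =>
      cases h
      simp only [List.set_cons_zero, List.map_cons, List.sum_cons]
      omega
    | succ j =>
      have := ih (j := j) h
      simp only [List.set_cons_succ, List.map_cons, List.sum_cons]
      omega

/-! ## Termination of the execution -/

/-- For an instance of `π`, the request stage may need one step to treat it, one to pass the
instance of `π_D` opened for it, and one more later to run that instance; an instance of `π_D` is
just passed. -/
def Kind.weight : Kind → ℕ
  | .pi => 3
  | .del => 1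

/-- A bound on the number of procedural steps of the rest of the execution; the deletion-requester
makes at most `b` steps and has made `t` steps so far. -/
def Phase.cost (b t : ℕ) (kinds : List Kind) : Phase → ℕ
  -- Each instance costs at most 5: a visit in each of the two running stages and a weight of at
  -- most 3. Each step that the requester has left may create another instance, whence the second 5.
  | .alive => 5 * kinds.length + 5 * (b - t) + 4
  | .runPi n =>
    (kinds.length - n) + 1 + (kinds.length + 2 + (kinds.map Kind.weight).sum)
  | .request n => kinds.length + 2 + ((kinds.drop n).map Kind.weight).sum
  | .runDel n => (kinds.length - n) + 1
  | .done => 0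

/-- A bound on the number of activations before a machine makes a step or the procedure goes on. -/
def Active.rank : Active → ℕ
  -- The values decrease along a run of an honest instance: client with input 6, server 5, collector
  -- 4, server with the reply 3, client 2, requester 1. A client of the environment makes counted
  -- machine steps, so it may start again at 5.
  | .main => 0
  | .X => 4
  | .Y => 1
  | .clientZ _ => 1
  | .clientY _ (.input _) => 6
  | .clientY _ _ => 2
  | .server _ (.incoming _) => 5
  | .server _ _ => 3

theorem Active.rank_le (a : Active) : a.rank ≤ 6 := by
  rcases a with _ | _ | _ | _ | ⟨_, _ | _ | _⟩ | ⟨_, _ | _ | _⟩ <;>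
    simp [Active.rank]

theorem List.sum_map_weight_le (l : List Kind) : (l.map Kind.weight).sum ≤ 3 * l.length := by
  induction l with
  | nil => exact le_rfl
  | cons k l ih =>
    have : k.weight ≤ 3 := by cases k <;> decide
    simp only [List.map_cons, List.sum_cons, List.length_cons]
    omega

theorem Phase.cost_runPi_lt (b t : ℕ) (kinds : List Kind) :
    (Phase.runPi 0).cost b t kinds < Phase.alive.cost b t kinds := by
  have := List.sum_map_weight_le kinds
  simp only [Phase.cost]
  omega

namespace World

variable {Z : Environment} {Y : Requester} (secp : ℕ)

/-- The number of steps that the machines have made. -/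
def coins (s : World contentCollector Z Y) : ℕ :=
  s.z.time + s.y.time + (s.zs.map fun e => e.client.2.time).sum

def cost (b : ℕ) (s : World contentCollector Z Y) : ℕ :=
  s.phase.cost b s.y.time (s.ys.map Session.kind)

/-- The text that the environment has written but not yet sent is counted with the input. A step
emits at most one symbol, and delivering an input adds one separation mark, hence the factor 2. -/
def ClientsGood (z : Z.machine.Config)
    (zs : List (Session (Σ c : Z.Code, (Z.client c).Config) Stage)) : Prop :=
  ∀ e ∈ zs, (Z.client e.client.1).Reachable secp e.client.2 ∧
    e.client.2.inputLength + z.pending.length ≤ secp + 2 * z.time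

/-- All machines are in reachable configurations, and the environment has had the time to write
the inputs of its clients. -/
structure Running (s : World contentCollector Z Y) : Prop where
  z_reachable : Z.machine.Reachable secp s.z
  z_input : s.z.inputLength = secp
  zs_length : s.zs.length ≤ s.z.time
  clients : ClientsGood secp s.z s.zs
  y_reachable : Y.Reachable secp s.y
  y_input : s.y.inputLength = secp
  alive : s.active = .Y → s.phase = .alive
  main : s.phase = .done → s.active = .main

/-- A step of a machine, an activation or a step of the procedure. -/
def Progress (b : ℕ) (s s' : World contentCollector Z Y) : Prop :=
  (s'.coins = s.coins + 1 ∧ s'.cost b ≤ s.cost b) ∨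
    (s'.coins = s.coins ∧ s'.active.rank < s.active.rank ∧ s'.cost b = s.cost b) ∨
    (s'.coins = s.coins ∧ s'.cost b < s.cost b)

variable {secp}

theorem ClientsGood.mono {z z' : Z.machine.Config}
    {zs : List (Session (Σ c : Z.Code, (Z.client c).Config) Stage)}
    (h : ClientsGood secp z zs) (ht : z'.time = z.time + 1)
    (hp : z'.pending.length ≤ z.pending.length + 1) : ClientsGood secp z' zs := by
  intro e he
  have := h e he
  exact ⟨this.1, by omega⟩

theorem Running.stepZ {b : ℕ} {s : World contentCollector Z Y} (h : Running secp s)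
    (hp : s.phase = .alive) (ha : s.active = .main) (coin : Bool) :
    Running secp (s.stepZ secp coin) ∧ Progress b s (s.stepZ secp coin) := by
  obtain ⟨phase, active, z, y, x, control, unread, zs, ys⟩ := s
  dsimp only at hp ha
  subst hp ha
  obtain ⟨h₁, h₂, h₃, h₄, h₅, h₆, -, -⟩ := h
  dsimp only at h₁ h₂ h₃ h₄ h₅ h₆
  unfold World.stepZ
  dsimp only
  rcases hz : z.step coin with _ | ⟨z', a⟩
  · exact ⟨⟨h₁, h₂, h₃, h₄, h₅, h₆, by rintro ⟨⟩, by rintro ⟨⟩⟩,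
      .inr (.inr ⟨rfl, Phase.cost_runPi_lt _ _ _⟩)⟩
  obtain ⟨ht, hi, hpend, hact⟩ := ITM.Config.step_eq_some hz
  have h₁' := ITM.Reachable.step _ _ _ _ h₁ hz
  have h₂' : z'.inputLength = secp := hi.trans h₂
  have h₃' : zs.length ≤ z'.time := by omega
  have h₄' : ClientsGood secp z' zs := h₄.mono ht hpend
  have hcoins : z'.time + y.time + (zs.map fun e => e.client.2.time).sum =
      z.time + y.time + (zs.map fun e => e.client.2.time).sum + 1 := by omega
  rcases a with _ | ⟨a, m⟩
  · exact ⟨⟨h₁', h₂', h₃', h₄', h₅, h₆, by rintro ⟨⟩, by rintro ⟨⟩⟩, .inl ⟨hcoins, le_rfl⟩⟩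
  have hsame : Running secp (⟨.alive, .main, z', y, x, control, unread, zs, ys⟩ :
      World contentCollector Z Y) :=
    ⟨h₁', h₂', h₃', h₄', h₅, h₆, by rintro ⟨⟩, by rintro ⟨⟩⟩
  obtain ⟨hp', hm⟩ := hact a m rfl
  cases a with
  | tellY =>
    refine ⟨⟨h₁', h₂', h₃', h₄', h₅.write _ _ _, ?_, fun _ => rfl, by rintro ⟨⟩⟩,
      .inl ⟨hcoins, le_rfl⟩⟩
    exact (ITM.Config.inputLength_write_of_ne y (by decide) _).trans h₆
  | writeInput =>
    dsimp only
    split_ifs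
    · refine ⟨⟨h₁', h₂', by simpa using h₃', ?_, h₅, h₆, by rintro ⟨⟩, by rintro ⟨⟩⟩,
        .inl ⟨?_, le_rfl⟩⟩
      · intro e he
        obtain ⟨i, hi⟩ := List.mem_iff_getElem?.1 he
        dsimp only at hi ⊢
        rw [List.getElem?_modify] at hi
        cases hl : zs[i]? with
        | none => rw [hl] at hi; cases hi
        | some d =>
          rw [hl] at hi
          have hd := List.mem_of_getElem? hl
          dsimp only [Functor.map, Option.map] at hi
          split_ifs at hi
          · obtain rfl := Option.some.inj hi
            refine ⟨(h₄ d hd).1.write _ _ _, ?_⟩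
            dsimp only
            -- The pending text turns into input; the two units gained by this step pay for its last
            -- symbol and for the mark.
            have := (h₄ d hd).2
            have := length_splitTarget_le m
            rw [ITM.Config.inputLength_write, hp', ht]
            simp only [List.length_cons, List.length_nil]
            omega
          · obtain rfl := Option.some.inj hi
            exact h₄' d hd
      · unfold coins
        dsimp only
        rw [List.map_modify_of_eq _ _ (by intro _; rfl)]
        exact hcoins
    · exact ⟨hsame, .inl ⟨hcoins, le_rfl⟩⟩
  | initiate k c =>
    refine ⟨⟨h₁'.write _ _ _, ?_, ?_, ?_, h₅, h₆, by rintro ⟨⟩, by rintro ⟨⟩⟩,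
      .inl ⟨?_, le_rfl⟩⟩
    · exact (ITM.Config.inputLength_write_of_ne z' (by decide) _).trans h₂'
    · dsimp only [openZ]
      rw [List.length_append, List.length_singleton, ITM.Config.time_write]
      omega
    · intro e he
      rcases List.mem_append.1 he with he | he
      · exact h₄' e he
      · obtain rfl := List.mem_singleton.1 he
        refine ⟨(ITM.Reachable.init).write _ _ _, ?_⟩
        dsimp only [openZ]
        rw [ITM.Config.inputLength_write_of_ne _ (by decide), ITM.Config.inputLength_init]
        change secp + z'.pending.length ≤ secp + 2 * z'.time
        rw [hp']
        simp
    · unfold coins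
      dsimp only [openZ]
      rw [List.map_append, List.sum_append, ITM.Config.time_write]
      exact hcoins
  | wakeX => exact ⟨⟨h₁', h₂', h₃', h₄', h₅, h₆, by rintro ⟨⟩, by rintro ⟨⟩⟩, .inl ⟨hcoins, le_rfl⟩⟩
  | wakeY => exact ⟨⟨h₁', h₂', h₃', h₄', h₅, h₆, fun _ => rfl, by rintro ⟨⟩⟩, .inl ⟨hcoins, le_rfl⟩⟩
  | endAlive =>
    exact ⟨⟨h₁', h₂', h₃', h₄', h₅, h₆, by rintro ⟨⟩, by rintro ⟨⟩⟩,
      .inl ⟨hcoins, (Phase.cost_runPi_lt _ _ _).le⟩⟩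
  | send => exact ⟨hsame, .inl ⟨hcoins, le_rfl⟩⟩
  | output => exact ⟨hsame, .inl ⟨hcoins, le_rfl⟩⟩
  | yield => exact ⟨hsame, .inl ⟨hcoins, le_rfl⟩⟩

theorem Running.stepY {b : ℕ} {s : World contentCollector Z Y} (h : Running secp s)
    (hb : ∀ d, Y.Reachable secp d → d.inputLength = secp → d.time ≤ b)
    (ha : s.active = .Y) (coin : Bool) :
    Running secp (s.stepY secp coin) ∧ Progress b s (s.stepY secp coin) := by
  have hp := h.alive ha
  obtain ⟨phase, active, z, y, x, control, unread, zs, ys⟩ := s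
  dsimp only at hp ha
  subst hp ha
  obtain ⟨h₁, h₂, h₃, h₄, h₅, h₆, -, -⟩ := h
  dsimp only at h₁ h₂ h₃ h₄ h₅ h₆
  unfold World.stepY
  dsimp only
  rcases hy : y.step coin with _ | ⟨y', a⟩
  · exact ⟨⟨h₁, h₂, h₃, h₄, h₅, h₆, by rintro ⟨⟩, by rintro ⟨⟩⟩,
      .inr (.inl ⟨rfl, Nat.zero_lt_one, rfl⟩)⟩
  obtain ⟨ht, hi, -, -⟩ := ITM.Config.step_eq_some hy
  have h₅' := ITM.Reachable.step _ _ _ _ h₅ hy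
  have h₆' : y'.inputLength = secp := hi.trans h₆
  have hcoins : z.time + y'.time + (zs.map fun e => e.client.2.time).sum =
      z.time + y.time + (zs.map fun e => e.client.2.time).sum + 1 := by omega
  -- Ensures that the truncated difference `b - t` really drops with this step, which pays for the
  -- instance it may create.
  have hle := hb y' h₅' h₆'
  have hcost : Phase.alive.cost b y'.time (ys.map Session.kind) ≤
      Phase.alive.cost b y.time (ys.map Session.kind) := by
    simp only [Phase.cost]
    omega
  have hmain : Running secp (⟨.alive, .main, z, y', x, control, unread, zs, ys⟩ :
      World contentCollector Z Y) ∧ Progress b (⟨.alive, .Y, z, y, x, control, unread, zs, ys⟩ :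
      World contentCollector Z Y) ⟨.alive, .main, z, y', x, control, unread, zs, ys⟩ :=
    ⟨⟨h₁, h₂, h₃, h₄, h₅', h₆', by rintro ⟨⟩, by rintro ⟨⟩⟩, .inl ⟨hcoins, hcost⟩⟩
  rcases a with _ | ⟨a, m⟩
  · exact ⟨⟨h₁, h₂, h₃, h₄, h₅', h₆', fun _ => rfl, by rintro ⟨⟩⟩, .inl ⟨hcoins, hcost⟩⟩
  cases a with
  | initiate k c =>
    refine ⟨⟨h₁, h₂, h₃, h₄, h₅'.write _ _ _, ?_, fun _ => rfl, by rintro ⟨⟩⟩,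
      .inl ⟨hcoins, ?_⟩⟩
    · exact (ITM.Config.inputLength_write_of_ne y' (by decide) _).trans h₆'
    · unfold cost
      dsimp only [openY]
      rw [ITM.Config.time_write]
      simp only [Phase.cost, List.length_map, List.length_append, List.length_singleton]
      omega
  | writeInput =>
    dsimp only
    cases ys[(splitTarget m).1]? with
    | none => exact hmain
    | some e =>
      dsimp only
      split_ifs
      · refine ⟨⟨h₁, h₂, h₃, h₄, h₅', h₆', by rintro ⟨⟩, by rintro ⟨⟩⟩, .inl ⟨hcoins, ?_⟩⟩
        unfold cost
        dsimp only [inputY]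
        rw [List.map_modify_of_eq _ _ (by intro _; rfl)]
        exact hcost
      · exact hmain
  | _ => exact hmain

theorem Running.stepClientZ {b : ℕ} {s : World contentCollector Z Y} (h : Running secp s) {j : ℕ}
    (ha : s.active = .clientZ j) (coin : Bool) :
    Running secp (s.stepClientZ j coin) ∧ Progress b s (s.stepClientZ j coin) := by
  have hp : s.phase ≠ .done := fun hp => by rw [h.main hp] at ha; cases ha
  obtain ⟨phase, active, z, y, x, control, unread, zs, ys⟩ := s
  dsimp only at hp ha
  subst ha
  obtain ⟨h₁, h₂, h₃, h₄, h₅, h₆, -, -⟩ := h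
  dsimp only at h₁ h₂ h₃ h₄ h₅ h₆
  unfold World.stepClientZ
  dsimp only
  have hmain : Running secp (⟨phase, .main, z, y, x, control, unread, zs, ys⟩ :
      World contentCollector Z Y) ∧ Progress b
      (⟨phase, .clientZ j, z, y, x, control, unread, zs, ys⟩ : World contentCollector Z Y)
      ⟨phase, .main, z, y, x, control, unread, zs, ys⟩ :=
    ⟨⟨h₁, h₂, h₃, h₄, h₅, h₆, by rintro ⟨⟩, fun _ => rfl⟩,
      .inr (.inl ⟨rfl, Nat.zero_lt_one, rfl⟩)⟩
  cases he : zs[j]? with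
  | none => exact hmain
  | some e =>
    dsimp only
    rcases hc : e.client.2.step coin with _ | ⟨c, a⟩
    · exact hmain
    obtain ⟨ht, hi, -, -⟩ := ITM.Config.step_eq_some hc
    have he' := h₄ e (List.mem_of_getElem? he)
    have key (z' : Z.machine.Config) (tr : List (Side × Msg)) (act : Active)
        (hz₁ : Z.machine.Reachable secp z') (hz₂ : z'.inputLength = z.inputLength)
        (hz₃ : z'.time = z.time) (hz₄ : z'.pending = z.pending) (hact : act ≠ .Y)  :
        Running secp (⟨phase, act, z', y, x, control, unread,
          zs.set j ⟨e.kind, ⟨e.client.1, c⟩, e.server, tr, e.given⟩, ys⟩ :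
            World contentCollector Z Y) ∧ Progress b
          (⟨phase, .clientZ j, z, y, x, control, unread, zs, ys⟩ : World contentCollector Z Y)
          ⟨phase, act, z', y, x, control, unread,
          zs.set j ⟨e.kind, ⟨e.client.1, c⟩, e.server, tr, e.given⟩, ys⟩ := by
      refine ⟨⟨hz₁, hz₂.trans h₂, ?_, ?_, h₅, h₆, fun h => absurd h hact, fun h => absurd h hp⟩,
        .inl ⟨?_, le_rfl⟩⟩
      · dsimp only
        rw [List.length_set, hz₃]
        exact h₃
      · intro d hd
        dsimp only
        rw [hz₃, hz₄]
        rcases List.mem_or_eq_of_mem_set hd with hd | rfl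
        · exact h₄ d hd
        · refine ⟨he'.1.step _ _ _ _ hc, ?_⟩
          dsimp only
          rw [hi]
          exact he'.2
      · have := List.sum_map_set (fun e : Session (Σ c : Z.Code, (Z.client c).Config) Stage =>
          e.client.2.time) (b := ⟨e.kind, ⟨e.client.1, c⟩, e.server, tr, e.given⟩) he
        unfold coins
        dsimp only at this ⊢
        omega
    rcases a with _ | ⟨a, m⟩
    · exact key z _ (.clientZ j) h₁ rfl rfl rfl (by rintro ⟨⟩)
    · cases a with
      | send => exact key z _ (.server (.Z, j) (.incoming m)) h₁ rfl rfl rfl (by rintro ⟨⟩)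
      | output =>
        exact key _ _ .main (h₁.write _ _ _)
          (ITM.Config.inputLength_write_of_ne z (by decide) _) rfl rfl (by rintro ⟨⟩)
      | _ => exact key z _ .main h₁ rfl rfl rfl (by rintro ⟨⟩)

/-- A server that has received the collector's reply never calls the collector again; this excludes
cycles and makes `Active.rank` decrease. -/
theorem storageParty_output {k : Kind} {l : Stage} {ev : Event} {m : Msg}
    (h : (storageParty k .server l ev).2 = .output m) : ∃ m', ev = .incoming m' := by
  cases k <;> cases l <;> rcases ev with _ | m' | m' <;> first | exact ⟨_, rfl⟩ | cases h

theorem storageParty_client_send {k : Kind} {l : Stage} {ev : Event} {m : Msg}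
    (h : (storageParty k .client l ev).2 = .send m) : ∃ m', ev = .input m' := by
  cases k <;> cases l <;> rcases ev with _ | m' | m' <;> first | exact ⟨_, rfl⟩ | cases h

theorem Active.rank_server_pos (sid : SID) (ev : Event) : 3 ≤ (Active.server sid ev).rank := by
  rcases ev with _ | m | m <;> simp [Active.rank]

theorem Active.rank_clientY_pos (j : ℕ) (ev : Event) : 2 ≤ (Active.clientY j ev).rank := by
  rcases ev with _ | m | m <;> simp [Active.rank]

/-- Changes that do not concern the programs of the environment and the deletion-requester. -/
theorem Running.activate {b : ℕ} {s s' : World contentCollector Z Y} (h : Running secp s)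
    (hd : s.active ≠ .main) (hphase : s'.phase = s.phase) (hz : s'.z = s.z)
    (hzs : s'.zs.length = s.zs.length) (hc : ClientsGood secp s.z s'.zs)
    (hcoins : (s'.zs.map fun e => e.client.2.time) = s.zs.map fun e => e.client.2.time)
    (hy : Y.Reachable secp s'.y) (hyi : s'.y.inputLength = secp) (hyt : s'.y.time = s.y.time)
    (hys : s'.ys.map Session.kind = s.ys.map Session.kind)
    (ha : s'.active = .Y → s.phase = .alive) (hr : s'.active.rank < s.active.rank) :
    Running secp s' ∧ Progress b s s' := by
  refine ⟨⟨hz ▸ h.z_reachable, hz ▸ h.z_input, ?_, hz ▸ hc, hy, hyi, fun h' => hphase ▸ ha h',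
    fun h' => absurd (h.main (hphase ▸ h')) hd⟩, .inr (.inl ⟨?_, hr, ?_⟩)⟩
  · rw [hzs, hz]
    exact h.zs_length
  · rw [coins, coins, hz, hyt, hcoins]
  · rw [cost, cost, hphase, hyt, hys]

theorem Running.main_of_active {b : ℕ} {s : World contentCollector Z Y} (h : Running secp s)
    (hr : 0 < s.active.rank) :
    Running secp ({ s with active := .main } : World contentCollector Z Y) ∧
      Progress b s { s with active := .main } :=
  h.activate (s' := { s with active := .main }) (fun ha => by rw [ha] at hr; cases hr) rfl rfl rfl
    h.clients rfl h.y_reachable h.y_input rfl rfl (by rintro ⟨⟩) hr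

theorem Running.afterServer {b : ℕ} {s : World contentCollector Z Y} (h : Running secp s)
    {sid : SID} {ev : Event} (ha : s.active = .server sid ev) (k : Kind) (l : Stage) :
    Running secp (s.afterServer sid (storageParty k .server l ev).1
      (storageParty k .server l ev).2) ∧
    Progress b s (s.afterServer sid (storageParty k .server l ev).1
      (storageParty k .server l ev).2) := by
  have hd : s.active ≠ .main := by rw [ha]; rintro ⟨⟩
  have hpos := Active.rank_server_pos sid ev
  rw [← ha] at hpos
  generalize (storageParty k .server l ev).1 = l'
  cases hf : (storageParty k .server l ev).2 with
  | halt =>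
    rcases sid with ⟨_ | _, j⟩
    · refine h.activate hd rfl rfl (List.length_modify ..)
        (List.forall_mem_modify (by intro _ h; exact h) h.clients _)
        (List.map_modify_of_eq _ _ (by intro _; rfl) _ _) h.y_reachable h.y_input rfl rfl
        (by rintro ⟨⟩) (lt_of_lt_of_le (show 0 < 3 by decide) hpos)
    · refine h.activate hd rfl rfl rfl h.clients rfl h.y_reachable h.y_input rfl
        (List.map_modify_of_eq _ _ (by intro _; rfl) _ _)
        (by rintro ⟨⟩) (lt_of_lt_of_le (show 0 < 3 by decide) hpos)
  | send m =>
    rcases sid with ⟨_ | _, j⟩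
    · refine h.activate hd rfl rfl ((List.length_modify ..).trans (List.length_modify ..))
        (List.forall_mem_modify (by
          intro e h
          refine ⟨h.1.write _ _ _, ?_⟩
          rw [ITM.Config.inputLength_write_of_ne _ (by decide)]
          exact h.2)
          (List.forall_mem_modify (by intro _ h; exact h) h.clients _) _)
        ((List.map_modify_of_eq _ _ (by intro _; rfl) _ _).trans
          (List.map_modify_of_eq _ _ (by intro _; rfl) _ _))
        h.y_reachable h.y_input rfl rfl (by rintro ⟨⟩) (lt_of_lt_of_le (show 1 < 3 by decide) hpos)
    · refine h.activate hd rfl rfl rfl h.clients rfl h.y_reachable h.y_input rfl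
        ((List.map_modify_of_eq _ _ (by intro _; rfl) _ _).trans
          (List.map_modify_of_eq _ _ (by intro _; rfl) _ _))
        (by rintro ⟨⟩) (lt_of_lt_of_le (show 2 < 3 by decide) hpos)
  | output m =>
    obtain ⟨m', rfl⟩ := storageParty_output hf
    have hr : 4 < s.active.rank := by rw [ha]; exact Nat.lt_succ_self 4
    rcases sid with ⟨_ | _, j⟩
    · exact h.activate hd rfl rfl (List.length_modify ..)
        (List.forall_mem_modify (by intro _ h; exact h) h.clients _)
        (List.map_modify_of_eq _ _ (by intro _; rfl) _ _) h.y_reachable h.y_input rfl rfl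
        (by rintro ⟨⟩) hr
    · exact h.activate hd rfl rfl rfl h.clients rfl h.y_reachable h.y_input rfl
        (List.map_modify_of_eq _ _ (by intro _; rfl) _ _)
        (by rintro ⟨⟩) hr

theorem Running.afterClientY {b : ℕ} {s : World contentCollector Z Y} (h : Running secp s)
    {j : ℕ} {ev : Event} (ha : s.active = .clientY j ev) (k : Kind) (l : Stage) :
    Running secp (s.afterClientY j (storageParty k .client l ev).1
      (storageParty k .client l ev).2) ∧
    Progress b s (s.afterClientY j (storageParty k .client l ev).1
      (storageParty k .client l ev).2) := by
  have hd : s.active ≠ .main := by rw [ha]; rintro ⟨⟩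
  have hpos := Active.rank_clientY_pos j ev
  rw [← ha] at hpos
  generalize (storageParty k .client l ev).1 = l'
  cases hf : (storageParty k .client l ev).2 with
  | halt =>
    exact h.activate hd rfl rfl rfl h.clients rfl h.y_reachable h.y_input rfl
      (List.map_modify_of_eq _ _ (by intro _; rfl) _ _)
      (by rintro ⟨⟩) (lt_of_lt_of_le (show 0 < 2 by decide) hpos)
  | send m =>
    obtain ⟨m', rfl⟩ := storageParty_client_send hf
    have hr : 5 < s.active.rank := by rw [ha]; exact Nat.lt_succ_self 5
    exact h.activate hd rfl rfl rfl h.clients rfl h.y_reachable h.y_input rfl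
      (List.map_modify_of_eq _ _ (by intro _; rfl) _ _) (by rintro ⟨⟩) hr
  | output m =>
    have hy : (s.y.write .reports (identOf j ++ m ++ [none])).inputLength = secp :=
      (ITM.Config.inputLength_write_of_ne _ (by decide) _).trans h.y_input
    obtain ⟨phase, active, z, y, x, control, unread, zs, ys⟩ := s
    dsimp only [World.afterClientY]
    cases phase with
    | alive =>
      exact h.activate hd rfl rfl rfl h.clients rfl (h.y_reachable.write _ _ _) hy rfl
        (List.map_modify_of_eq _ _ (by intro _; rfl) _ _) (fun _ => rfl)
        (lt_of_lt_of_le (show 1 < 2 by decide) hpos)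
    | _ =>
      exact h.activate hd rfl rfl rfl h.clients rfl (h.y_reachable.write _ _ _) hy rfl
        (List.map_modify_of_eq _ _ (by intro _; rfl) _ _) (by rintro ⟨⟩)
        (lt_of_lt_of_le (show 0 < 2 by decide) hpos)

theorem Running.afterX {b : ℕ} {s : World contentCollector Z Y} (h : Running secp s)
    (ha : s.active = .X) (r : Content × Option (ℕ × Msg)) :
    Running secp (s.afterX r) ∧ Progress b s (s.afterX r) := by
  have hd : s.active ≠ .main := by rw [ha]; rintro ⟨⟩
  have hr : s.active.rank = 4 := by rw [ha]; rfl
  have hmain : Running secp ({ s with x := r.1, unread := s.unread.tail, active := .main } :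
      World contentCollector Z Y) ∧
      Progress b s { s with x := r.1, unread := s.unread.tail, active := .main } :=
    h.activate (s' := { s with x := r.1, unread := s.unread.tail, active := .main }) hd rfl rfl rfl
      h.clients rfl h.y_reachable h.y_input rfl rfl (by rintro ⟨⟩)
      (by rw [hr]; exact Nat.zero_lt_succ 3)
  rcases r with ⟨x, _ | ⟨i, m⟩⟩
  · exact hmain
  · unfold World.afterX
    dsimp only
    cases s.control[i]? with
    | none => exact hmain
    | some sid =>
      exact h.activate hd rfl rfl rfl h.clients rfl h.y_reachable h.y_input rfl rfl
        (by rintro ⟨⟩) (by rw [hr]; exact Nat.lt_succ_self 3)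

theorem Running.procedure {b : ℕ} {s s' : World contentCollector Z Y} (h : Running secp s)
    (hz : s'.z = s.z) (hzs : s'.zs = s.zs) (hy : Y.Reachable secp s'.y)
    (hyi : s'.y.inputLength = secp) (hyt : s'.y.time = s.y.time) (ha : s'.active ≠ .Y)
    (hm : s'.phase = .done → s'.active = .main) (hcost : s'.cost b < s.cost b) :
    Running secp s' ∧ Progress b s s' := by
  refine ⟨⟨hz ▸ h.z_reachable, hz ▸ h.z_input, hz ▸ hzs ▸ h.zs_length, ?_, hy, hyi,
    fun h' => absurd h' ha, hm⟩, .inr (.inr ⟨?_, hcost⟩)⟩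
  · rw [hz, hzs]
    exact h.clients
  · rw [coins, coins, hz, hyt, hzs]

theorem Running.procedure_phase {b : ℕ} {s : World contentCollector Z Y} (h : Running secp s)
    (ha : s.active = .main) {phase : Phase}
    (hcost : phase.cost b s.y.time (s.ys.map Session.kind) < s.cost b) :
    Running secp ({ s with phase := phase } : World contentCollector Z Y) ∧
      Progress b s { s with phase := phase } :=
  h.procedure (s' := { s with phase := phase }) rfl rfl h.y_reachable h.y_input rfl
    (by rw [ha]; rintro ⟨⟩) (fun _ => ha) hcost

theorem Running.terminate {b : ℕ} {s s' : World contentCollector Z Y} (h : Running secp s)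
    (ha : s.active = .main) (hp : s.phase ≠ .alive) (hd : s.phase ≠ .done)
    (hs : s' ∈ (s.step secp).support) : Running secp s' ∧ Progress b s s' := by
  rw [step_of_main ha] at hs
  have next {phase phase' : Phase} (hph : s.phase = phase) (hs : s' = { s with phase := phase' })
      (hcost : phase'.cost b s.y.time (s.ys.map Session.kind) <
        phase.cost b s.y.time (s.ys.map Session.kind)) : Running secp s' ∧ Progress b s s' := by
    rw [hs]
    refine h.procedure_phase ha ?_
    rw [cost, hph]
    exact hcost
  have hlen : (s.ys.map Session.kind).length = s.ys.length := List.length_map ..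
  cases hph : s.phase with
  | alive => exact absurd hph hp
  | done => exact absurd hph hd
  | runPi n =>
    rw [hph] at hs
    dsimp only at hs
    cases he : s.ys[n]? with
    | none =>
      rw [he] at hs
      refine next hph ((PMF.mem_support_pure_iff _ _).1 hs) ?_
      simp only [Phase.cost, List.drop_zero]
      omega
    | some e =>
      rw [he] at hs
      dsimp only at hs
      rw [wakeUntilHalt_eq he ha, ite_self] at hs
      refine next hph ((PMF.mem_support_pure_iff _ _).1 hs) ?_
      have := (List.getElem?_eq_some_iff.1 he).1
      simp only [Phase.cost]
      omega
  | runDel n =>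
    rw [hph] at hs
    dsimp only at hs
    cases he : s.ys[n]? with
    | none =>
      rw [he] at hs
      refine next hph ((PMF.mem_support_pure_iff _ _).1 hs) ?_
      simp only [Phase.cost]
      omega
    | some e =>
      rw [he] at hs
      dsimp only at hs
      rw [wakeUntilHalt_eq he ha, ite_self] at hs
      refine next hph ((PMF.mem_support_pure_iff _ _).1 hs) ?_
      have := (List.getElem?_eq_some_iff.1 he).1
      simp only [Phase.cost]
      omega
  | request n =>
    rw [hph] at hs
    dsimp only at hs
    split_ifs at hs with hn
    · have hdrop : (s.ys.map Session.kind).drop n =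
          s.ys[n].kind :: (s.ys.map Session.kind).drop (n + 1) := by
        rw [List.drop_eq_getElem_cons (by omega), List.getElem_map]
      have hw : 1 ≤ s.ys[n].kind.weight := by cases s.ys[n].kind <;> decide
      have hskip : (Phase.request (n + 1)).cost b s.y.time (s.ys.map Session.kind) <
          (Phase.request n).cost b s.y.time (s.ys.map Session.kind) := by
        simp only [Phase.cost, hdrop, List.map_cons, List.sum_cons]
        omega
      cases ht : s.tokenOf n with
      | none =>
        rw [ht] at hs
        exact next hph ((PMF.mem_support_pure_iff _ _).1 hs) hskip
      | some t =>
        rw [ht] at hs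
        dsimp only at hs
        split_ifs at hs with hr
        · exact next hph ((PMF.mem_support_pure_iff _ _).1 hs) hskip
        · rw [(PMF.mem_support_pure_iff _ _).1 hs]
          -- Only instances of `π` have tokens, so weight 3 is available: it covers the added
          -- length, the added weight 1, and a strict decrease.
          have hk : s.ys[n].kind = .pi := by
            unfold tokenOf at ht
            rw [List.getElem?_eq_getElem hn] at ht
            dsimp only at ht
            split_ifs at ht with hk
            exact hk
          refine h.procedure rfl rfl (h.y_reachable.write _ _ _)
            ((ITM.Config.inputLength_write_of_ne _ (by decide) _).trans h.y_input) rfl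
            (by rintro ⟨⟩) (by rintro ⟨⟩) ?_
          rw [cost, cost, hph]
          dsimp only [inputY, openY]
          rw [List.map_modify_of_eq _ _ (by intro _; rfl), List.map_append]
          simp only [Phase.cost, hdrop, List.map_cons, List.map_nil, List.sum_cons,
            List.length_append, List.length_singleton]
          rw [List.drop_append_of_le_length (by omega), List.map_append, List.sum_append, hk]
          simp only [List.map_cons, List.map_nil, List.sum_singleton, Kind.weight]
          omega
    · refine next hph ((PMF.mem_support_pure_iff _ _).1 hs) ?_
      simp only [Phase.cost]
      omega

theorem Running.step {b : ℕ} {s s' : World contentCollector Z Y} (h : Running secp s)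
    (hb : ∀ d, Y.Reachable secp d → d.inputLength = secp → d.time ≤ b) (hd : s.phase ≠ .done)
    (hs : s' ∈ (s.step secp).support) : Running secp s' ∧ Progress b s s' := by
  cases ha : s.active with
  | main =>
    by_cases hp : s.phase = .alive
    · rw [step_of_alive secp ha hp] at hs
      obtain ⟨coin, -, rfl⟩ := (PMF.mem_support_map_iff _ _ _).1 hs
      exact h.stepZ hp ha coin
    · exact h.terminate ha hp hd hs
  | X =>
    rw [step_of_X secp ha, stepX_eq] at hs
    obtain ⟨r, -, rfl⟩ := (PMF.mem_support_map_iff _ _ _).1 hs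
    exact h.afterX ha r
  | Y =>
    rw [step_of_Y secp ha] at hs
    obtain ⟨coin, -, rfl⟩ := (PMF.mem_support_map_iff _ _ _).1 hs
    exact h.stepY hb ha coin
  | clientZ j =>
    rw [step_of_clientZ secp ha] at hs
    obtain ⟨coin, -, rfl⟩ := (PMF.mem_support_map_iff _ _ _).1 hs
    exact h.stepClientZ ha coin
  | clientY j ev =>
    rw [step_of_clientY secp ha] at hs
    rw [(PMF.mem_support_pure_iff _ _).1 hs]
    cases s.ys[j]? with
    | none =>
      refine h.main_of_active ?_
      rw [ha]
      exact lt_of_lt_of_le (by decide) (Active.rank_clientY_pos j ev)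
    | some e => exact h.afterClientY ha _ _
  | server sid ev =>
    rw [step_of_server secp ha] at hs
    rw [(PMF.mem_support_pure_iff _ _).1 hs]
    cases s.serverOf sid with
    | none =>
      refine h.main_of_active ?_
      rw [ha]
      exact lt_of_lt_of_le (by decide) (Active.rank_server_pos sid ev)
    | some e => exact h.afterServer ha _ _

end World

/-! ### The termination measure and its consequences -/

namespace World

variable {Z : Environment} {Y : Requester} {secp : ℕ}

/-- Bounds for the numbers of steps of the environment, of the deletion-requester and of each client
of the environment. -/
structure TimeBound (Z : Environment) (Y : Requester) (secp a b c : ℕ) : Prop where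
  environment : ∀ d, Z.machine.Reachable secp d → d.inputLength = secp → d.time ≤ a
  requester : ∀ d, Y.Reachable secp d → d.inputLength = secp → d.time ≤ b
  client : ∀ k d, (Z.client k).Reachable secp d → d.inputLength ≤ secp + 2 * a → d.time ≤ c

variable {a b c : ℕ}

/-- The environment has at most as many clients as it has made steps, and the lengths of their
inputs are bounded by its running time. -/
theorem Running.coins_le {s : World contentCollector Z Y} (h : Running secp s)
    (ht : TimeBound Z Y secp a b c) : s.coins ≤ a + b + a * c := by
  have hz := ht.environment _ h.z_reachable h.z_input
  have hy := ht.requester _ h.y_reachable h.y_input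
  have hc : (s.zs.map fun e => e.client.2.time).sum ≤ s.zs.length * c := by
    have := List.sum_le_card_nsmul (s.zs.map fun e => e.client.2.time) c (by
      intro t ht'
      obtain ⟨e, he, rfl⟩ := List.mem_map.1 ht'
      obtain ⟨h₁, h₂⟩ := h.clients e he
      exact ht.client _ _ h₁ (by omega))
    simpa using this
  have : s.zs.length * c ≤ a * c := Nat.mul_le_mul_right _ (h.zs_length.trans hz)
  unfold coins
  omega

/-- A bound on the number of steps until the end of the execution. -/
def remaining (n b : ℕ) (s : World contentCollector Z Y) : ℕ :=
  -- The rank is at most 6, so the factor 7 lets a machine step or a step of the procedure outweigh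
  -- any increase of the rank.
  7 * (n - s.coins) + s.active.rank + 7 * s.cost b

theorem Running.remaining_lt {s s' : World contentCollector Z Y} (h : Running secp s)
    (ht : TimeBound Z Y secp a b c) (hd : s.phase ≠ .done) (hs : s' ∈ (s.step secp).support) :
    s'.remaining (a + b + a * c) b < s.remaining (a + b + a * c) b := by
  obtain ⟨h', hp⟩ := h.step ht.requester hd hs
  have := h'.coins_le ht
  have := s'.active.rank_le
  unfold remaining
  rcases hp with ⟨_, _⟩ | ⟨_, _, _⟩ | ⟨_, _⟩ <;> omega

theorem step_of_done {s : World contentCollector Z Y} (hd : s.phase = .done)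
    (ha : s.active = .main) : s.step secp = PMF.pure s := by
  rw [step_of_main ha, hd]

theorem Running.of_step {s s' : World contentCollector Z Y} (h : Running secp s)
    (ht : TimeBound Z Y secp a b c) (hs : s' ∈ (s.step secp).support) : Running secp s' := by
  by_cases hd : s.phase = .done
  · rw [step_of_done hd (h.main hd)] at hs
    rwa [(PMF.mem_support_pure_iff _ _).1 hs]
  · exact (h.step ht.requester hd hs).1

theorem Running.value_congr {g g' : World contentCollector Z Y → ℝ≥0∞}
    (ht : TimeBound Z Y secp a b c) (hg : ∀ s, Running secp s → g s = g' s) (T : ℕ)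
    {s : World contentCollector Z Y} (h : Running secp s) : value secp g T s = value secp g' T s := by
  induction T generalizing s with
  | zero => exact hg s h
  | succ T ih => exact PMF.expect_congr fun s' hs => ih (h.of_step ht hs)

theorem Running.value_eq_one {g : World contentCollector Z Y → ℝ≥0∞}
    (ht : TimeBound Z Y secp a b c)
    (hg : ∀ s : World contentCollector Z Y, s.phase = .done → s.active = .main → g s = 1) (T : ℕ)
    {s : World contentCollector Z Y} (h : Running secp s)
    (hT : s.phase = .done ∨ s.remaining (a + b + a * c) b ≤ T) : value secp g T s = 1 := by
  induction T generalizing s with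
  | zero =>
    have hd : s.phase = .done := by
      -- Every phase except `done` has positive cost.
      refine hT.elim id fun hT => ?_
      unfold remaining cost at hT
      cases hp : s.phase with
      | done => rfl
      | _ =>
        rw [hp] at hT
        simp only [Phase.cost] at hT
        omega
    exact hg s hd (h.main hd)
  | succ T ih =>
    by_cases hd : s.phase = .done
    · rw [value, step_of_done hd (h.main hd), PMF.expect_pure]
      exact ih h (.inl hd)
    · refine PMF.expect_eq_const fun s' hs => ih (h.of_step ht hs) (.inr ?_)
      have := h.remaining_lt ht hd hs
      have := hT.resolve_left hd
      omega

variable (Z Y secp) in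
theorem running_start (x : Content) : Running secp (start contentCollector Z Y secp x) where
  z_reachable := .init
  z_input := ITM.Config.inputLength_init _
  zs_length := Nat.zero_le _
  clients := fun _ h => absurd h List.not_mem_nil
  y_reachable := .init
  y_input := ITM.Config.inputLength_init _
  alive := fun _ => rfl
  main := fun _ => rfl

variable (Z Y secp) in
theorem remaining_start (x : Content) (n b : ℕ) :
    (start contentCollector Z Y secp x).remaining n b ≤ 7 * (n + 5 * b + 4) := by
  unfold remaining cost
  simp only [start, Active.rank, Phase.cost, List.map_nil, List.length_nil]
  omega

variable (Z Y secp) in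
theorem goodWorld_start : GoodWorld (start contentCollector Z Y secp Content.empty) [] [] [] where
  control_Z := fun _ h => absurd h (Nat.not_lt_zero _)
  control_Y := fun _ h => absurd h (Nat.not_lt_zero _)
  mem_of_get := fun _ h => absurd rfl h
  mem_of_mem := fun _ h => absurd h List.not_mem_nil
  session := fun _ h => absurd h List.not_mem_nil
  pending := fun _ h => absurd h List.not_mem_nil

/-! ## The two executions compared -/

variable (Dict : Implementation StorageDict)

/-- The probability that `D` accepts, given the content of the dictionary and the view. -/
noncomputable def acceptance (D : Dict.Mem × View → Bool) (x : Content) (v : View) : ℝ≥0∞ :=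
  (contentMem Dict x).expect fun mem => if D (mem, v) = true then 1 else 0

theorem acceptance_add_not (D : Dict.Mem × View → Bool) (x : Content) (v : View) :
    acceptance Dict D x v + acceptance Dict (fun r => !D r) x v = 1 := by
  unfold acceptance
  rw [← PMF.expect_add]
  refine PMF.expect_eq_const fun mem _ => ?_
  cases h : D (mem, v) <;> simp [h]

/-- Requiring `main` to be active makes this reward `Terminal` for all configurations; in those
satisfying `Running`, it follows from `done`. -/
noncomputable def outcome (D : Dict.Mem × View → Bool) (s : World contentCollector Z Y) : ℝ≥0∞ :=
  match s.phase, s.active with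
  | .done, .main => acceptance Dict D s.x s.z.view
  | _, _ => 0

/-- Acceptance is decided at the end of the alive phase already, as `ZWorld` is frozen afterwards.
-/
noncomputable def _root_.ZWorld.outcome (D : Dict.Mem × View → Bool) (u : ZWorld Z) : ℝ≥0∞ :=
  if u.live = true then 0 else acceptance Dict D u.x u.z.view

theorem outcome_of_done {D : Dict.Mem × View → Bool} {s : World contentCollector Z Y}
    (hp : s.phase = .done) (ha : s.active = .main) :
    outcome Dict D s = acceptance Dict D s.x s.z.view := by
  unfold outcome
  rw [hp, ha]

theorem terminal_outcome (D : Dict.Mem × View → Bool) :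
    Terminal (outcome Dict D : World contentCollector Z Y → ℝ≥0∞) := by
  intro s hs
  unfold outcome
  split
  · rename_i hp ha
    exact (hs.elim (· hp) (· ha)).elim
  · rfl

theorem acceptance_le_one (D : Dict.Mem × View → Bool) (x : Content) (v : View) :
    acceptance Dict D x v ≤ 1 :=
  le_self_add.trans_eq (acceptance_add_not Dict D x v)

theorem outcome_le_one (D : Dict.Mem × View → Bool) (s : World contentCollector Z Y) :
    outcome Dict D s ≤ 1 := by
  unfold outcome
  split
  · exact acceptance_le_one Dict D _ _
  · exact zero_le

theorem outcome_le_forget (D : Dict.Mem × View → Bool) (s : World contentCollector Z Y)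
    (hp : s.phase = .done) : outcome Dict D s ≤ (s.forget []).outcome Dict D := by
  have h : (s.forget []).outcome Dict D = acceptance Dict D s.x s.z.view := by
    unfold ZWorld.outcome forget
    dsimp only
    rw [hp, Content.erase_eq_self (by simp)]
    exact if_neg (by decide)
  rw [h]
  unfold outcome
  split
  · exact le_rfl
  · exact zero_le

theorem _root_.ZWorld.outcome_add_not_le (D : Dict.Mem × View → Bool) (u : ZWorld Z) :
    u.outcome Dict D + u.outcome Dict (fun r => !D r) ≤ 1 := by
  unfold ZWorld.outcome
  split_ifs
  · simp
  · exact (acceptance_add_not Dict D _ _).le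

theorem value_outcome_add (ht : TimeBound Z Y secp a b c) (D : Dict.Mem × View → Bool) {T : ℕ}
    {s : World contentCollector Z Y} (h : Running secp s)
    (hT : s.remaining (a + b + a * c) b ≤ T) :
    value secp (outcome Dict D) T s + value secp (outcome Dict fun r => !D r) T s = 1 := by
  rw [← value_add]
  refine h.value_eq_one ht (fun s hp ha => ?_) T (.inr hT)
  rw [outcome_of_done Dict hp ha, outcome_of_done Dict hp ha, acceptance_add_not]

variable {Dict}

/-- The supremum over all times is attained at `T`. By then the probabilities of acceptance and
rejection add up to 1; both are nondecreasing in time, so neither can grow any more. -/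
theorem acceptProb_eq (hDict : Dict.HistoryIndependent) (ht : TimeBound Z Y secp a b c)
    (D : Dict.Mem × View → Bool) {T : ℕ} (hT : 7 * (a + b + a * c + 5 * b + 4) ≤ T) :
    acceptProb (storageCollector Dict) Z Y D secp =
      (value secp (outcome Dict D) T
        (start contentCollector Z Y secp Content.empty)).toReal := by
  set s := start contentCollector Z Y secp Content.empty with hs
  have hrun : Running secp s := running_start Z Y secp _
  have hrem := remaining_start Z Y secp Content.empty (a + b + a * c) b
  have hprob (T : ℕ) : ((execution (storageCollector Dict) Z Y secp T).map
      (accepted (C := storageCollector Dict) D)) true =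
      value secp (outcome Dict D) T s := by
    rw [PMF.map_true_eq_expect]
    refine (execution_expect secp
      (fun s => if accepted (C := storageCollector Dict) D s = true then 1 else 0) T 0).trans ?_
    rw [Nat.add_zero]
    change Dict.init.expect _ = _
    rw [← contentMem_empty hDict]
    refine (value_withMem secp hDict
      (fun s => if accepted (C := storageCollector Dict) D s = true then 1 else 0) T s).trans ?_
    refine hrun.value_congr ht (fun s' h' => ?_) T
    by_cases hp : s'.phase = .done
    · rw [outcome_of_done Dict hp (h'.main hp)]
      unfold acceptance
      congr 1
      funext mem
      have : accepted (C := storageCollector Dict) D (s'.withMem mem) = D (mem, s'.z.view) := by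
        unfold accepted
        rw [show (s'.withMem mem).phase = .done from hp]
        rfl
      rw [this]
    · rw [terminal_outcome Dict D s' (.inl hp)]
      refine PMF.expect_eq_const fun mem _ => if_neg ?_
      have hp' : (s'.withMem mem).phase ≠ .done := hp
      unfold accepted
      split
      · contradiction
      · exact Bool.false_ne_true
  unfold acceptProb
  congr 1
  refine le_antisymm (iSup_le fun T' => ?_) (le_iSup_of_le T (hprob T).ge)
  rw [hprob]
  have hmono (D : Dict.Mem × View → Bool) := value_mono secp (terminal_outcome Dict D) s
  refine (hmono D (le_max_right T T')).trans ?_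
  have h₁ := value_outcome_add Dict ht D hrun (hrem.trans hT)
  have h₂ := value_outcome_add Dict ht D hrun (hrem.trans (hT.trans (le_max_left T T')))
  have h₃ : value secp (outcome Dict fun r => !D r) T s ≤
    value secp (outcome Dict fun r => !D r) (max T T') s := hmono _ (le_max_left T T')
  have hfin : value secp (outcome Dict fun r => !D r) T s ≠ ⊤ :=
    ((value_le_one secp (outcome_le_one Dict _) T s).trans_lt ENNReal.one_lt_top).ne
  refine ENNReal.le_of_add_le_add_right hfin ?_
  rw [h₁, ← h₂]
  exact add_le_add_right h₃ _

/-- The upper bound for the negated distinguisher serves as the lower bound for `D`. The `ZWorld`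
value does not involve the requester, so it can be compared with the real and the ideal execution
alike. -/
theorem abs_acceptProb_sub_le (hDict : Dict.HistoryIndependent) (ht : TimeBound Z Y secp a b c)
    (D : Dict.Mem × View → Bool) {T : ℕ} (hT : 7 * (a + b + a * c + 5 * b + 4) ≤ T) :
    |acceptProb (storageCollector Dict) Z Y D secp -
      (ZWorld.value secp (ZWorld.outcome Dict D) T
        ⟨true, .main, Z.machine.init secp, Content.empty, []⟩).toReal| ≤
      (T : ℝ) ^ 2 / 2 ^ secp := by
  rw [acceptProb_eq hDict ht D hT]
  set s := start contentCollector Z Y secp Content.empty with hs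
  set u : ZWorld Z := ⟨true, .main, Z.machine.init secp, Content.empty, []⟩ with hu
  have hrun : Running secp s := running_start Z Y secp _
  have hrem := remaining_start Z Y secp Content.empty (a + b + a * c) b
  have hsum := value_outcome_add Dict ht D hrun (hrem.trans hT)
  have hsum' := ZWorld.value_add_le_one secp (ZWorld.outcome_add_not_le Dict D) T u
  have herr : (T : ℝ≥0∞) * (T * ((2 : ℝ≥0∞) ^ secp)⁻¹) =
      ENNReal.ofReal ((T : ℝ) ^ 2 / 2 ^ secp) := by
    rw [ENNReal.ofReal_div_of_pos (by positivity), ENNReal.ofReal_pow (by positivity),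
      ENNReal.ofReal_pow (by positivity), ENNReal.ofReal_natCast, ENNReal.ofReal_ofNat,
      ← mul_assoc, sq, div_eq_mul_inv]
  have hle (D : Dict.Mem × View → Bool) : value secp (outcome Dict D) T s ≤
      ZWorld.value secp (ZWorld.outcome Dict D) T u + ENNReal.ofReal ((T : ℝ) ^ 2 / 2 ^ secp) := by
    have hfor : s.forget [] = u := by
      rw [hs, hu]
      unfold forget start
      dsimp only
      rw [Content.erase_eq_self (by simp)]
      rfl
    -- Initially no string is in use, so `N = T` suffices and the error is `T * T / 2 ^ secp`.
    have := bounded (secp := secp) (h := ZWorld.outcome Dict D) (terminal_outcome Dict D)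
      (outcome_le_one Dict D) (fun u hu => if_pos hu) (outcome_le_forget Dict D) T T s [] [] (goodWorld_start Z Y secp)
      (.inl ⟨rfl, rfl⟩) (by simp)
    rw [hfor, herr] at this
    simpa [ZWorld.bound] using this
  have hW (D : Dict.Mem × View → Bool) :
      ZWorld.value secp (ZWorld.outcome Dict D) T u ≠ ⊤ := by
    refine (lt_of_le_of_lt (le_self_add.trans
      (ZWorld.value_add_le_one secp (ZWorld.outcome_add_not_le Dict D) T u)) ENNReal.one_lt_top).ne
  have hV (D : Dict.Mem × View → Bool) : value secp (outcome Dict D) T s ≠ ⊤ :=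
    ((value_le_one secp (outcome_le_one Dict _) T s).trans_lt ENNReal.one_lt_top).ne
  have hle' (D : Dict.Mem × View → Bool) : (value secp (outcome Dict D) T s).toReal ≤
      (ZWorld.value secp (ZWorld.outcome Dict D) T u).toReal + (T : ℝ) ^ 2 / 2 ^ secp := by
    have h := ENNReal.toReal_mono (ENNReal.add_ne_top.2 ⟨hW D, ENNReal.ofReal_ne_top⟩) (hle D)
    rwa [ENNReal.toReal_add (hW D) ENNReal.ofReal_ne_top,
      ENNReal.toReal_ofReal (by positivity)] at h
  have h₁ := congrArg ENNReal.toReal hsum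
  rw [ENNReal.toReal_add (hV _) (hV _), ENNReal.toReal_one] at h₁
  have h₂ := ENNReal.toReal_mono ENNReal.one_ne_top hsum'
  rw [ENNReal.toReal_add (hW _) (hW _), ENNReal.toReal_one] at h₂
  have h₃ := hle' D
  have h₄ := hle' fun r => !D r
  rw [abs_le]
  constructor <;> linarith

end World

/-! ### Polynomial bounds and the theorem -/

theorem ITM.time_silent {κ : Type} {secp : ℕ} {d : (silent κ).Config}
    (hd : (silent κ).Reachable secp d) : d.time = 0 := by
  induction hd with
  | init => rfl
  | write c t m _ ih => exact ih
  | step c c' coin a _ h _ => cases h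

theorem negligible_div_two_pow (p : Polynomial ℝ) :
    Negligible fun n => p.eval (n : ℝ) / 2 ^ n := by
  have h : Asymptotics.SuperpolynomialDecay Filter.atTop (fun n : ℕ => (n : ℝ))
      fun n => ((2 : ℝ) ^ n)⁻¹ :=
    fun k => tendsto_pow_const_div_const_pow_of_one_lt k one_lt_two
  exact h.polynomial_mul p

/-- There are only finitely many client programs, so one exponent serves all of them. -/
theorem Environment.PPT.exists_pow {Z : Environment} (hZ : Z.PPT) :
    ∃ k, ∀ code secp d, (Z.client code).Reachable secp d → d.time ≤ (d.inputLength + 2) ^ k := by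
  choose k hk using fun code => (hZ.2 code).exists_pow
  have := Z.finCode
  obtain ⟨n, hn⟩ := (Set.finite_range k).bddAbove
  exact ⟨n, fun code secp d hd => (hk code secp d hd).trans
    (Nat.pow_le_pow_right (by omega) (hn ⟨code, rfl⟩))⟩

theorem exists_polynomial_advantage_le {Dict : Implementation StorageDict}
    (hDict : Dict.HistoryIndependent) {Z : Environment} (hZ : Z.PPT) {Y : Requester}
    (hY : Y.PPT) : ∃ p : Polynomial ℝ, ∀ (secp : ℕ)
      (D : (storageCollector Dict).State × View → Bool),
      advantage (storageCollector Dict) Z Y D secp ≤ p.eval (secp : ℝ) / 2 ^ secp := by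
  obtain ⟨i, hi⟩ := hZ.1.exists_pow
  obtain ⟨j, hj⟩ := hY.exists_pow
  obtain ⟨k, hk⟩ := hZ.exists_pow
  -- `a`, `b`, `c` bound the steps of the environment, of the requester and of each client, whose
  -- input has length at most `secp + 2 * a`; `t` bounds the initial value of `remaining`. The
  -- factor 2 in the final polynomial comes from the triangle inequality through `ZWorld`.
  let a : Polynomial ℕ := (.X + 2) ^ i
  let b : Polynomial ℕ := (.X + 2) ^ j
  let c : Polynomial ℕ := (.X + 2 * a + 2) ^ k
  let t : Polynomial ℕ := 7 * (a + b + a * c + 5 * b + 4)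
  refine ⟨(2 * t ^ 2).map (Nat.castRingHom ℝ), fun secp D => ?_⟩
  have ha : a.eval secp = (secp + 2) ^ i := by simp [a]
  have hb : b.eval secp = (secp + 2) ^ j := by simp [b]
  have hc : c.eval secp = (secp + 2 * a.eval secp + 2) ^ k := by simp [c]
  have ht : t.eval secp = 7 * (a.eval secp + b.eval secp + a.eval secp * c.eval secp +
      5 * b.eval secp + 4) := by simp [t]
  have hZ' : ∀ code d, (Z.client code).Reachable secp d →
      d.inputLength ≤ secp + 2 * a.eval secp → d.time ≤ c.eval secp := fun code d hd hl => by
    rw [hc]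
    exact (hk code secp d hd).trans (Nat.pow_le_pow_left (by omega) k)
  have hreal : World.TimeBound Z Y secp (a.eval secp) (b.eval secp) (c.eval secp) :=
    ⟨fun d hd hl => by rw [ha, ← hl]; exact hi _ d (hl.symm ▸ hd),
      fun d hd hl => by rw [hb, ← hl]; exact hj _ d (hl.symm ▸ hd), hZ'⟩
  have hideal : World.TimeBound Z (ITM.silent Unit) secp (a.eval secp) (b.eval secp)
      (c.eval secp) :=
    ⟨hreal.environment, fun d hd _ => (ITM.time_silent hd).trans_le (Nat.zero_le _), hZ'⟩
  have h₁ := World.abs_acceptProb_sub_le hDict hreal D ht.ge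
  have h₂ := World.abs_acceptProb_sub_le hDict hideal D ht.ge
  have heval : ((2 * t ^ 2).map (Nat.castRingHom ℝ)).eval (secp : ℝ) =
      2 * ((t.eval secp : ℕ) : ℝ) ^ 2 := by
    rw [Polynomial.eval_natCast_map]
    simp
  rw [heval, mul_div_assoc, two_mul]
  exact (abs_sub_le _ _ _).trans (add_le_add h₁ ((abs_sub_comm _ _).trans_le h₂))

theorem theorem3p1 (Dict : Implementation StorageDict) (hDict : Dict.HistoryIndependent) :
    StatisticallyDeletionCompliant (storageCollector Dict) ∧
    ∀ Z : Environment, Z.PPT → ∀ Y : Requester, Y.PPT →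
      ∃ p : Polynomial ℝ, ∀ (secp : ℕ) (D : (storageCollector Dict).State × View → Bool),
        advantage (storageCollector Dict) Z Y D secp ≤ p.eval (secp : ℝ) / 2 ^ secp := by
  exact ⟨fun Z hZ Y hY D =>
    have ⟨p, hp⟩ := exists_polynomial_advantage_le hDict hZ hY
    ⟨_, negligible_div_two_pow p, fun secp => hp secp D⟩,
    fun Z hZ Y hY => exists_polynomial_advantage_le hDict hZ hY⟩
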